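/- Let $A$ be a $\mathbb{C}$-algebra with an idempotent $e$, put $A_{\mathrm{con}} = A/AeA$, and let $i^* = -\otimes_A A_{\mathrm{con}}$ be extension of scalars from right $A$-modules to right $A_{\mathrm{con}}$-modules. Let $S_1,\dots,S_t$ be pairwise non-isomorphic finite-dimensional simple right $A$-modules with $S_j e = 0$ (i.e. they are $A_{\mathrm{con}}$-modules). Let $n$ be such that for each $j$ there is a complex of finitely generated projective $A$-modules $$Q^j = (0\to Q^j_{n-1}\to\cdots\to Q^j_1\to Q^j_0\to 0),$$ with $Q^j_k$ in cohomological degree $-k$, which is a projective resolution of $S_j$, and such that $P^j := i^*Q^j$ satisfies $H^{-k}(P^j)\cong i^*S_j$ for $k\in\{0,n-1\}$ and $H^{-k}(P^j)=0$ for all other $k$. Let $\mathcal{B}$ be the DG-category with objects $1,\dots,t$ and complexes of morphisms $(i,j)\mapsto \mathcal{H}om_A(Q^i,Q^j)$, and let $\mathcal{A}$ be the DG-category with objects $1,\dots,t$ and complexes of morphisms $(i,j)\mapsto \mathcal{H}om_{A_{\mathrm{con}}}(P^i,P^j)$. Then $\mathcal{A}$ has a strictly unital minimal model, that is, a strictly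 unital $A_\infty$-category $\mathcal{M}$ with $m_1=0$ together with strictly unital $A_\infty$-quasi-isomorphisms $\mathcal{M}\rightsquigarrow\mathcal{A}$ and $\mathcal{A}\rightsquigarrow\mathcal{M}$. For any such $\mathcal{M}$, let $\mathcal{N}_{\mathcal{A}}\subseteq\mathcal{M}$ be the unitally positive $A_\infty$-category of $\mathcal{A}$: it has the objects of $\mathcal{M}$, the morphism spaces $\mathbb{C}e_x\oplus \mathrm{Hom}^{>0}_{\mathcal{M}}(x,x)$ and, for $x\neq y$, $\mathrm{Hom}^{>0}_{\mathcal{M}}(x,y)$, where $e_x$ is the strict unit of $x$, and the $A_\infty$-operations of $\mathcal{M}$ restricted to these spaces. Then there is an $A_\infty$-quasi-isomorphism $\mathcal{B}\rightsquigarrow\mathcal{N}_{\mathcal{A}}$, i.e. an $A_\infty$-functor which is bijective on objects and whose linear component induces isomorphisms on the cohomology of all morphism spaces. -/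

import Mathlib

open CategoryTheory

universe u v u' v' w₁ w₂

/-! ### Composable chains of homogeneous morphisms -/

/-- A composable chain of homogeneous morphisms in a graded quiver `H` (`H x y p` being the
morphisms `x ⟶ y` of degree `p`).  It is written as a tensor word `f_n ⊗ ⋯ ⊗ f_1` in the order of
composition of functions: in `cons f c` the morphism `f` is the leftmost letter, applied last. -/
inductive Chain {O : Type u} (H : O → O → ℤ → Type v) (x : O) : O → Type (max u v)
  | nil : Chain H x x
  | cons {y z : O} {p : ℤ} (f : H y z p) (c : Chain H x y) : Chain H x z

/-- A word cut into consecutive blocks. -/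
inductive Blocks {O : Type u} (H : O → O → ℤ → Type v) (x : O) : O → Type (max u v)
  | nil : Blocks H x x
  | cons {y z : O} (b : Chain H y z) (β : Blocks H x y) : Blocks H x z

/-- A word cut into three consecutive subwords `left ⊗ mid ⊗ right`. -/
structure Split {O : Type u} (H : O → O → ℤ → Type v) (x z : O) where
  {y : O}
  {w : O}
  left : Chain H w z
  mid : Chain H y w
  right : Chain H x y

namespace Chain

variable {O : Type u} {H : O → O → ℤ → Type v}

/-- The number of letters. -/
def length {x : O} : ∀ {y : O}, Chain H x y → ℕ
  | _, nil => 0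
  | _, cons _ c => c.length + 1

/-- The total degree. -/
def deg {x : O} : ∀ {y : O}, Chain H x y → ℤ
  | _, nil => 0
  | _, cons (p := p) _ c => p + c.deg

/-- Concatenation of words. -/
def append {x y : O} : ∀ {z : O}, Chain H y z → Chain H x y → Chain H x z
  | _, nil, d => d
  | _, cons f c, d => cons f (c.append d)

/-- All ways of cutting a word into two consecutive (possibly empty) subwords. -/
def cuts {x : O} : ∀ {z : O}, Chain H x z → List (Σ y : O, Chain H y z × Chain H x y)
  | _, nil => [⟨x, nil, nil⟩]
  | z, cons f c => ⟨z, nil, cons f c⟩ :: c.cuts.map fun s => ⟨s.1, cons f s.2.1, s.2.2⟩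

/-- All ways of cutting a word into three consecutive (possibly empty) subwords. -/
def splits {x z : O} (c : Chain H x z) : List (Split H x z) :=
  c.cuts.flatMap fun s => s.2.2.cuts.map fun t => ⟨s.2.1, t.2.1, t.2.2⟩

/-- The cuttings of `f ⊗ c` into nonempty blocks that come from a given cutting of `c`: either `f`
is a block of its own, or it is added to the first block of `c`. -/
def pushBlocks {x y z : O} {p : ℤ} (f : H y z p) : Blocks H x y → List (Blocks H x z)
  | .nil => [.cons (cons f nil) .nil]
  | .cons b β => [.cons (cons f nil) (.cons b β), .cons (cons f b) β]

/-- All ways of cutting a word into nonempty consecutive blocks. -/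
def blockings {x : O} : ∀ {z : O}, Chain H x z → List (Blocks H x z)
  | _, nil => [.nil]
  | _, cons f c => c.blockings.flatMap fun β => pushBlocks f β

/-- The image of a word under a degree preserving map of morphisms. -/
def map {H' : O → O → ℤ → Type v'} (φ : ∀ {x y : O} {p : ℤ}, H x y p → H' x y p) {x : O} :
    ∀ {y : O}, Chain H x y → Chain H' x y
  | _, nil => nil
  | _, cons f c => cons (φ f) (c.map φ)

theorem length_append {x y : O} : ∀ {z : O} (c : Chain H y z) (d : Chain H x y),
    (c.append d).length = c.length + d.length
  | _, nil, d => (Nat.zero_add _).symm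
  | _, cons f c, d => by simp only [append, length, length_append c d]; omega

theorem length_cuts {x : O} : ∀ {z : O} (c : Chain H x z), ∀ s ∈ c.cuts,
    s.2.1.length + s.2.2.length = c.length
  | _, nil, s, h => by
    obtain rfl : s = _ := by simpa [cuts] using h
    rfl
  | _, cons f c, s, h => by
    simp only [cuts, List.mem_cons, List.mem_map] at h
    rcases h with rfl | ⟨a, h', rfl⟩
    · simp [length]
    · have := length_cuts c _ h'
      simp only [length]
      omega

theorem length_splits {x z : O} (c : Chain H x z) (s : Split H x z) (hs : s ∈ c.splits) :
    s.left.length + s.mid.length + s.right.length = c.length := by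
  simp only [splits, List.mem_flatMap, List.mem_map] at hs
  obtain ⟨a, ha, b, hb, rfl⟩ := hs
  have h₁ := length_cuts _ _ ha
  have h₂ := length_cuts _ _ hb
  simp only
  omega

section

variable {H' : O → O → ℤ → Type v'} (φ : ∀ {x y : O} {p : ℤ}, H x y p → H' x y p)

theorem length_map {x : O} : ∀ {y : O} (c : Chain H x y), (c.map φ).length = c.length
  | _, nil => rfl
  | _, cons _ c => congrArg (· + 1) (length_map c)

theorem deg_map {x : O} : ∀ {y : O} (c : Chain H x y), (c.map φ).deg = c.deg
  | _, nil => rfl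
  | _, cons (p := p) _ c => congrArg (p + ·) (deg_map c)

theorem append_map {x y : O} : ∀ {z : O} (c : Chain H y z) (d : Chain H x y),
    (c.append d).map φ = (c.map φ).append (d.map φ)
  | _, nil, _ => rfl
  | _, cons f c, d => congrArg (cons (φ f)) (append_map c d)

theorem cuts_map {x : O} : ∀ {z : O} (c : Chain H x z),
    (c.map φ).cuts = c.cuts.map fun s => ⟨s.1, s.2.1.map φ, s.2.2.map φ⟩
  | _, nil => rfl
  | _, cons f c => by
    simp only [map, cuts, cuts_map c, List.map_cons, List.map_map]
    rfl

end

/-- Either all letters of a word have positive degree, or some letter has not. -/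
theorem length_le_deg_or {x : O} : ∀ {z : O} (c : Chain H x z), (c.length : ℤ) ≤ c.deg ∨
    ∃ (y w : O) (p : ℤ) (a : Chain H w z) (f : H y w p) (b : Chain H x y),
      p ≤ 0 ∧ c = a.append (cons f b)
  | _, nil => Or.inl le_rfl
  | _, cons (y := y) (z := z) (p := p) f c => by
    rcases le_or_gt p 0 with hp | hp
    · exact Or.inr ⟨y, z, p, nil, f, c, hp, rfl⟩
    · rcases length_le_deg_or c with h | ⟨y', w', p', a, g, b, hp', rfl⟩
      · left
        simp only [length, deg]
        push_cast
        omega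
      · exact Or.inr ⟨y', w', p', cons f a, g, b, hp', rfl⟩

end Chain

namespace Split

variable {O : Type u} {H : O → O → ℤ → Type v}

/-- With `r`, `s`, `t` the lengths of the three subwords, this is the sign of the term
`(-1)^(r + s t) m (1^r ⊗ m_s ⊗ 1^t)`, including the Koszul sign `(-1)^((2 - s) |left|)` which
arises when it is evaluated on elements. -/
def sign {x z : O} (s : Split H x z) : ℤˣ :=
  ((s.left.length : ℤ) + s.mid.length * s.right.length + s.mid.length * s.left.deg).negOnePow

/-- The word `left ⊗ m_s(mid) ⊗ right`; here `m_s` has degree `2 - s`. -/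
def contract (m : ∀ {x y : O}, Chain H x y → ∀ q : ℤ, H x y q) {x z : O} (s : Split H x z) :
    Chain H x z :=
  s.left.append (.cons (m s.mid (s.mid.deg + 2 - s.mid.length)) s.right)

/-- The image of a cut word under a degree preserving map of morphisms. -/
def map {H' : O → O → ℤ → Type v'} (φ : ∀ {x y : O} {p : ℤ}, H x y p → H' x y p) {x z : O}
    (s : Split H x z) : Split H' x z :=
  ⟨s.left.map φ, s.mid.map φ, s.right.map φ⟩

theorem splits_map {H' : O → O → ℤ → Type v'} (φ : ∀ {x y : O} {p : ℤ}, H x y p → H' x y p)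
    {x z : O} (c : Chain H x z) : (c.map φ).splits = c.splits.map (Split.map φ) := by
  simp only [Chain.splits, Chain.cuts_map, List.flatMap_map, List.map_flatMap, List.map_map]
  rfl

theorem sign_map {H' : O → O → ℤ → Type v'} (φ : ∀ {x y : O} {p : ℤ}, H x y p → H' x y p)
    {x z : O} (s : Split H x z) : (s.map φ).sign = s.sign := by
  simp only [sign, map, Chain.length_map, Chain.deg_map]

end Split

namespace Blocks

variable {O : Type u} {H : O → O → ℤ → Type v}

/-- The number of blocks. -/
def count {x : O} : ∀ {y : O}, Blocks H x y → ℕ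
  | _, nil => 0
  | _, cons _ β => β.count + 1

/-- The total number of letters. -/
def length {x : O} : ∀ {y : O}, Blocks H x y → ℕ
  | _, nil => 0
  | _, cons b β => b.length + β.length

/-- The exponent of the sign of the term `m_r (f_{i_1} ⊗ ⋯ ⊗ f_{i_r})`, evaluated on the blocks
`b_1, …, b_r` of lengths `i_1, …, i_r`: it is the sum over `u` of
`(1 - i_u) * ((r - u) + |b_1| + ⋯ + |b_{u-1}|)`, where the part with `r - u` is the sign in the
identity of multilinear maps and the other part is the Koszul sign, as `f_i` has degree `1 - i`. -/
def signExp {x : O} : ∀ {y : O}, Blocks H x y → ℤ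
  | _, nil => 0
  | _, cons b β =>
    (1 - (b.length : ℤ)) * β.count + ((β.count : ℤ) - β.length) * b.deg + β.signExp

/-- The word `f(b_1) ⊗ ⋯ ⊗ f(b_r)`; here `f_i` has degree `1 - i`. -/
def image {O' : Type u'} {H' : O' → O' → ℤ → Type v'} (obj : O → O')
    (f : ∀ {x y : O}, Chain H x y → ∀ q : ℤ, H' (obj x) (obj y) q) {x : O} :
    ∀ {y : O}, Blocks H x y → Chain H' (obj x) (obj y)
  | _, nil => .nil
  | _, cons b β => .cons (f b (b.deg + 1 - b.length)) (β.image obj f)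

end Blocks

/-! ### `A_∞`-categories -/

/-- A (not necessarily unital) `A_∞`-category over `k`.  The graded space of morphisms from `x` to
`y` is the family `Hom x y p`, `p : ℤ`.  For a word `c = f_n ⊗ ⋯ ⊗ f_1`, the element `m c q` is the
component in degree `q` of `m_n (f_n ⊗ ⋯ ⊗ f_1)`, so it vanishes unless `q = |c| + 2 - n`.
There is no `m_0`. -/
structure AInfCat (k : Type w₁) [Field k] where
  Obj : Type u
  Hom : Obj → Obj → ℤ → Type v
  [addCommGroup : ∀ x y p, AddCommGroup (Hom x y p)]
  [module : ∀ x y p, Module k (Hom x y p)]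
  m : ∀ {x y : Obj}, Chain Hom x y → ∀ q : ℤ, Hom x y q
  m_nil : ∀ (x : Obj) (q : ℤ), m (.nil : Chain Hom x x) q = 0
  m_deg : ∀ {x y : Obj} (c : Chain Hom x y) (q : ℤ), q ≠ c.deg + 2 - c.length → m c q = 0
  m_add : ∀ {x y z w : Obj} {p : ℤ} (c : Chain Hom z w) (f g : Hom y z p) (d : Chain Hom x y)
    (q : ℤ), m (c.append (.cons (f + g) d)) q =
      m (c.append (.cons f d)) q + m (c.append (.cons g d)) q
  m_smul : ∀ {x y z w : Obj} {p : ℤ} (c : Chain Hom z w) (a : k) (f : Hom y z p)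
    (d : Chain Hom x y) (q : ℤ), m (c.append (.cons (a • f) d)) q = a • m (c.append (.cons f d)) q
  /-- The identities `∑ (-1)^(r + s t) m_{r+1+t} (1^r ⊗ m_s ⊗ 1^t) = 0`.  (The sum also has terms
  with `s = 0`, which vanish.) -/
  rel : ∀ {x y : Obj} (c : Chain Hom x y) (q : ℤ),
    (c.splits.map fun s => s.sign • m (s.contract m) q).sum = 0

attribute [instance] AInfCat.addCommGroup AInfCat.module

namespace AInfCat

variable {k : Type w₁} [Field k]

/-- Minimality: `m_1 = 0`. -/
def IsMinimal (C : AInfCat.{u, v} k) : Prop :=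
  ∀ {x y : C.Obj} {p : ℤ} (f : C.Hom x y p) (q : ℤ), C.m (.cons f .nil) q = 0

/-- The map `m_1`, as a linear map from degree `p` to degree `q` (zero unless `q = p + 1`). -/
def m₁ (C : AInfCat.{u, v} k) (x y : C.Obj) (p q : ℤ) : C.Hom x y p →ₗ[k] C.Hom x y q where
  toFun f := C.m (.cons f .nil) q
  map_add' f g := C.m_add .nil f g .nil q
  map_smul' a f := C.m_smul .nil a f .nil q

theorem m_zero (C : AInfCat.{u, v} k) {x y z w : C.Obj} {p : ℤ} (c : Chain C.Hom z w)
    (d : Chain C.Hom x y) (q : ℤ) : C.m (c.append (.cons (0 : C.Hom y z p) d)) q = 0 := by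
  simpa using C.m_smul c (0 : k) (0 : C.Hom y z p) d q

theorem m_one_congr (C : AInfCat.{u, v} k) {x y : C.Obj} (f : ∀ q : ℤ, C.Hom x y q) {p p' : ℤ}
    (h : p = p') (q : ℤ) : C.m (.cons (f p) .nil) q = C.m (.cons (f p') .nil) q := by
  rw [h]

/-- The cohomology in degree `p` of the graded space of morphisms from `x` to `y`, with respect to
the differential `m_1`. -/
abbrev cohomology (C : AInfCat.{u, v} k) (x y : C.Obj) (p : ℤ) : Type v :=
  LinearMap.ker (C.m₁ x y p (p + 1)) ⧸
    (LinearMap.range (C.m₁ x y (p - 1) p)).comap (LinearMap.ker (C.m₁ x y p (p + 1))).subtype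

end AInfCat

/-- A strictly unital `A_∞`-category. -/
structure UnitalAInfCat (k : Type w₁) [Field k] extends AInfCat.{u, v} k where
  one : ∀ x : Obj, Hom x x 0
  m_one_left : ∀ {x y : Obj} {p : ℤ} (f : Hom x y p), m (.cons (one y) (.cons f .nil)) p = f
  m_one_right : ∀ {x y : Obj} {p : ℤ} (f : Hom x y p), m (.cons f (.cons (one x) .nil)) p = f
  /-- `m_i` with `i ≠ 2` vanishes as soon as one of the arguments is a unit. -/
  m_one : ∀ {x y z : Obj} (c : Chain Hom y z) (d : Chain Hom x y) (q : ℤ),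
    (c.append (.cons (one y) d)).length ≠ 2 → m (c.append (.cons (one y) d)) q = 0

/-! ### `A_∞`-functors -/

/-- An `A_∞`-functor.  For a word `c = f_n ⊗ ⋯ ⊗ f_1`, the element `map c q` is the component in
degree `q` of `F_n (f_n ⊗ ⋯ ⊗ f_1)`, so it vanishes unless `q = |c| + 1 - n`. -/
structure AInfFunctor {k : Type w₁} [Field k] (C : AInfCat.{u, v} k) (D : AInfCat.{u', v'} k) where
  obj : C.Obj → D.Obj
  map : ∀ {x y : C.Obj}, Chain C.Hom x y → ∀ q : ℤ, D.Hom (obj x) (obj y) q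
  map_nil : ∀ (x : C.Obj) (q : ℤ), map (.nil : Chain C.Hom x x) q = 0
  map_deg : ∀ {x y : C.Obj} (c : Chain C.Hom x y) (q : ℤ), q ≠ c.deg + 1 - c.length → map c q = 0
  map_add : ∀ {x y z w : C.Obj} {p : ℤ} (c : Chain C.Hom z w) (f g : C.Hom y z p)
    (d : Chain C.Hom x y) (q : ℤ), map (c.append (.cons (f + g) d)) q =
      map (c.append (.cons f d)) q + map (c.append (.cons g d)) q
  map_smul : ∀ {x y z w : C.Obj} {p : ℤ} (c : Chain C.Hom z w) (a : k) (f : C.Hom y z p)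
    (d : Chain C.Hom x y) (q : ℤ),
      map (c.append (.cons (a • f) d)) q = a • map (c.append (.cons f d)) q
  /-- The identities
  `∑ (-1)^(r + s t) F_{r+1+t} (1^r ⊗ m_s ⊗ 1^t) = ∑ ± m_r (F_{i_1} ⊗ ⋯ ⊗ F_{i_r})`. -/
  rel : ∀ {x y : C.Obj} (c : Chain C.Hom x y) (q : ℤ),
    (c.splits.map fun s => s.sign • map (s.contract C.m) q).sum =
      (c.blockings.map fun β => β.signExp.negOnePow • D.m (β.image obj map) q).sum

namespace AInfFunctor

variable {k : Type w₁} [Field k] {C : AInfCat.{u, v} k} {D : AInfCat.{u', v'} k}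

theorem map_zero (F : AInfFunctor C D) {x y z w : C.Obj} {p : ℤ} (c : Chain C.Hom z w)
    (d : Chain C.Hom x y) (q : ℤ) : F.map (c.append (.cons (0 : C.Hom y z p) d)) q = 0 := by
  simpa using F.map_smul c (0 : k) (0 : C.Hom y z p) d q

/-- The map `F_1`, as a linear map in degree `p`. -/
def map₁ (F : AInfFunctor C D) (x y : C.Obj) (p : ℤ) :
    C.Hom x y p →ₗ[k] D.Hom (F.obj x) (F.obj y) p where
  toFun f := F.map (.cons f .nil) p
  map_add' f g := F.map_add .nil f g .nil p
  map_smul' a f := F.map_smul .nil a f .nil p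

theorem map_one_congr (F : AInfFunctor C D) {x y : C.Obj} (f : ∀ q : ℤ, C.Hom x y q) {p p' : ℤ}
    (h : p = p') (q : ℤ) : F.map (.cons (f p) .nil) q = F.map (.cons (f p') .nil) q := by
  rw [h]

/-- `m_1 ∘ F_1 = F_1 ∘ m_1`. -/
theorem map₁_m₁ (F : AInfFunctor C D) (x y : C.Obj) (p q : ℤ) (hpq : p + 1 = q)
    (f : C.Hom x y p) :
    D.m₁ (F.obj x) (F.obj y) p q (F.map₁ x y p f) = F.map₁ x y q (C.m₁ x y p q f) := by
  have h := F.rel (.cons f .nil) q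
  have h₁ (p' : ℤ) : F.map (.cons (0 : C.Hom y y p') (.cons f .nil)) q = 0 :=
    F.map_zero .nil (.cons f .nil) q
  have h₂ (p' : ℤ) : F.map (.cons f (.cons (0 : C.Hom x x p') .nil)) q = 0 :=
    F.map_zero (.cons f .nil) .nil q
  have h₃ := F.map_one_congr (fun q => C.m (.cons f .nil) q)
    (show p + 0 + 2 - ((0 + 1 : ℕ) : ℤ) = q by push_cast; omega) q
  have h₄ := D.m_one_congr (fun q => F.map (.cons f .nil) q)
    (show p + 0 + 1 - ((0 + 1 : ℕ) : ℤ) = p by push_cast; omega) q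
  have e : (Chain.cons f .nil).splits =
      [⟨.nil, .nil, .cons f .nil⟩, ⟨.nil, .cons f .nil, .nil⟩, ⟨.cons f .nil, .nil, .nil⟩] := rfl
  have e' : (Chain.cons f .nil).blockings = [.cons (.cons f .nil) .nil] := rfl
  rw [e, e'] at h
  simp only [List.map, List.sum_cons, List.sum_nil, Split.contract, C.m_nil] at h
  simp only [Chain.append, h₁, h₂, smul_zero, zero_add, add_zero] at h
  have s₁ : (⟨.nil, .cons f .nil, .nil⟩ : Split C.Hom x y).sign = 1 := by
    simp [Split.sign, Chain.length, Chain.deg]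
  have s₂ : (Blocks.cons (.cons f .nil) .nil : Blocks C.Hom x y).signExp = 0 := by
    simp [Blocks.signExp, Blocks.count, Blocks.length]
  rw [s₁, s₂, Int.negOnePow_zero, one_smul, one_smul] at h
  exact h₄.symm.trans (h.symm.trans h₃)

/-- The map on cohomology induced by `F_1`. -/
def cohomologyMap (F : AInfFunctor C D) (x y : C.Obj) (p : ℤ) :
    C.cohomology x y p →ₗ[k] D.cohomology (F.obj x) (F.obj y) p :=
  Submodule.mapQ _ _
    ((F.map₁ x y p).restrict (p := LinearMap.ker (C.m₁ x y p (p + 1)))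
      (q := LinearMap.ker (D.m₁ (F.obj x) (F.obj y) p (p + 1))) (fun f hf => by
        rw [LinearMap.mem_ker] at hf ⊢
        rw [F.map₁_m₁ x y p (p + 1) rfl, hf, _root_.map_zero]))
    (by
      rintro ⟨f, hf⟩ ⟨g, hg⟩
      exact ⟨F.map₁ x y (p - 1) g,
        (F.map₁_m₁ x y (p - 1) p (by omega) g).trans (congrArg (F.map₁ x y p) hg)⟩)

/-- An `A_∞`-functor is a quasi-isomorphism if it is bijective on objects and `F_1` induces
isomorphisms on the cohomology of the spaces of morphisms. -/
def IsQuasiIso (F : AInfFunctor C D) : Prop :=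
  Function.Bijective F.obj ∧
    ∀ (x y : C.Obj) (p : ℤ), Function.Bijective (F.cohomologyMap x y p)

end AInfFunctor

/-- Strict unitality of an `A_∞`-functor between strictly unital `A_∞`-categories. -/
structure AInfFunctor.IsStrictlyUnital {k : Type w₁} [Field k] {C : UnitalAInfCat.{u, v} k}
    {D : UnitalAInfCat.{u', v'} k} (F : AInfFunctor C.toAInfCat D.toAInfCat) : Prop where
  map_one : ∀ x : C.Obj, F.map (.cons (C.one x) .nil) 0 = D.one (F.obj x)
  map_one_eq_zero : ∀ {x y z : C.Obj} (c : Chain C.Hom y z) (d : Chain C.Hom x y) (q : ℤ),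
    (c.append (.cons (C.one y) d)).length ≠ 1 → F.map (c.append (.cons (C.one y) d)) q = 0

/-- A strictly unital minimal model of a strictly unital `A_∞`-category `C`: a strictly unital and
minimal `A_∞`-category with strictly unital `A_∞`-quasi-isomorphisms to and from `C`. -/
structure MinimalModel {k : Type w₁} [Field k] (C : UnitalAInfCat.{u, v} k) where
  cat : UnitalAInfCat.{u', v'} k
  isMinimal : cat.IsMinimal
  incl : AInfFunctor cat.toAInfCat C.toAInfCat
  incl_unital : incl.IsStrictlyUnital
  incl_quasiIso : incl.IsQuasiIso
  proj : AInfFunctor C.toAInfCat cat.toAInfCat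
  proj_unital : proj.IsStrictlyUnital
  proj_quasiIso : proj.IsQuasiIso

/-! ### The unitally positive `A_∞`-category -/

namespace UnitalAInfCat

variable {k : Type w₁} [Field k] (C : UnitalAInfCat.{u, v} k)

/-- The predicate "`f` is one of the units `e_x`". -/
inductive IsOne : ∀ {x y : C.Obj} {p : ℤ}, C.Hom x y p → Prop
  | one (x : C.Obj) : IsOne (C.one x)

/-- The graded subspaces `k e_x ⊕ Hom^{>0}(x, x)` and, for `x ≠ y`, `Hom^{>0}(x, y)`: everything in
positive degrees, the span of `e_x` in degree `0` of `Hom(x, x)`, and zero otherwise. -/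
def positivePart (x y : C.Obj) (p : ℤ) : Submodule k (C.Hom x y p) :=
  if 0 < p then ⊤ else Submodule.span k {f | C.IsOne f}

/-- The inclusion of `positivePart` on words. -/
abbrev positiveIncl {x y : C.Obj} (c : Chain (fun x y p => C.positivePart x y p) x y) :
    Chain C.Hom x y :=
  c.map fun f => f.1

theorem m_mem_positivePart {x y : C.Obj}
    (c : Chain (fun x y p => C.positivePart x y p) x y) (q : ℤ) :
    C.m (C.positiveIncl c) q ∈ C.positivePart x y q := by
  rcases lt_or_ge 0 q with hq | hq
  · simp [positivePart, hq]
  rcases c.length_le_deg_or with h | ⟨y', w', p', a, ⟨g, hg⟩, b, hp', rfl⟩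
  · rw [C.m_deg _ _ (by rw [Chain.deg_map, Chain.length_map]; omega)]
    exact Submodule.zero_mem _
  · have hg' : g ∈ Submodule.span k {f | C.IsOne f} := by
      simpa [positivePart, not_lt.2 hp'] using hg
    simp only [positiveIncl, Chain.append_map, Chain.map]
    clear hg
    induction hg' using Submodule.span_induction with
    | zero => rw [C.m_zero]; exact Submodule.zero_mem _
    | add f g _ _ hf hg => rw [C.m_add]; exact Submodule.add_mem _ hf hg
    | smul r f _ hf => rw [C.m_smul]; exact Submodule.smul_mem _ r hf
    | mem f hf =>
      cases hf with
      | one =>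
        by_cases hl : ((C.positiveIncl a).append (.cons (C.one _) (C.positiveIncl b))).length = 2
        · rw [Chain.length_append, Chain.length_map] at hl
          simp only [Chain.length, Chain.length_map] at hl
          rcases a with _ | ⟨f, _ | _⟩ <;> rcases b with _ | ⟨f', _ | _⟩ <;>
            simp only [Chain.length] at hl <;> try omega
          · rename_i p
            by_cases hpq : q = p
            · subst hpq
              exact (C.m_one_left f'.1).symm ▸ f'.2
            · refine (C.m_deg _ _ ?_).symm ▸ Submodule.zero_mem _
              simp only [Chain.append, Chain.map, Chain.deg, Chain.length]
              push_cast
              omega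
          · rename_i p
            by_cases hpq : q = p
            · subst hpq
              exact (C.m_one_right f.1).symm ▸ f.2
            · refine (C.m_deg _ _ ?_).symm ▸ Submodule.zero_mem _
              simp only [Chain.append, Chain.map, Chain.deg, Chain.length]
              push_cast
              omega
        · rw [C.m_one _ _ _ hl]
          exact Submodule.zero_mem _

theorem append_cons_m_congr {x y z w : C.Obj} (a : Chain C.Hom z w) (c : Chain C.Hom y z)
    (b : Chain C.Hom x y) {p p' : ℤ} (h : p = p') :
    a.append (.cons (C.m c p) b) = a.append (.cons (C.m c p') b) := by
  rw [h]

/-- The unitally positive `A_∞`-category of a strictly unital minimal `A_∞`-category `C`: the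
operations of `C`, restricted to the subspaces `positivePart`. -/
def unitallyPositive : AInfCat.{u, v} k where
  Obj := C.Obj
  Hom x y p := C.positivePart x y p
  m c q := ⟨C.m (C.positiveIncl c) q, C.m_mem_positivePart c q⟩
  m_nil x q := Subtype.ext (C.m_nil x q)
  m_deg c q h := Subtype.ext (C.m_deg _ q (by rwa [Chain.deg_map, Chain.length_map]))
  m_add c f g d q := Subtype.ext (by
    simp only [positiveIncl, Chain.append_map, Chain.map, Submodule.coe_add, C.m_add])
  m_smul c a f d q := Subtype.ext (by
    simp only [positiveIncl, Chain.append_map, Chain.map, Submodule.coe_smul, C.m_smul])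
  rel {x y} c q := by
    have h := C.rel (C.positiveIncl c) q
    rw [Split.splits_map, List.map_map] at h
    apply Subtype.ext
    refine (map_list_sum (Submodule.subtype (C.positivePart x y q)) _).trans ?_
    rw [List.map_map]
    refine Eq.trans (congrArg List.sum (List.map_congr_left fun s _ => ?_)) h
    simp only [Function.comp_apply, Split.sign_map]
    have e : C.positiveIncl (s.contract fun c q => ⟨C.m (C.positiveIncl c) q,
        C.m_mem_positivePart c q⟩) = (s.map fun f => f.1).contract C.m := by
      simp only [Split.contract, positiveIncl, Chain.append_map, Chain.map, Split.map]
      exact append_cons_m_congr _ _ _ _ (by rw [Chain.deg_map, Chain.length_map])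
    rcases Int.units_eq_one_or s.sign with hs | hs <;> simp [hs, ← e]

end UnitalAInfCat

/-! ### DG-categories -/

/-- A DG-category over `k`, with composition `comp _ g f = g ∘ f` of a morphism `g` of degree `p`
and a morphism `f` of degree `q`.  The map `d x y p q` is the differential if `q = p + 1`, and
zero otherwise. -/
structure DGCat (k : Type w₁) [Field k] where
  Obj : Type u
  Hom : Obj → Obj → ℤ → Type v
  [addCommGroup : ∀ x y p, AddCommGroup (Hom x y p)]
  [module : ∀ x y p, Module k (Hom x y p)]
  d : ∀ (x y : Obj) (p q : ℤ), Hom x y p →ₗ[k] Hom x y q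
  d_shape : ∀ (x y : Obj) (p q : ℤ), p + 1 ≠ q → d x y p q = 0
  d_d : ∀ {x y : Obj} (p q r : ℤ) (f : Hom x y p), d x y q r (d x y p q f) = 0
  comp : ∀ {x y z : Obj} {p q r : ℤ}, p + q = r → Hom y z p →ₗ[k] Hom x y q →ₗ[k] Hom x z r
  one : ∀ x : Obj, Hom x x 0
  d_one : ∀ (x : Obj) (q : ℤ), d x x 0 q (one x) = 0
  one_comp : ∀ {x y : Obj} {p : ℤ} (f : Hom x y p), comp (zero_add p) (one y) f = f
  comp_one : ∀ {x y : Obj} {p : ℤ} (f : Hom x y p), comp (add_zero p) f (one x) = f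
  assoc : ∀ {x y z w : Obj} {p q r pq qr pqr : ℤ} (h₁ : p + q = pq) (h₂ : q + r = qr)
    (h₃ : p + q + r = pqr) (h : Hom z w p) (g : Hom y z q) (f : Hom x y r),
      comp (by omega : pq + r = pqr) (comp h₁ h g) f =
        comp (by omega : p + qr = pqr) h (comp h₂ g f)
  leibniz : ∀ {x y z : Obj} {p q r : ℤ} (h : p + q = r) (g : Hom y z p) (f : Hom x y q),
    d x z r (r + 1) (comp h g f) =
      comp (by omega : p + 1 + q = r + 1) (d y z p (p + 1) g) f +
        p.negOnePow • comp (by omega : p + (q + 1) = r + 1) g (d x y q (q + 1) f)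

attribute [instance] DGCat.addCommGroup DGCat.module

namespace DGCat

variable {k : Type w₁} [Field k] (D : DGCat.{u, v} k)

/-- The operations `m_1 = d`, `m_2(g ⊗ f) = g ∘ f` and `m_n = 0` for `n ≥ 3`. -/
def m {x : D.Obj} : ∀ {y : D.Obj}, Chain D.Hom x y → ∀ q : ℤ, D.Hom x y q
  | _, .nil, _ => 0
  | _, .cons (p := p) f .nil, q => D.d _ _ p q f
  | _, .cons (p := p) g (.cons (p := p') f .nil), q =>
      if h : p + p' = q then D.comp h g f else 0
  | _, .cons _ (.cons _ (.cons _ _)), _ => 0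

theorem m_eq_zero {x y : D.Obj} : ∀ (c : Chain D.Hom x y) (q : ℤ), 3 ≤ c.length → D.m c q = 0
  | .nil, _, h => absurd h (by simp [Chain.length])
  | .cons _ .nil, _, h => absurd h (by simp [Chain.length])
  | .cons _ (.cons _ .nil), _, h => absurd h (by simp [Chain.length])
  | .cons _ (.cons _ (.cons _ _)), _, _ => rfl

theorem m_deg {x y : D.Obj} : ∀ (c : Chain D.Hom x y) (q : ℤ), q ≠ c.deg + 2 - c.length →
    D.m c q = 0
  | .nil, _, _ => rfl
  | .cons (p := p) f .nil, q, h => by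
    have : p + 1 ≠ q := fun h' => h (by simp only [Chain.deg, Chain.length]; push_cast; omega)
    simp [m, D.d_shape _ _ _ _ this]
  | .cons (p := p) _ (.cons (p := p') _ .nil), q, h => by
    have : ¬ p + p' = q := fun h' => h (by simp only [Chain.deg, Chain.length]; push_cast; omega)
    simp [m, this]
  | .cons _ (.cons _ (.cons _ _)), _, _ => rfl

theorem m_add {x y z w : D.Obj} {p : ℤ} (c : Chain D.Hom z w) (f g : D.Hom y z p)
    (d : Chain D.Hom x y) (q : ℤ) : D.m (c.append (.cons (f + g) d)) q =
      D.m (c.append (.cons f d)) q + D.m (c.append (.cons g d)) q := by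
  by_cases h : 3 ≤ c.length + (d.length + 1)
  · have h' (f : D.Hom y z p) : D.m (c.append (.cons f d)) q = 0 :=
      D.m_eq_zero _ _ (by rwa [Chain.length_append])
    rw [h', h', h', add_zero]
  · cases d with
    | nil =>
      cases c with
      | nil => simp [Chain.append, m]
      | cons e c =>
        cases c with
        | nil => simp only [Chain.append, m]; split_ifs <;> simp
        | cons _ _ => exact absurd h (by simp only [Chain.length]; omega)
    | cons e d =>
      cases c with
      | nil =>
        cases d with
        | nil => simp only [Chain.append, m]; split_ifs <;> simp
        | cons _ _ => exact absurd h (by simp only [Chain.length]; omega)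
      | cons _ _ => exact absurd h (by simp only [Chain.length]; omega)

theorem m_smul {x y z w : D.Obj} {p : ℤ} (c : Chain D.Hom z w) (a : k) (f : D.Hom y z p)
    (d : Chain D.Hom x y) (q : ℤ) : D.m (c.append (.cons (a • f) d)) q =
      a • D.m (c.append (.cons f d)) q := by
  by_cases h : 3 ≤ c.length + (d.length + 1)
  · have h' (f : D.Hom y z p) : D.m (c.append (.cons f d)) q = 0 :=
      D.m_eq_zero _ _ (by rwa [Chain.length_append])
    rw [h', h', smul_zero]
  · cases d with
    | nil =>
      cases c with
      | nil => simp [Chain.append, m]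
      | cons e c =>
        cases c with
        | nil => simp only [Chain.append, m]; split_ifs <;> simp
        | cons _ _ => exact absurd h (by simp only [Chain.length]; omega)
    | cons e d =>
      cases c with
      | nil =>
        cases d with
        | nil => simp only [Chain.append, m]; split_ifs <;> simp
        | cons _ _ => exact absurd h (by simp only [Chain.length]; omega)
      | cons _ _ => exact absurd h (by simp only [Chain.length]; omega)

theorem m_zero {x y z w : D.Obj} {p : ℤ} (c : Chain D.Hom z w) (d : Chain D.Hom x y) (q : ℤ) :
    D.m (c.append (.cons (0 : D.Hom y z p) d)) q = 0 := by
  simpa using D.m_smul c (0 : k) (0 : D.Hom y z p) d q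

theorem m_contract_of_mid_nil {x y z : D.Obj} (c : Chain D.Hom y z) (d : Chain D.Hom x y) (q : ℤ) :
    D.m ((⟨c, .nil, d⟩ : Split D.Hom x z).contract D.m) q = 0 :=
  D.m_zero c d q

theorem m_d_left {x y z : D.Obj} {p p' : ℤ} (g : D.Hom y z p) (f : D.Hom x y p') {n : ℤ}
    (hn : n = p + 1) (q : ℤ) : D.m (.cons (D.m (.cons g .nil) n) (.cons f .nil)) q =
      if h : p + 1 + p' = q then D.comp h (D.d y z p (p + 1) g) f else 0 := by
  subst hn
  rfl

theorem m_d_right {x y z : D.Obj} {p p' : ℤ} (g : D.Hom y z p) (f : D.Hom x y p') {n : ℤ}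
    (hn : n = p' + 1) (q : ℤ) : D.m (.cons g (.cons (D.m (.cons f .nil) n) .nil)) q =
      if h : p + (p' + 1) = q then D.comp h g (D.d x y p' (p' + 1) f) else 0 := by
  subst hn
  rfl

theorem m_comp {x y z : D.Obj} {p p' : ℤ} (g : D.Hom y z p) (f : D.Hom x y p') (q : ℤ)
    (hq : p + p' = q) : D.m (.cons g (.cons f .nil)) q = D.comp hq g f :=
  dif_pos hq

theorem m_comp_of_ne {x y z : D.Obj} {p p' : ℤ} (g : D.Hom y z p) (f : D.Hom x y p') (q : ℤ)
    (hq : ¬ p + p' = q) : D.m (.cons g (.cons f .nil)) q = 0 :=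
  dif_neg hq

theorem m_comp_congr {x y z u : D.Obj} {p p' : ℤ} (g : D.Hom y z p) (f : D.Hom x y p') {n n' : ℤ}
    (hn : n = n') (d : Chain D.Hom u x) :
    Chain.cons (D.m (.cons g (.cons f .nil)) n) d =
      Chain.cons (D.m (.cons g (.cons f .nil)) n') d := by
  rw [hn]

theorem rel {x y : D.Obj} (c : Chain D.Hom x y) (q : ℤ) :
    (c.splits.map fun s => s.sign • D.m (s.contract D.m) q).sum = 0 := by
  by_cases h : 4 ≤ c.length
  · refine List.sum_eq_zero fun t ht => ?_
    obtain ⟨s, hs, rfl⟩ := List.mem_map.1 ht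
    have hl := c.length_splits s hs
    by_cases h3 : 3 ≤ s.mid.length
    · have : D.m (s.contract D.m) q = 0 := by
        rw [Split.contract, D.m_eq_zero s.mid _ h3]
        exact D.m_zero _ _ _
      rw [this, smul_zero]
    · rw [D.m_eq_zero _ _ (by
        rw [Split.contract, Chain.length_append]; simp only [Chain.length]; omega), smul_zero]
  · match c with
    | .nil =>
      have e : (.nil : Chain D.Hom x x).splits = [⟨.nil, .nil, .nil⟩] := rfl
      rw [e]
      simp [m_contract_of_mid_nil]
    | .cons (p := p) f .nil =>
      have e : (Chain.cons f .nil).splits =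
        [⟨.nil, .nil, .cons f .nil⟩, ⟨.nil, .cons f .nil, .nil⟩, ⟨.cons f .nil, .nil, .nil⟩] := rfl
      rw [e]
      simp only [List.map, List.sum_cons, List.sum_nil, m_contract_of_mid_nil]
      simp [Split.contract, Chain.append, m, D.d_d]
    | .cons (p := p) g (.cons (p := p') f .nil) =>
      have e : (Chain.cons g (.cons f .nil)).splits =
        [⟨.nil, .nil, .cons g (.cons f .nil)⟩, ⟨.nil, .cons g .nil, .cons f .nil⟩,
          ⟨.nil, .cons g (.cons f .nil), .nil⟩, ⟨.cons g .nil, .nil, .cons f .nil⟩,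
          ⟨.cons g .nil, .cons f .nil, .nil⟩, ⟨.cons g (.cons f .nil), .nil, .nil⟩] := rfl
      rw [e]
      simp only [List.map, List.sum_cons, List.sum_nil, m_contract_of_mid_nil, smul_zero, zero_add,
        add_zero]
      simp only [Split.contract, Chain.append]
      rw [D.m_d_left g f (by simp only [Chain.deg, Chain.length]; push_cast; omega) q,
        D.m_d_right g f (by simp only [Chain.deg, Chain.length]; push_cast; omega) q,
        D.m_comp_congr g f (n' := p + p')
          (by simp only [Chain.deg, Chain.length]; push_cast; omega), D.m_comp g f _ rfl]
      by_cases hq : p + p' + 1 = q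
      · subst hq
        rw [dif_pos (by omega), dif_pos (by omega)]
        have s₁ : (⟨.nil, .cons g .nil, .cons f .nil⟩ : Split D.Hom _ _).sign = -1 := by
          simp [Split.sign, Chain.length, Chain.deg]
        have s₂ : (⟨.nil, .cons g (.cons f .nil), .nil⟩ : Split D.Hom _ _).sign = 1 := by
          simp [Split.sign, Chain.length, Chain.deg]
        have s₃ : (⟨.cons g .nil, .cons f .nil, .nil⟩ : Split D.Hom _ _).sign = -p.negOnePow := by
          simp [Split.sign, Chain.length, Chain.deg, Int.negOnePow_add]
        rw [s₁, s₂, s₃, m, D.leibniz rfl g f, Units.neg_smul, Units.neg_smul, one_smul, one_smul]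
        abel
      · rw [dif_neg (by omega), dif_neg (by omega)]
        simp [m, D.d_shape _ _ _ _ hq]
    | .cons (p := p₃) h (.cons (p := p₂) g (.cons (p := p₁) f .nil)) =>
      have e : (Chain.cons h (.cons g (.cons f .nil))).splits =
        [⟨.nil, .nil, .cons h (.cons g (.cons f .nil))⟩,
          ⟨.nil, .cons h .nil, .cons g (.cons f .nil)⟩,
          ⟨.nil, .cons h (.cons g .nil), .cons f .nil⟩,
          ⟨.nil, .cons h (.cons g (.cons f .nil)), .nil⟩,
          ⟨.cons h .nil, .nil, .cons g (.cons f .nil)⟩,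
          ⟨.cons h .nil, .cons g .nil, .cons f .nil⟩,
          ⟨.cons h .nil, .cons g (.cons f .nil), .nil⟩,
          ⟨.cons h (.cons g .nil), .nil, .cons f .nil⟩,
          ⟨.cons h (.cons g .nil), .cons f .nil, .nil⟩,
          ⟨.cons h (.cons g (.cons f .nil)), .nil, .nil⟩] := rfl
      rw [e]
      simp only [List.map, List.sum_cons, List.sum_nil, m_contract_of_mid_nil, smul_zero, zero_add,
        add_zero]
      simp only [Split.contract, Chain.append]
      rw [D.m_comp_congr h g (n' := p₃ + p₂)
          (by simp only [Chain.deg, Chain.length]; push_cast; omega),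
        D.m_comp_congr g f (n' := p₂ + p₁)
          (by simp only [Chain.deg, Chain.length]; push_cast; omega)]
      rw [D.m_comp h g _ rfl, D.m_comp g f _ rfl]
      have z₁ (n : ℤ) : D.m (.cons (D.m (.cons h .nil) n) (.cons g (.cons f .nil))) q = 0 := rfl
      have z₂ (n : ℤ) : D.m (.cons h (.cons (D.m (.cons g .nil) n) (.cons f .nil))) q = 0 := rfl
      have z₃ (n : ℤ) : D.m (.cons h (.cons g (.cons (D.m (.cons f .nil) n) .nil))) q = 0 := rfl
      have z₄ (n : ℤ) : D.m (.cons (D.m (.cons h (.cons g (.cons f .nil))) n) .nil) q = 0 :=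
        D.m_zero .nil .nil q
      rw [z₁, z₂, z₃, z₄]
      simp only [smul_zero, zero_add, add_zero]
      by_cases hq : p₃ + p₂ + p₁ = q
      · rw [D.m_comp _ _ q hq, D.m_comp _ _ q (by omega), D.assoc rfl rfl hq]
        have s₁ : (⟨.nil, .cons h (.cons g .nil), .cons f .nil⟩ : Split D.Hom _ _).sign = 1 := by
          simp only [Split.sign, Chain.length, Chain.deg]
          exact Int.negOnePow_even _ ⟨1, by push_cast⟩
        have s₂ : (⟨.cons h .nil, .cons g (.cons f .nil), .nil⟩ : Split D.Hom _ _).sign = -1 := by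
          simp only [Split.sign, Chain.length, Chain.deg]
          exact Int.negOnePow_odd _ ⟨p₃, by push_cast; omega⟩
        rw [s₁, s₂, Units.neg_smul, one_smul, add_neg_cancel]
      · rw [D.m_comp_of_ne _ _ q hq, D.m_comp_of_ne _ _ q (by omega)]
        simp
    | .cons _ (.cons _ (.cons _ (.cons _ _))) =>
      exact absurd h (by simp only [Chain.length]; omega)

/-- A DG-category, regarded as a strictly unital `A_∞`-category. -/
def toAInf : UnitalAInfCat.{u, v} k where
  Obj := D.Obj
  Hom := D.Hom
  m := D.m
  m_nil x q := rfl
  m_deg := D.m_deg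
  m_add := D.m_add
  m_smul := D.m_smul
  rel := D.rel
  one := D.one
  m_one_left {x y p} f := by simp [m, D.one_comp]
  m_one_right {x y p} f := by simp [m, D.comp_one]
  m_one c d q h := by
    by_cases h3 : 3 ≤ (c.append (.cons (D.one _) d)).length
    · exact D.m_eq_zero _ _ h3
    · rw [Chain.length_append] at h h3
      match c, d with
      | .nil, .nil => exact D.d_one _ q
      | .cons _ _, _ => exact absurd h (by simp only [Chain.length] at *; omega)
      | .nil, .cons _ _ => exact absurd h (by simp only [Chain.length] at *; omega)

end DGCat

open CochainComplex.HomComplex in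
/-- The DG-category with set of objects `ι` and with complexes of morphisms
`(i, j) ↦ Hom(K i, K j)`, for a family `K` of complexes. -/
noncomputable def homDG (k : Type w₁) [Field k] {𝒞 : Type u} [Category.{v} 𝒞] [Preadditive 𝒞]
    [Linear k 𝒞] {ι : Type u'} (K : ι → CochainComplex 𝒞 ℤ) : DGCat.{u', v} k where
  Obj := ι
  Hom i j p := Cochain (K i) (K j) p
  d i j p q := δ_hom k (K i) (K j) p q
  d_shape i j p q h := by
    exact LinearMap.ext fun f => δ_shape p q h f
  d_d p q r f := δ_δ p q r f
  comp {i j l p q r} h := LinearMap.mk₂ k (fun g f => f.comp g (by omega))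
    (fun _ _ _ => by simp) (fun _ _ _ => by simp) (fun _ _ _ => by simp) (fun _ _ _ => by simp)
  one i := Cochain.ofHom (𝟙 (K i))
  d_one i q := δ_ofHom _
  one_comp f := f.comp_id
  comp_one f := f.id_comp
  assoc h₁ h₂ h₃ h g f :=
    (Cochain.comp_assoc f g h (by rw [add_comm, h₂]) (by rw [add_comm, h₁]) (by omega)).symm
  leibniz {i j l p q r} h g f := by
    refine (δ_comp f g (by omega) (q + 1) (p + 1) (r + 1) rfl rfl rfl).trans ?_
    rfl

/-! ### Idempotents and extension of scalars

Right `A`-modules are modules over `Aᵐᵒᵖ`. -/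

section Idempotent

open MulOpposite

variable {A : Type u} [Ring A] (e : A)

/-- The two-sided ideal `A e A`. -/
def idealAeA : Ideal A := Ideal.span {x | ∃ a b : A, x = a * e * b}

instance : (idealAeA e).IsTwoSided where
  mul_mem_of_left {x} b hx := by
    induction hx using Submodule.span_induction with
    | zero => rw [zero_mul]; exact Submodule.zero_mem _
    | add x y _ _ hx hy => rw [add_mul]; exact Submodule.add_mem _ hx hy
    | smul a x _ hx => rw [smul_eq_mul, mul_assoc]; exact Ideal.mul_mem_left _ a hx
    | mem x hx =>
      obtain ⟨a, a', rfl⟩ := hx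
      exact Submodule.subset_span ⟨a, a' * b, by simp only [mul_assoc]⟩

/-- The ring `A_con = A / A e A`. -/
abbrev Acon : Type u := A ⧸ idealAeA e

/-- The submodule `M · (A e A)` of a right `A`-module `M`. -/
def smulAeA (M : Type v) [AddCommGroup M] [Module Aᵐᵒᵖ M] : Submodule Aᵐᵒᵖ M :=
  Submodule.span Aᵐᵒᵖ {x | ∃ a ∈ idealAeA e, ∃ m : M, x = op a • m}

/-- The right `A_con`-module `M ⊗_A A_con`, in the form `M / M · (A e A)`. -/
abbrev ExtScalars (M : Type v) [AddCommGroup M] [Module Aᵐᵒᵖ M] : Type v := M ⧸ smulAeA e M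

/-- The right action of `A` on `M / M · (A e A)`, as a ring homomorphism. -/
def actionHom (M : Type v) [AddCommGroup M] [Module Aᵐᵒᵖ M] :
    A →+* (AddMonoid.End (ExtScalars e M))ᵐᵒᵖ where
  toFun a := op (Module.toAddMonoidEnd Aᵐᵒᵖ (ExtScalars e M) (op a))
  map_one' := by simp
  map_mul' a b := by simp
  map_zero' := by simp
  map_add' a b := by simp

theorem actionHom_eq_zero (M : Type v) [AddCommGroup M] [Module Aᵐᵒᵖ M] (a : A)
    (ha : a ∈ idealAeA e) : actionHom e M a = 0 := by
  refine unop_injective (AddMonoidHom.ext fun x => ?_)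
  obtain ⟨m, rfl⟩ := Submodule.Quotient.mk_surjective _ x
  exact (Submodule.Quotient.mk_eq_zero _).2 (Submodule.subset_span ⟨a, ha, m, rfl⟩)

/-- The right action of `A_con` on `M / M · (A e A)`, as a ring homomorphism. -/
def aconActionHom (M : Type v) [AddCommGroup M] [Module Aᵐᵒᵖ M] :
    (Acon e)ᵐᵒᵖ →+* AddMonoid.End (ExtScalars e M) :=
  RingHom.unop ((Ideal.Quotient.lift (idealAeA e) (actionHom e M) (actionHom_eq_zero e M)).comp
    (RingEquiv.opOp (Acon e)).symm.toRingHom)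

/-- The structure of a right `A_con`-module on `M / M · (A e A)`. -/
instance (M : Type v) [AddCommGroup M] [Module Aᵐᵒᵖ M] :
    Module (Acon e)ᵐᵒᵖ (ExtScalars e M) :=
  Module.compHom _ (aconActionHom e M)

theorem extScalars_smul_mk (M : Type v) [AddCommGroup M] [Module Aᵐᵒᵖ M] (a : A) (m : M) :
    (op (Ideal.Quotient.mk (idealAeA e) a) • Submodule.Quotient.mk m : ExtScalars e M) =
      Submodule.Quotient.mk (op a • m) :=
  rfl

/-- The map `f ⊗_A A_con`. -/
def extScalarsMap {M : Type v} [AddCommGroup M] [Module Aᵐᵒᵖ M] {N : Type v} [AddCommGroup N]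
    [Module Aᵐᵒᵖ N] (f : M →ₗ[Aᵐᵒᵖ] N) : ExtScalars e M →ₗ[(Acon e)ᵐᵒᵖ] ExtScalars e N where
  toFun := Submodule.mapQ (smulAeA e M) (smulAeA e N) f (by
    refine Submodule.span_le.2 ?_
    rintro _ ⟨a, ha, m, rfl⟩
    exact Submodule.subset_span ⟨a, ha, f m, f.map_smul _ _⟩)
  map_add' := map_add _
  map_smul' r x := by
    obtain ⟨a, rfl⟩ := op_surjective r
    obtain ⟨a, rfl⟩ := Ideal.Quotient.mk_surjective a
    obtain ⟨m, rfl⟩ := Submodule.Quotient.mk_surjective _ x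
    exact congrArg Submodule.Quotient.mk (f.map_smul (op a) m)

/-- The extension of scalars functor `i^* = - ⊗_A A_con` from right `A`-modules to right
`A_con`-modules. -/
def extScalars : ModuleCat.{v} Aᵐᵒᵖ ⥤ ModuleCat.{v} (Acon e)ᵐᵒᵖ where
  obj M := ModuleCat.of _ (ExtScalars e M)
  map f := ModuleCat.ofHom (extScalarsMap e f.hom)
  map_id M := by
    refine ModuleCat.hom_ext (LinearMap.ext fun x => ?_)
    obtain ⟨m, rfl⟩ := Submodule.Quotient.mk_surjective _ x
    rfl
  map_comp f g := by
    refine ModuleCat.hom_ext (LinearMap.ext fun x => ?_)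
    obtain ⟨m, rfl⟩ := Submodule.Quotient.mk_surjective _ x
    rfl

instance : (extScalars.{u, v} e).Additive where
  map_add {M N f g} := by
    refine ModuleCat.hom_ext (LinearMap.ext fun x => ?_)
    obtain ⟨m, rfl⟩ := Submodule.Quotient.mk_surjective _ x
    rfl

/-- The complex `i^* Q` of right `A_con`-modules, for a complex `Q` of right `A`-modules. -/
noncomputable def extScalarsComplex (Q : CochainComplex (ModuleCat.{v} Aᵐᵒᵖ) ℤ) :
    CochainComplex (ModuleCat.{v} (Acon e)ᵐᵒᵖ) ℤ :=
  ((extScalars e).mapHomologicalComplex (ComplexShape.up ℤ)).obj Q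

end Idempotent

-- Extension of scalars is a DG-functor 𝓑 → 𝓐 which is the identity on objects, and two facts about
-- cohomology carry the theorem. First, H^p 𝓑(i,j) = Ext^p(S_i, S_j) vanishes for p < 0, and in
-- degree 0 it is spanned by the unit if i = j and is zero otherwise, by Schur's lemma
-- (`homDG_exists_mem_span_isOne`). Second, for p > 0 the functor induces isomorphisms H^p 𝓑(i,j) →
-- H^p 𝓐(i,j) (`homDGMap_cohomologyMap_bijective`). Indeed, classes of degree p are governed by the
-- composite of the component Q^i_p → Q^j_0 with the augmentation Q^j_0 → S_j, and maps into S_j are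
-- the same over A and over A_con because S_j is annihilated by e. The second cohomology module of
-- P^j, in degree 1 - n, does no harm: a component of degree p > 0 which ends there starts in degree
-- 1 - n - p ≤ -n, where P^i is zero.
--
-- The rest is formal. Let N be a strictly unital minimal model of 𝓑. By the first fact N has only
-- multiples of units in nonpositive degrees. The composite N → 𝓑 → 𝓐 → M is strictly unital. Its
-- r-th component sends r letters of positive degree to degree at least 1, and for r ≥ 2 it vanishes
-- as soon as one letter is a unit. Hence the composite takes values in the unitally positive part
-- of M (`positiveLift`), and it maps N bijectively onto that part by the second fact and because
-- the units of 𝓐 are not exact. Composing with 𝓑 → N gives the quasi-isomorphism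
-- (`exists_isQuasiIso_unitallyPositive`).
--
-- What remains is the existence of strictly unital minimal models with quasi-isomorphisms in both
-- directions (`UnitsNonexact.nonempty_minimalModel`). This is homotopy transfer, carried out in the
-- bar construction. After suspension the operations become one family `b` from words to letters,
-- the A_∞-relations become `b ∘ bar b = 0`, and an A_∞-functor becomes a family `F` with `b' ∘ hat
-- F = F ∘ bar b`. Families of maps between words form a ring under convolution, in which `hat F` is
-- the geometric series 1/(1 - F). Given a contraction (i, p, h) of the complexes of morphisms onto
-- their cohomology, and with b_{≥2} for the part of `b` of arity at least two, the inclusion, the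
-- operations and the projection solve I = i - h b_{≥2} hat I, b' = p b_{≥2} hat I and P = p + (b'
-- hat P - P bar b_{≥2}) H, where H extends h to words.
--
-- Both recursions are contractive for the length of words, so solutions exist. The deviations from
-- the functor equations satisfy contractive equations as well, and therefore vanish. If the units
-- are not exact, the contraction can be chosen with h(e) = 0 and with the units fixed by the
-- projection onto cohomology, and the same induction on length shows that I, b' and P are strictly
-- unital.

universe u'' v''

set_option linter.unusedSectionVars false

/-! ### Sums over cuttings of a word -/

namespace Chain

section CutSum

universe w

variable {O : Type u} {H : O → O → ℤ → Type v} {W : Type w} [AddCommMonoid W]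

theorem append_nil {x : O} : ∀ {y : O} (c : Chain H x y), c.append nil = c
  | _, nil => rfl
  | _, cons f c => congrArg (cons f) (append_nil c)

theorem append_assoc {x y z : O} : ∀ {w : O} (a : Chain H z w) (b : Chain H y z) (c : Chain H x y),
    (a.append b).append c = a.append (b.append c)
  | _, nil, _, _ => rfl
  | _, cons f a, b, c => congrArg (cons f) (append_assoc a b c)

theorem deg_append {x y : O} : ∀ {z : O} (c : Chain H y z) (d : Chain H x y),
    (c.append d).deg = c.deg + d.deg
  | _, nil, d => (zero_add _).symm
  | _, cons f c, d => by simp only [append, deg, deg_append c d]; omega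

/-- The sum of a function over all ways of cutting a word into two subwords. -/
def cutSum {x z : O} (Φ : ∀ y, Chain H y z → Chain H x y → W) (c : Chain H x z) : W :=
  (c.cuts.map fun s => Φ s.1 s.2.1 s.2.2).sum

theorem cutSum_nil {x : O} (Φ : ∀ y, Chain H y x → Chain H x y → W) :
    cutSum Φ nil = Φ x nil nil := by
  simp [cutSum, cuts]

theorem cutSum_cons {x y z : O} {p : ℤ} (Φ : ∀ y, Chain H y z → Chain H x y → W) (f : H y z p)
    (c : Chain H x y) :
    cutSum Φ (cons f c) = Φ z nil (cons f c) + cutSum (fun w u v => Φ w (cons f u) v) c := by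
  simp only [cutSum, cuts, List.map_cons, List.sum_cons, List.map_map]
  rfl

theorem cutSum_congr {x z : O} {Φ Ψ : ∀ y, Chain H y z → Chain H x y → W} (c : Chain H x z)
    (h : ∀ y (a : Chain H y z) (b : Chain H x y), a.length + b.length = c.length →
      Φ y a b = Ψ y a b) : cutSum Φ c = cutSum Ψ c :=
  congrArg List.sum (List.map_congr_left fun s hs => h _ _ _ (length_cuts c s hs))

theorem append_of_mem_cuts {x z : O} (c : Chain H x z) (s) (hs : s ∈ c.cuts) :
    s.2.1.append s.2.2 = c := by
  induction c with
  | nil =>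
    obtain rfl : s = _ := by simpa [cuts] using hs
    rfl
  | cons f c ih =>
    simp only [cuts, List.mem_cons, List.mem_map] at hs
    rcases hs with rfl | ⟨a, h', rfl⟩
    · rfl
    · exact congrArg (cons f) (ih _ h')

theorem cutSum_congr' {x z : O} {Φ Ψ : ∀ y, Chain H y z → Chain H x y → W} (c : Chain H x z)
    (h : ∀ y (a : Chain H y z) (b : Chain H x y), a.append b = c →
      Φ y a b = Ψ y a b) : cutSum Φ c = cutSum Ψ c :=
  congrArg List.sum (List.map_congr_left fun s hs => h _ _ _ (append_of_mem_cuts c s hs))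

theorem cutSum_add {x z : O} (Φ Ψ : ∀ y, Chain H y z → Chain H x y → W) (c : Chain H x z) :
    cutSum (fun y a b => Φ y a b + Ψ y a b) c = cutSum Φ c + cutSum Ψ c := by
  simp only [cutSum, List.sum_map_add]

theorem map_cutSum {W' : Type*} [AddCommMonoid W'] {F : Type*} [FunLike F W W']
    [AddMonoidHomClass F W W'] (g : F) {x z : O}
    (Φ : ∀ y, Chain H y z → Chain H x y → W) (c : Chain H x z) :
    g (cutSum Φ c) = cutSum (fun y a b => g (Φ y a b)) c := by
  simp only [cutSum, map_list_sum, List.map_map]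
  rfl

theorem cutSum_zero {x z : O} (c : Chain H x z) :
    cutSum (fun _ _ _ => (0 : W)) c = 0 := by
  simp [cutSum]

/-- Coassociativity of deconcatenation: a word is cut twice, and the order of the two cuts is
irrelevant. Associativity of the convolution product and the co-Leibniz rule below reduce to this.
-/
theorem cutSum_assoc {x z : O}
    (Φ : ∀ y y', Chain H y' z → Chain H y y' → Chain H x y → W) (c : Chain H x z) :
    cutSum (fun y a b => cutSum (fun y' a' a'' => Φ y y' a' a'' b) a) c =
      cutSum (fun y' a b => cutSum (fun y b' b'' => Φ y y' a b' b'') b) c := by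
  induction c with
  | nil => simp only [cutSum_nil]
  | cons f c ih =>
    simp only [cutSum_cons, cutSum_nil, cutSum_add]
    rw [ih fun y y' a b d => Φ y y' (cons f a) b d, add_assoc]

/-- A cut falls either to the left or to the right of the marked letter. With `f` a variable letter
this controls multilinearity; with `f` a unit it controls strict unitality. -/
theorem cutSum_append_cons {x y z w : O} {p : ℤ} (Φ : ∀ y, Chain H y w → Chain H x y → W)
    (a : Chain H z w) (f : H y z p) (d : Chain H x y) :
    cutSum Φ (a.append (cons f d)) =
      cutSum (fun t a' a'' => Φ t a' (a''.append (cons f d))) a +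
        cutSum (fun t d' d'' => Φ t (a.append (cons f d')) d'') d := by
  induction a with
  | nil => simp only [append, cutSum_cons, cutSum_nil]
  | cons g a ih =>
    simp only [append, cutSum_cons]
    rw [ih (fun t a b => Φ t (cons g a) b), add_assoc]

theorem _root_.List.sum_map_flatMap {α β : Type*} (l : List α) (g : α → List β) (Φ : β → W) :
    ((l.flatMap g).map Φ).sum = (l.map fun a => ((g a).map Φ).sum).sum := by
  induction l with
  | nil => rfl
  | cons a l ih => simp [ih]

theorem sum_splits {x z : O} (Φ : Split H x z → W) (c : Chain H x z) :
    (c.splits.map Φ).sum =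
      cutSum (fun _ a b => cutSum (fun _ b' b'' => Φ ⟨a, b', b''⟩) b) c := by
  simp only [splits, cutSum, List.sum_map_flatMap, List.map_map]
  rfl

/-- A blocking is determined by its first block and a blocking of the rest. -/
theorem sum_blockings_cons {x y z : O} {p : ℤ} (Φ : Blocks H x z → W) (f : H y z p)
    (c : Chain H x y) :
    ((cons f c).blockings.map Φ).sum =
      cutSum (fun _ a b => (b.blockings.map fun β => Φ (.cons (cons f a) β)).sum) c := by
  induction c generalizing z p with
  | nil => simp [blockings, pushBlocks, cutSum_nil]
  | @cons y₁ y₂ p₁ g c ih =>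
    have h₁ : ((cons f (cons g c)).blockings.map Φ).sum =
        ((cons g c).blockings.map fun β => ((pushBlocks f β).map Φ).sum).sum := by
      rw [blockings, List.sum_map_flatMap]
    -- `Φ'` handles the case in which `f` joins the first block. Its value at `nil` is irrelevant,
    -- since the nonempty word `g ⊗ c` has no empty blocking; applying the induction hypothesis to
    -- both sides makes this visible.
    let Φ' : Blocks H x y₂ → W := fun β =>
      match β with
      | .nil => 0
      | .cons b β' => Φ (.cons (cons f b) β')
    have h₂ : ((cons g c).blockings.map fun β => ((pushBlocks f β).map Φ).sum).sum =
        ((cons g c).blockings.map fun β => Φ (.cons (cons f nil) β) + Φ' β).sum := by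
      rw [ih, ih]
      exact cutSum_congr c fun y a b _ => by simp [pushBlocks, Φ']
    rw [h₁, h₂, List.sum_map_add, ih Φ' g, cutSum_cons]

end CutSum

end Chain

/-! ### Words modulo multilinearity -/

section Word

universe w

variable (k : Type w₁) [Field k] {O : Type u} (H : O → O → ℤ → Type v)
  [∀ x y p, AddCommGroup (H x y p)] [∀ x y p, Module k (H x y p)]

/-- The relations of multilinearity in the free module on the words. -/
noncomputable def wordRel (x z : O) : Submodule k (Chain H x z →₀ k) :=
  Submodule.span k
    ({r | ∃ (y w : O) (p : ℤ) (c : Chain H w z) (f g : H y w p) (d : Chain H x y),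
      r = Finsupp.single (c.append (.cons (f + g) d)) 1 -
        (Finsupp.single (c.append (.cons f d)) 1 + Finsupp.single (c.append (.cons g d)) 1)} ∪
    {r | ∃ (y w : O) (p : ℤ) (c : Chain H w z) (a : k) (f : H y w p) (d : Chain H x y),
      r = Finsupp.single (c.append (.cons (a • f) d)) 1 -
        a • Finsupp.single (c.append (.cons f d)) 1})

/-- The tensor words from `x` to `z` with letters in `H`: the direct sum of all tensor products
`H(x_{n-1}, z) ⊗ ⋯ ⊗ H(x, x_1)`. -/
def Word (x z : O) : Type (max u v w₁) := (Chain H x z →₀ k) ⧸ wordRel k H x z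

noncomputable instance (x z : O) : AddCommGroup (Word k H x z) :=
  inferInstanceAs (AddCommGroup ((Chain H x z →₀ k) ⧸ wordRel k H x z))

noncomputable instance (x z : O) : Module k (Word k H x z) :=
  inferInstanceAs (Module k ((Chain H x z →₀ k) ⧸ wordRel k H x z))

variable {H}

/-- Multilinearity of a function of words. -/
structure Chain.IsMulti {x z : O} {W : Type w} [AddCommGroup W] [Module k W]
    (φ : Chain H x z → W) : Prop where
  add : ∀ {y t : O} {p : ℤ} (c : Chain H t z) (f g : H y t p) (d : Chain H x y),
    φ (c.append (.cons (f + g) d)) = φ (c.append (.cons f d)) + φ (c.append (.cons g d))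
  smul : ∀ {y t : O} {p : ℤ} (c : Chain H t z) (a : k) (f : H y t p) (d : Chain H x y),
    φ (c.append (.cons (a • f) d)) = a • φ (c.append (.cons f d))

namespace Word

/-- The class of a word. -/
noncomputable def of {x z : O} (c : Chain H x z) : Word k H x z :=
  (wordRel k H x z).mkQ (Finsupp.single c 1)

theorem of_isMulti (x z : O) : Chain.IsMulti k (of k : Chain H x z → Word k H x z) where
  add c f g d := by
    rw [← sub_eq_zero]
    refine Eq.trans ?_ ((Submodule.Quotient.mk_eq_zero _).2
      (Submodule.subset_span (Or.inl ⟨_, _, _, c, f, g, d, rfl⟩)))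
    exact ((wordRel k H x z).mkQ.map_sub _ _).symm.trans rfl
  smul c a f d := by
    rw [← sub_eq_zero]
    refine Eq.trans ?_ ((Submodule.Quotient.mk_eq_zero _).2
      (Submodule.subset_span (Or.inr ⟨_, _, _, c, a, f, d, rfl⟩)))
    rfl

variable {k}

/-- The linear map defined by a multilinear function. -/
noncomputable def lift {x z : O} {W : Type w} [AddCommGroup W] [Module k W] (φ : Chain H x z → W)
    (h : Chain.IsMulti k φ) : Word k H x z →ₗ[k] W :=
  (wordRel k H x z).liftQ (Finsupp.linearCombination k φ) (by
    refine Submodule.span_le.2 ?_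
    rintro r (⟨y, w, p, c, f, g, d, rfl⟩ | ⟨y, w, p, c, a, f, d, rfl⟩)
    · simp [h.add]
    · simp [h.smul])

@[simp]
theorem lift_of {x z : O} {W : Type w} [AddCommGroup W] [Module k W] (φ : Chain H x z → W)
    (h : Chain.IsMulti k φ) (c : Chain H x z) : lift φ h (of k c) = φ c := by
  refine (Submodule.liftQ_apply _ _ _).trans ?_
  simp

theorem span_of (x z : O) : Submodule.span k (Set.range (of k : Chain H x z → _)) = ⊤ := by
  refine eq_top_iff.2 fun t _ => ?_
  obtain ⟨t, rfl⟩ := Submodule.mkQ_surjective _ t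
  clear * -
  induction t using Finsupp.induction_linear with
  | zero => rw [map_zero]; exact Submodule.zero_mem _
  | add s t hs ht => rw [map_add]; exact Submodule.add_mem _ hs ht
  | single c a =>
    have : Finsupp.single c a = a • Finsupp.single c (1 : k) := by simp
    rw [this, map_smul]
    exact Submodule.smul_mem _ _ (Submodule.subset_span ⟨c, rfl⟩)

theorem hom_ext {x z : O} {W : Type w} [AddCommGroup W] [Module k W] {f g : Word k H x z →ₗ[k] W}
    (h : ∀ c, f (of k c) = g (of k c)) : f = g :=
  LinearMap.ext_on (span_of x z) (by rintro _ ⟨c, rfl⟩; exact h c)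

/-- A letter, as a word. -/
noncomputable def letter (x z : O) (p : ℤ) : H x z p →ₗ[k] Word k H x z where
  toFun f := of k (.cons f .nil)
  map_add' f g := (of_isMulti k x z).add .nil f g .nil
  map_smul' a f := (of_isMulti k x z).smul .nil a f .nil

theorem cutSum_isMulti {x z : O} {W : Type w} [AddCommGroup W] [Module k W]
    (Ψ : ∀ y, Word k H y z →ₗ[k] Word k H x y →ₗ[k] W) :
    Chain.IsMulti k (Chain.cutSum fun y a b => Ψ y (of k a) (of k b)) where
  add c f g d := by
    simp only [Chain.cutSum_append_cons, (of_isMulti k _ _).add, map_add, LinearMap.add_apply,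
      Chain.cutSum_add]
    abel
  smul c a f d := by
    simp only [Chain.cutSum_append_cons, (of_isMulti k _ _).smul, map_smul, LinearMap.smul_apply]
    have h {x z : O} (Φ : ∀ y, Chain H y z → Chain H x y → W) (c) :
        a • Chain.cutSum Φ c = Chain.cutSum (fun y u v => a • Φ y u v) c :=
      Chain.map_cutSum (LinearMap.lsmul k W a) Φ c
    rw [smul_add, h, h]

/-- The application of bilinear maps to the coproduct of a word (deconcatenation). -/
noncomputable def conv {x z : O} {W : Type w} [AddCommGroup W] [Module k W]
    (Ψ : ∀ y, Word k H y z →ₗ[k] Word k H x y →ₗ[k] W) : Word k H x z →ₗ[k] W :=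
  lift _ (cutSum_isMulti Ψ)

theorem conv_of {x z : O} {W : Type w} [AddCommGroup W] [Module k W]
    (Ψ : ∀ y, Word k H y z →ₗ[k] Word k H x y →ₗ[k] W) (c : Chain H x z) :
    conv Ψ (of k c) = Chain.cutSum (fun y a b => Ψ y (of k a) (of k b)) c :=
  lift_of _ _ _

theorem append_isMulti_right {x y z : O} (a : Chain H y z) :
    Chain.IsMulti k fun b : Chain H x y => of k (a.append b) where
  add c f g d := by simp only [← Chain.append_assoc, (of_isMulti k _ _).add]
  smul c r f d := by simp only [← Chain.append_assoc, (of_isMulti k _ _).smul]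

/-- Concatenation. -/
noncomputable def mul {x y z : O} : Word k H y z →ₗ[k] Word k H x y →ₗ[k] Word k H x z :=
  lift (fun a => lift (fun b => of k (a.append b)) (append_isMulti_right a))
    { add := fun c f g d => hom_ext fun b => by
        simp only [LinearMap.add_apply, lift_of, Chain.append_assoc, Chain.append,
          (of_isMulti k _ _).add]
      smul := fun c r f d => hom_ext fun b => by
        simp only [LinearMap.smul_apply, lift_of, Chain.append_assoc, Chain.append,
          (of_isMulti k _ _).smul] }

@[simp]
theorem mul_of {x y z : O} (a : Chain H y z) (b : Chain H x y) :
    mul (of k a) (of k b) = of k (a.append b) := by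
  simp [mul]

theorem induction {x z : O} {P : Word k H x z → Prop} (of : ∀ c, P (of k c)) (zero : P 0)
    (add : ∀ s t, P s → P t → P (s + t)) (smul : ∀ (a : k) t, P t → P (a • t))
    (t : Word k H x z) : P t := by
  have ht := (span_of (k := k) x z).ge (Submodule.mem_top : t ∈ ⊤)
  induction ht using Submodule.span_induction with
  | zero => exact zero
  | add _ _ _ _ h₁ h₂ => exact add _ _ h₁ h₂
  | smul _ _ _ h => exact smul _ _ h
  | mem a ha =>
    obtain ⟨a, rfl⟩ := ha
    exact of a

theorem mul_assoc {x y z w : O} (a : Word k H z w) (b : Word k H y z) (c : Word k H x y) :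
    mul (mul a b) c = mul a (mul b c) := by
  induction a using Word.induction with
  | zero => simp
  | add _ _ h₁ h₂ => simp [h₁, h₂]
  | smul _ _ h => simp [h]
  | of a =>
    induction b using Word.induction with
    | zero => simp
    | add _ _ h₁ h₂ => simp [h₁, h₂]
    | smul _ _ h => simp [h]
    | of b =>
      induction c using Word.induction with
      | zero => simp
      | add _ _ h₁ h₂ => rw [map_add, map_add, map_add, h₁, h₂]
      | smul _ _ h => rw [map_smul, map_smul, map_smul, h]
      | of c => simp [Chain.append_assoc]

theorem nil_mul {x y : O} (a : Word k H x y) : mul (of k .nil) a = a := by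
  induction a using Word.induction with
  | of c => simp [Chain.append]
  | zero => simp
  | add _ _ h₁ h₂ => rw [map_add, h₁, h₂]
  | smul _ _ h => rw [map_smul, h]

theorem mul_nil {x y : O} (a : Word k H x y) : mul a (of k .nil) = a := by
  induction a using Word.induction with
  | of c => simp [Chain.append_nil]
  | zero => simp
  | add _ _ h₁ h₂ => rw [map_add, LinearMap.add_apply, h₁, h₂]
  | smul _ _ h => rw [map_smul, LinearMap.smul_apply, h]

end Word

end Word

/-- The sign `(-1)^n` in a field. -/
def sgn (k : Type w₁) [Field k] (n : ℤ) : k := ((n.negOnePow : ℤˣ) : ℤ)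

section sgn

variable {k : Type w₁} [Field k]

theorem sgn_add (m n : ℤ) : sgn k (m + n) = sgn k m * sgn k n := by
  simp [sgn, Int.negOnePow_add]

theorem sgn_congr {m n : ℤ} (h : Even (m - n)) : sgn k m = sgn k n := by
  rw [sgn, sgn, (Int.negOnePow_eq_iff m n).2 h]

@[simp]
theorem sgn_mul_self (m : ℤ) : sgn k m * sgn k m = 1 := by
  rw [← sgn_add, sgn, Int.negOnePow_even _ (Even.add_self m)]
  simp

@[simp]
theorem sgn_zero : sgn k 0 = 1 := by simp [sgn]

@[simp]
theorem sgn_one : sgn k 1 = -1 := by simp [sgn]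

theorem sgn_smul {W : Type*} [AddCommGroup W] [Module k W] (n : ℤ) (w : W) :
    n.negOnePow • w = sgn k n • w := by
  rcases Int.units_eq_one_or n.negOnePow with h | h <;> simp [sgn, h]

end sgn

namespace Word

universe w

variable {k : Type w₁} [Field k] {O : Type u} {H : O → O → ℤ → Type v}
  [∀ x y p, AddCommGroup (H x y p)] [∀ x y p, Module k (H x y p)]

/-- Multiplication of a word by a scalar which depends on its degree and on its length. -/
noncomputable def scale (s : ℤ → ℕ → k) (x z : O) : Word k H x z →ₗ[k] Word k H x z :=
  lift (fun c => s c.deg c.length • of k c)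
    { add := fun c f g d => by
        simp only [(of_isMulti k _ _).add, smul_add, Chain.deg_append, Chain.length_append,
          Chain.deg, Chain.length]
      smul := fun c f g d => by
        simp only [(of_isMulti k _ _).smul, Chain.deg_append, Chain.length_append,
          Chain.deg, Chain.length]
        rw [smul_comm] }

@[simp]
theorem scale_of (s : ℤ → ℕ → k) {x z : O} (c : Chain H x z) :
    scale s x z (of k c) = s c.deg c.length • of k c :=
  lift_of _ _ _

variable {W : Type w} [AddCommGroup W] [Module k W] {x z : O}

theorem conv_zero : conv (fun _ => 0 : ∀ y, Word k H y z →ₗ[k] Word k H x y →ₗ[k] W) = 0 :=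
  hom_ext fun c => by simp [conv_of, Chain.cutSum_zero]

theorem conv_add (Ψ Ψ' : ∀ y, Word k H y z →ₗ[k] Word k H x y →ₗ[k] W) :
    conv (fun y => Ψ y + Ψ' y) = conv Ψ + conv Ψ' :=
  hom_ext fun c => by simp [conv_of, Chain.cutSum_add]

theorem conv_smul (a : k) (Ψ : ∀ y, Word k H y z →ₗ[k] Word k H x y →ₗ[k] W) :
    conv (fun y => a • Ψ y) = a • conv Ψ :=
  hom_ext fun c => by
    simp only [conv_of, LinearMap.smul_apply]
    exact (Chain.map_cutSum (LinearMap.lsmul k W a) _ c).symm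

/-- The projection to the words of length one. -/
noncomputable def lam (x z : O) : Word k H x z →ₗ[k] Word k H x z :=
  scale (fun _ n => if n = 1 then 1 else 0) x z

/-- The middle factor is forced by `lam` to be a single letter, which cannot be cut, so every cut
lies in `A` or in `B`. -/
theorem conv_mul_letter {y t : O} (Ψ : ∀ y, Word k H y z →ₗ[k] Word k H x y →ₗ[k] W)
    (A : Word k H t z) (X : Word k H y t) (B : Word k H x y) :
    conv Ψ (mul A (mul (lam y t X) B)) =
      conv (fun s => (Ψ s).compl₂ (mul.flip (mul (lam y t X) B))) A +
        conv (fun s => (Ψ s) ∘ₗ (mul (mul A (lam y t X)))) B := by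
  induction A using Word.induction with
  | zero =>
    simp only [map_zero, LinearMap.zero_apply, LinearMap.comp_zero, conv_zero, add_zero]
  | add a b ha hb =>
    simp only [map_add, LinearMap.add_apply, LinearMap.comp_add, conv_add, ha, hb]
    abel
  | smul r a ha =>
    simp only [map_smul, LinearMap.smul_apply, LinearMap.comp_smul, conv_smul, ha, smul_add]
  | of a =>
  induction B using Word.induction with
  | zero =>
    have e (s) : (Ψ s).compl₂ (0 : Word k H t s →ₗ[k] _) = 0 := by ext; simp
    simp only [map_zero, e, conv_zero, LinearMap.zero_apply, add_zero]
  | add b b' h h' =>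
    have e (s) : (Ψ s).compl₂ (mul.flip (mul (lam y t X) b) + mul.flip (mul (lam y t X) b')) =
        (Ψ s).compl₂ (mul.flip (mul (lam y t X) b)) +
          (Ψ s).compl₂ (mul.flip (mul (lam y t X) b')) := by ext; simp
    simp only [map_add, LinearMap.add_apply, e, conv_add, h, h']
    abel
  | smul r b h =>
    have e (s) : (Ψ s).compl₂ (r • mul.flip (mul (lam y t X) b)) =
        r • (Ψ s).compl₂ (mul.flip (mul (lam y t X) b)) := by ext; simp
    simp only [map_smul, LinearMap.smul_apply, e, conv_smul, h, smul_add]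
  | of b =>
  induction X using Word.induction with
  | zero =>
    have e (s) : (Ψ s).compl₂ (0 : Word k H t s →ₗ[k] _) = 0 := by ext; simp
    simp [conv_zero, e]
  | add f g h h' =>
    have e (s) : (Ψ s).compl₂ (mul.flip (mul (lam y t f) (of k b)) +
        mul.flip (mul (lam y t g) (of k b))) =
        (Ψ s).compl₂ (mul.flip (mul (lam y t f) (of k b))) +
          (Ψ s).compl₂ (mul.flip (mul (lam y t g) (of k b))) := by ext; simp
    simp only [map_add, LinearMap.add_apply, e, conv_add, h, h', LinearMap.comp_add]
    abel
  | smul r f h =>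
    have e (s) : (Ψ s).compl₂ (r • mul.flip (mul (lam y t f) (of k b))) =
        r • (Ψ s).compl₂ (mul.flip (mul (lam y t f) (of k b))) := by ext; simp
    simp only [map_smul, LinearMap.smul_apply, e, conv_smul, h, smul_add, LinearMap.comp_smul]
  | of f =>
    rcases f with _ | ⟨f, _ | ⟨g, c⟩⟩
    · have e (s) : (Ψ s).compl₂ (0 : Word k H y s →ₗ[k] _) = 0 := by ext; simp
      simp [conv_zero, lam, Chain.length, e]
    · simp [lam, Chain.length, conv_of, Chain.append, Chain.append_assoc,
        Chain.cutSum_append_cons]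
    · have e (s) : (Ψ s).compl₂ (0 : Word k H t s →ₗ[k] _) = 0 := by ext; simp
      simp [conv_zero, lam, Chain.length, e]

end Word

/-! ### Families of linear maps of words -/

/-- Families of linear maps between the modules of words of two graded quivers. -/
def Fam (k : Type w₁) [Field k] {O : Type u} {O' : Type u'} (H : O → O → ℤ → Type v)
    [∀ x y p, AddCommGroup (H x y p)] [∀ x y p, Module k (H x y p)] (H' : O' → O' → ℤ → Type v')
    [∀ x y p, AddCommGroup (H' x y p)] [∀ x y p, Module k (H' x y p)] (o : O → O') :
    Type (max u v u' v' w₁) :=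
  ∀ x y : O, Word k H x y →ₗ[k] Word k H' (o x) (o y)

namespace Chain

universe w

variable {O : Type u} {H : O → O → ℤ → Type v} {W : Type w} [AddCommMonoid W]

theorem cutSum_eq_left {x z : O} (Φ : ∀ y, Chain H y z → Chain H x y → W) (c : Chain H x z)
    (h : ∀ (y t : O) (p : ℤ) (f : H t z p) (a : Chain H y t) (b : Chain H x y),
      Φ y (cons f a) b = 0) : cutSum Φ c = Φ z nil c := by
  cases c with
  | nil => exact cutSum_nil _
  | cons f c => simp [cutSum_cons, h, cutSum_zero]

theorem cutSum_eq_right {x z : O} (Φ : ∀ y, Chain H y z → Chain H x y → W) (c : Chain H x z)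
    (h : ∀ (y t : O) (p : ℤ) (a : Chain H t z) (f : H y t p) (b : Chain H x y),
      Φ t a (cons f b) = 0) : cutSum Φ c = Φ x c nil := by
  induction c with
  | nil => exact cutSum_nil _
  | cons f c ih =>
    rw [cutSum_cons, h, zero_add]
    exact ih _ fun y t p a g b => h y t p _ g b

theorem cutSum_comm {x z x' z' : O} (Φ : ∀ y y', Chain H y z → Chain H x y → Chain H y' z' →
    Chain H x' y' → W) (c : Chain H x z) (d : Chain H x' z') :
    cutSum (fun y a b => cutSum (fun y' a' b' => Φ y y' a b a' b') d) c =
      cutSum (fun y' a' b' => cutSum (fun y a b => Φ y y' a b a' b') c) d := by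
  induction c with
  | nil => simp only [cutSum_nil]
  | cons f c ih => simp only [cutSum_cons, cutSum_add, ih fun y y' a b => Φ y y' (cons f a) b]

end Chain

namespace Fam

variable {k : Type w₁} [Field k] {O : Type u} {O' : Type u'} {O'' : Type u''}
  {H : O → O → ℤ → Type v} [∀ x y p, AddCommGroup (H x y p)] [∀ x y p, Module k (H x y p)]
  {H' : O' → O' → ℤ → Type v'} [∀ x y p, AddCommGroup (H' x y p)] [∀ x y p, Module k (H' x y p)]
  {H'' : O'' → O'' → ℤ → Type v''} [∀ x y p, AddCommGroup (H'' x y p)]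
  [∀ x y p, Module k (H'' x y p)]
  {o : O → O'} {o' : O' → O''}

open Word

noncomputable instance : AddCommGroup (Fam k H H' o) :=
  inferInstanceAs (AddCommGroup (∀ x y : O, Word k H x y →ₗ[k] Word k H' (o x) (o y)))

noncomputable instance : Module k (Fam k H H' o) :=
  inferInstanceAs (Module k (∀ x y : O, Word k H x y →ₗ[k] Word k H' (o x) (o y)))

theorem ext {f g : Fam k H H' o} (h : ∀ x y (c : Chain H x y), f x y (of k c) = g x y (of k c)) :
    f = g :=
  funext fun x => funext fun y => hom_ext (h x y)

@[simp]
theorem add_apply (f g : Fam k H H' o) (x y : O) (w : Word k H x y) :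
    (f + g) x y w = f x y w + g x y w := rfl

@[simp]
theorem sub_apply (f g : Fam k H H' o) (x y : O) (w : Word k H x y) :
    (f - g) x y w = f x y w - g x y w := rfl

@[simp]
theorem neg_apply (f : Fam k H H' o) (x y : O) (w : Word k H x y) :
    (-f) x y w = - f x y w := rfl

@[simp]
theorem zero_apply (x y : O) (w : Word k H x y) : (0 : Fam k H H' o) x y w = 0 := rfl

@[simp]
theorem smul_apply (a : k) (f : Fam k H H' o) (x y : O) (w : Word k H x y) :
    (a • f) x y w = a • f x y w := rfl

/-- The convolution product: deconcatenate, apply `f` and `g`, concatenate. No Koszul signs are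
built in; they are inserted explicitly through `tau`, so that identities between families become
computations in an ordinary associative ring. -/
noncomputable instance : Mul (Fam k H H' o) where
  mul f g x z := conv fun y => mul.compl₁₂ (f y z) (g x y)

theorem mul_of (f g : Fam k H H' o) {x z : O} (c : Chain H x z) :
    (f * g) x z (of k c) =
      Chain.cutSum (fun y a b => mul (f y z (of k a)) (g x y (of k b))) c :=
  conv_of _ c

variable (o) in
/-- The value of the unit for the convolution. -/
noncomputable def oneFun : ∀ {x z : O}, Chain H x z → Word k H' (o x) (o z)
  | _, _, .nil => of k .nil
  | _, _, .cons _ _ => 0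

theorem oneFun_append_cons {x y z w : O} {p : ℤ} (c : Chain H z w) (f : H y z p)
    (d : Chain H x y) : oneFun (k := k) (H' := H') o (c.append (.cons f d)) = 0 := by
  cases c <;> rfl

noncomputable instance : One (Fam k H H' o) where
  one x z := lift (oneFun o)
    { add := fun c f g d => by simp only [oneFun_append_cons, add_zero]
      smul := fun c f g d => by simp only [oneFun_append_cons, smul_zero] }

@[simp]
theorem one_nil (x : O) : (1 : Fam k H H' o) x x (of k .nil) = of k .nil :=
  lift_of _ _ _

@[simp]
theorem one_cons {x y z : O} {p : ℤ} (f : H y z p) (c : Chain H x y) :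
    (1 : Fam k H H' o) x z (of k (.cons f c)) = 0 :=
  lift_of _ _ _

theorem mul_nil (f g : Fam k H H' o) (x : O) :
    (f * g) x x (of k .nil) = mul (f x x (of k .nil)) (g x x (of k .nil)) := by
  rw [mul_of, Chain.cutSum_nil]

noncomputable instance : Ring (Fam k H H' o) :=
  { (inferInstance : AddCommGroup (Fam k H H' o)), (inferInstance : Mul (Fam k H H' o)),
    (inferInstance : One (Fam k H H' o)) with
    left_distrib := fun f g h => ext fun x y c => by
      simp only [mul_of, add_apply, map_add, Chain.cutSum_add]
    right_distrib := fun f g h => ext fun x y c => by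
      simp only [mul_of, add_apply, map_add, LinearMap.add_apply, Chain.cutSum_add]
    zero_mul := fun f => ext fun x y c => by
      simp only [mul_of, zero_apply, map_zero, LinearMap.zero_apply, Chain.cutSum_zero]
    mul_zero := fun f => ext fun x y c => by
      simp only [mul_of, zero_apply, map_zero, Chain.cutSum_zero]
    mul_assoc := fun f g h => ext fun x y c => by
      have e {t : O} (g : Word k H' (o x) (o t)) (Φ : ∀ s, Chain H s y → Chain H t s →
          Word k H' (o t) (o y)) (c : Chain H t y) : mul (Chain.cutSum Φ c) g =
          Chain.cutSum (fun s a b => mul (Φ s a b) g) c :=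
        Chain.map_cutSum (mul.flip g) Φ c
      simp only [mul_of, e]
      simp only [Chain.map_cutSum, Word.mul_assoc]
      exact Chain.cutSum_assoc (fun s t a b d =>
        mul (f t y (of k a)) (mul (g s t (of k b)) (h x s (of k d)))) c
    one_mul := fun f => ext fun x y c => by
      rw [mul_of, Chain.cutSum_eq_left, one_nil, Word.nil_mul]
      intro y t p f a b
      simp
    mul_one := fun f => ext fun x y c => by
      rw [mul_of, Chain.cutSum_eq_right, one_nil, Word.mul_nil]
      intro y t p f a b
      simp }

/-- The composition of families of linear maps. -/
noncomputable def comp (f : Fam k H' H'' o') (g : Fam k H H' o) :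
    Fam k H H'' (fun x => o' (o x)) :=
  fun x y => f (o x) (o y) ∘ₗ g x y

@[simp]
theorem comp_apply (f : Fam k H' H'' o') (g : Fam k H H' o) (x y : O) (w : Word k H x y) :
    f.comp g x y w = f (o x) (o y) (g x y w) := rfl

theorem add_comp (f f' : Fam k H' H'' o') (g : Fam k H H' o) :
    (f + f').comp g = f.comp g + f'.comp g := rfl

theorem sub_comp (f f' : Fam k H' H'' o') (g : Fam k H H' o) :
    (f - f').comp g = f.comp g - f'.comp g := rfl

theorem neg_comp (f : Fam k H' H'' o') (g : Fam k H H' o) : (-f).comp g = -f.comp g := rfl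

theorem zero_comp (g : Fam k H H' o) : (0 : Fam k H' H'' o').comp g = 0 := rfl

theorem comp_add (f : Fam k H' H'' o') (g g' : Fam k H H' o) :
    f.comp (g + g') = f.comp g + f.comp g' :=
  funext fun _ => funext fun _ => LinearMap.comp_add _ _ _

theorem comp_sub (f : Fam k H' H'' o') (g g' : Fam k H H' o) :
    f.comp (g - g') = f.comp g - f.comp g' :=
  funext fun _ => funext fun _ => LinearMap.comp_sub _ _ _

theorem comp_neg (f : Fam k H' H'' o') (g : Fam k H H' o) :
    f.comp (-g) = -f.comp g :=
  funext fun _ => funext fun _ => LinearMap.comp_neg _ _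

theorem comp_zero (f : Fam k H' H'' o') : f.comp (0 : Fam k H H' o) = 0 :=
  funext fun _ => funext fun _ => LinearMap.comp_zero _

theorem comp_assoc {O₃ : Type*} {H₃ : O₃ → O₃ → ℤ → Type*} [∀ x y p, AddCommGroup (H₃ x y p)]
    [∀ x y p, Module k (H₃ x y p)] {o₃ : O'' → O₃} (f : Fam k H'' H₃ o₃) (g : Fam k H' H'' o')
    (h : Fam k H H' o) : (f.comp g).comp h = f.comp (g.comp h) := rfl

variable (k H) in
/-- The identity. -/
noncomputable def id : Fam k H H (fun x => x) := fun _ _ => LinearMap.id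

@[simp]
theorem id_apply (x y : O) (w : Word k H x y) : id k H x y w = w := rfl

theorem comp_id (f : Fam k H H' o) : f.comp (id k H) = f := rfl

variable (k H) in
/-- The projection to words of length one. -/
noncomputable def lam : Fam k H H (fun x => x) := Word.lam

variable (k H) in
/-- The sign given by the degree in the suspension. -/
noncomputable def tau : Fam k H H (fun x => x) := Word.scale fun d n => sgn k (d - n)

theorem lam_of {x y : O} (c : Chain H x y) :
    lam k H x y (of k c) = if c.length = 1 then of k c else 0 := by
  rw [lam, Word.lam, scale_of]
  split_ifs <;> simp

theorem lam_letter {x y : O} {p : ℤ} (f : H x y p) :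
    lam k H x y (of k (.cons f .nil)) = of k (.cons f .nil) := by
  simp [lam_of, Chain.length]

theorem tau_of {x y : O} (c : Chain H x y) :
    tau k H x y (of k c) = sgn k (c.deg - c.length) • of k c := by
  rw [tau, scale_of]

theorem tau_tau : (tau k H).comp (tau k H) = id k H := ext fun x y c => by
  simp [tau_of, smul_smul]

theorem lam_lam : (lam k H).comp (lam k H) = lam k H := ext fun x y c => by
  simp only [comp_apply, lam_of]
  split_ifs with h <;> simp [lam_of, h]

theorem tau_lam : (tau k H).comp (lam k H) = (lam k H).comp (tau k H) := ext fun x y c => by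
  simp only [comp_apply, lam_of, tau_of, map_smul]
  split_ifs with h <;> simp [tau_of]

theorem tau_mul_apply {x y z : O} (a : Word k H y z) (b : Word k H x y) :
    tau k H x z (Word.mul a b) = Word.mul (tau k H y z a) (tau k H x y b) := by
  induction a using Word.induction with
  | zero => simp
  | add _ _ h₁ h₂ => simp [h₁, h₂]
  | smul _ _ h => simp [h]
  | of a =>
    induction b using Word.induction with
    | zero => simp
    | add _ _ h₁ h₂ => simp only [map_add, h₁, h₂]
    | smul _ _ h => simp only [map_smul, h]
    | of b =>
      simp only [Word.mul_of, tau_of, map_smul, LinearMap.smul_apply, smul_smul, ← sgn_add,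
        Chain.deg_append, Chain.length_append]
      congr 2
      push_cast
      ring

theorem tau_comp_mul (f g : Fam k H H' o) :
    (tau k H').comp (f * g) = (tau k H').comp f * (tau k H').comp g := ext fun x y c => by
  simp only [comp_apply, mul_of, Chain.map_cutSum, tau_mul_apply]

theorem mul_comp_tau (f g : Fam k H H' o) :
    (f * g).comp (tau k H) = f.comp (tau k H) * g.comp (tau k H) := ext fun x y c => by
  simp only [comp_apply, mul_of, tau_of, map_smul, LinearMap.smul_apply]
  have h := Chain.map_cutSum (LinearMap.lsmul k (Word k H' (o x) (o y)) (sgn k (c.deg - c.length)))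
    (fun t a b => Word.mul (f t y (of k a)) (g x t (of k b))) c
  refine h.trans (Chain.cutSum_congr' c fun t a b hab => ?_)
  subst hab
  simp only [LinearMap.lsmul_apply, smul_smul, ← sgn_add, Chain.deg_append, Chain.length_append]
  congr 2
  push_cast
  ring

theorem one_comp_tau : (1 : Fam k H H' o).comp (tau k H) = 1 := ext fun x y c => by
  cases c <;> simp [tau_of, Chain.deg, Chain.length]

theorem tau_comp_one : (tau k H').comp (1 : Fam k H H' o) = 1 := ext fun x y c => by
  cases c <;> simp [tau_of, Chain.deg, Chain.length]

/-- A concatenation is a single letter exactly if one factor is a letter and the other is empty;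
composition with the unit `1` extracts the empty word. -/
theorem lam_comp_mul (f g : Fam k H H' o) :
    (lam k H').comp (f * g) = (lam k H').comp f * (1 : Fam k H' H' fun x => x).comp g +
      (1 : Fam k H' H' fun x => x).comp f * (lam k H').comp g := ext fun x y c => by
  have key {x y z : O'} (a : Word k H' y z) (b : Word k H' x y) :
      lam k H' x z (Word.mul a b) =
        Word.mul (lam k H' y z a) ((1 : Fam k H' H' fun x => x) x y b) +
          Word.mul ((1 : Fam k H' H' fun x => x) y z a) (lam k H' x y b) := by
    induction a using Word.induction with
    | zero => simp
    | add _ _ h₁ h₂ => simp only [map_add, LinearMap.add_apply, h₁, h₂]; abel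
    | smul _ _ h => simp only [map_smul, LinearMap.smul_apply, h, smul_add]
    | of a =>
      induction b using Word.induction with
      | zero => simp
      | add _ _ h₁ h₂ => simp only [map_add, h₁, h₂]; abel
      | smul _ _ h => simp only [map_smul, h, smul_add]
      | of b =>
        rcases a with _ | ⟨f, _ | ⟨g, a⟩⟩ <;> rcases b with _ | ⟨f', b⟩ <;>
          simp [lam_of, Chain.length, Chain.append, Chain.append_nil, Word.nil_mul]
  simp only [comp_apply, mul_of, Chain.map_cutSum, add_apply, key, Chain.cutSum_add]

theorem lam_comp_one : (lam k H').comp (1 : Fam k H H' o) = 0 := ext fun x y c => by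
  cases c <;> simp [lam_of, Chain.length]

theorem one_comp_lam : (1 : Fam k H H' o).comp (lam k H) = 0 := ext fun x y c => by
  rcases c with _ | ⟨f, _ | ⟨g, c⟩⟩ <;> simp [lam_of, Chain.length]

/-! ### Families with values in the letters -/

/-- Families with values in the letters which vanish on the empty words. -/
structure IsLetter (F : Fam k H H' o) : Prop where
  lam_comp : (lam k H').comp F = F
  nil : ∀ x, F x x (of k .nil) = 0

theorem isLetter_lam : IsLetter (lam k H) where
  lam_comp := lam_lam
  nil x := by simp [lam_of, Chain.length]

namespace IsLetter

variable {F G : Fam k H H' o}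

theorem apply (hF : IsLetter F) {x y : O} (w : Word k H x y) :
    lam k H' _ _ (F x y w) = F x y w :=
  congrFun (congrArg DFunLike.coe (congrFun (congrFun hF.lam_comp x) y)) w

theorem add (hF : IsLetter F) (hG : IsLetter G) : IsLetter (F + G) where
  lam_comp := by rw [comp_add, hF.lam_comp, hG.lam_comp]
  nil x := by rw [add_apply, hF.nil, hG.nil, add_zero]

theorem neg (hF : IsLetter F) : IsLetter (-F) where
  lam_comp := by rw [comp_neg, hF.lam_comp]
  nil x := by rw [neg_apply, hF.nil, neg_zero]

theorem sub (hF : IsLetter F) (hG : IsLetter G) : IsLetter (F - G) := by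
  rw [sub_eq_add_neg]
  exact hF.add hG.neg

theorem comp {f : Fam k H' H'' o'} (hf : IsLetter f) (hF : IsLetter F) : IsLetter (f.comp F) where
  lam_comp := by rw [← comp_assoc, hf.lam_comp]
  nil x := by rw [comp_apply, hF.nil, map_zero]

theorem one_comp (hF : IsLetter F) : (1 : Fam k H' H'' o').comp F = 0 := by
  rw [← hF.lam_comp, ← comp_assoc, one_comp_lam, zero_comp]

theorem comp_tau (hF : IsLetter F) : IsLetter (F.comp (tau k H)) where
  lam_comp := by rw [← comp_assoc, hF.lam_comp]
  nil x := by rw [comp_apply, tau_of, map_smul, hF.nil, smul_zero]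

end IsLetter

/-! ### Agreement on short words -/

/-- Two families agree on the words of length less than `n`. -/
def EqOn (n : ℕ) (f g : Fam k H H' o) : Prop :=
  ∀ (x y : O) (c : Chain H x y), c.length < n → f x y (of k c) = g x y (of k c)

theorem EqOn.refl (n : ℕ) (f : Fam k H H' o) : EqOn n f f := fun _ _ _ _ => rfl

theorem EqOn.symm {n : ℕ} {f g : Fam k H H' o} (h : EqOn n f g) : EqOn n g f :=
  fun x y c hc => (h x y c hc).symm

theorem EqOn.trans {n : ℕ} {f g h : Fam k H H' o} (h₁ : EqOn n f g) (h₂ : EqOn n g h) :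
    EqOn n f h := fun x y c hc => (h₁ x y c hc).trans (h₂ x y c hc)

theorem EqOn.mono {m n : ℕ} {f g : Fam k H H' o} (h : EqOn n f g) (hmn : m ≤ n) : EqOn m f g :=
  fun x y c hc => h x y c (hc.trans_le hmn)

theorem EqOn.add {n : ℕ} {f f' g g' : Fam k H H' o} (h : EqOn n f f') (h' : EqOn n g g') :
    EqOn n (f + g) (f' + g') := fun x y c hc => by
  rw [add_apply, add_apply, h x y c hc, h' x y c hc]

theorem EqOn.neg {n : ℕ} {f f' : Fam k H H' o} (h : EqOn n f f') :
    EqOn n (-f) (-f') := fun x y c hc => by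
  rw [neg_apply, neg_apply, h x y c hc]

theorem EqOn.sub {n : ℕ} {f f' g g' : Fam k H H' o} (h : EqOn n f f') (h' : EqOn n g g') :
    EqOn n (f - g) (f' - g') := fun x y c hc => by
  rw [sub_apply, sub_apply, h x y c hc, h' x y c hc]

theorem EqOn.comp_left {n : ℕ} {f f' : Fam k H H' o} (h : EqOn n f f') (g : Fam k H' H'' o') :
    EqOn n (g.comp f) (g.comp f') := fun x y c hc => by
  rw [comp_apply, comp_apply, h x y c hc]

theorem eqOn_zero (f g : Fam k H H' o) : EqOn 0 f g := fun _ _ _ hc => absurd hc (Nat.not_lt_zero _)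

theorem eq_of_eqOn {f g : Fam k H H' o} (h : ∀ n, EqOn n f g) : f = g :=
  ext fun x y c => h _ x y c (Nat.lt_succ_self _)

theorem eq_of_eqOn_succ {f g : Fam k H H' o} (h : ∀ n, EqOn n f g → EqOn (n + 1) f g) : f = g :=
  eq_of_eqOn fun n => Nat.rec (eqOn_zero f g) h n

theorem EqOn.mul {n : ℕ} {f f' g g' : Fam k H H' o} (h : EqOn n f f') (h' : EqOn n g g') :
    EqOn n (f * g) (f' * g') := fun x y c hc => by
  simp only [mul_of]
  refine Chain.cutSum_congr c fun t a b hab => ?_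
  rw [h _ _ a (by omega), h' _ _ b (by omega)]

/-- The vanishing of the first factor on empty words improves the agreement of products. -/
theorem EqOn.mul_succ_right {n : ℕ} {f f' g g' : Fam k H H' o} (h : EqOn (n + 1) f f')
    (h' : EqOn n g g') (hf : ∀ x, f x x (of k .nil) = 0) (hf' : ∀ x, f' x x (of k .nil) = 0) :
    EqOn (n + 1) (f * g) (f' * g') := fun x y c hc => by
  simp only [mul_of]
  refine Chain.cutSum_congr c fun t a b hab => ?_
  cases a with
  | nil => rw [hf, hf']; simp
  | cons e a =>
    simp only [Chain.length] at hab
    rw [h _ _ (.cons e a) (by simp only [Chain.length]; omega), h' _ _ b (by omega)]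

theorem EqOn.mul_succ_left {n : ℕ} {f f' g g' : Fam k H H' o} (h : EqOn n f f')
    (h' : EqOn (n + 1) g g') (hg : ∀ x, g x x (of k .nil) = 0)
    (hg' : ∀ x, g' x x (of k .nil) = 0) : EqOn (n + 1) (f * g) (f' * g') := fun x y c hc => by
  simp only [mul_of]
  refine Chain.cutSum_congr c fun t a b hab => ?_
  cases b with
  | nil => rw [hg, hg']; simp
  | cons e b =>
    simp only [Chain.length] at hab
    rw [h _ _ a (by omega), h' _ _ (.cons e b) (by simp only [Chain.length]; omega)]

end Fam

namespace Fam

variable {k : Type w₁} [Field k] {O : Type u} {O' : Type u'} {O'' : Type u''}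
  {H : O → O → ℤ → Type v} [∀ x y p, AddCommGroup (H x y p)] [∀ x y p, Module k (H x y p)]
  {H' : O' → O' → ℤ → Type v'} [∀ x y p, AddCommGroup (H' x y p)] [∀ x y p, Module k (H' x y p)]
  {H'' : O'' → O'' → ℤ → Type v''} [∀ x y p, AddCommGroup (H'' x y p)]
  [∀ x y p, Module k (H'' x y p)]
  {o : O → O'} {o' : O' → O''}

open Word

/-! ### The morphism of coalgebras defined by a family with values in the letters -/

/-- The sum of the convolution powers of a family. -/
noncomputable def hat (F : Fam k H H' o) : Fam k H H' o := fun x y =>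
  lift (fun c => (∑ n ∈ Finset.range (c.length + 1), F ^ n : Fam k H H' o) x y (of k c))
    { add := fun c f g d => by
        simp only [Chain.length_append, Chain.length, (of_isMulti k _ _).add, map_add]
      smul := fun c f g d => by
        simp only [Chain.length_append, Chain.length, (of_isMulti k _ _).smul, map_smul] }

/-- Each of the `n` factors must use up at least one letter of the word. This makes the geometric
series finite on every word. -/
theorem IsLetter.pow_eqOn {F : Fam k H H' o} (hF : IsLetter F) (n : ℕ) : EqOn n (F ^ n) 0 := by
  induction n with
  | zero => exact eqOn_zero _ _
  | succ n ih =>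
    have := (EqOn.refl (n + 1) F).mul_succ_right ih hF.nil hF.nil
    rwa [mul_zero, ← pow_succ'] at this

theorem IsLetter.hat_eqOn {F : Fam k H H' o} (hF : IsLetter F) (n : ℕ) :
    EqOn n (hat F) (∑ i ∈ Finset.range n, F ^ i) := fun x y c hc => by
  refine (lift_of _ _ _).trans ?_
  obtain ⟨m, rfl⟩ := Nat.exists_eq_add_of_le (Nat.succ_le_of_lt hc)
  clear hc
  induction m with
  | zero => rfl
  | succ m ih =>
    rw [ih, ← add_assoc, Finset.sum_range_succ, add_apply,
      hF.pow_eqOn _ x y c (by omega), zero_apply, add_zero]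

/-- The equation (1 - F) hat F = 1 of the geometric series. By `IsLetter.unique` it characterises
`hat F`, and it is used in place of the definition from here on. -/
theorem IsLetter.hat_eq {F : Fam k H H' o} (hF : IsLetter F) : hat F = 1 + F * hat F :=
  eq_of_eqOn fun n => by
    refine EqOn.mono (n := n + 1) (f := hat F) ?_ (Nat.le_succ n)
    refine (hF.hat_eqOn (n + 1)).trans ?_
    rw [Finset.sum_range_succ', pow_zero, add_comm _ (1 : Fam k H H' o)]
    refine EqOn.add (EqOn.refl _ _) ?_
    simp only [pow_succ', ← Finset.mul_sum]
    exact (EqOn.refl _ F).mul_succ_right (hF.hat_eqOn n).symm hF.nil hF.nil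

theorem IsLetter.hat_eq' {F : Fam k H H' o} (hF : IsLetter F) : hat F = 1 + hat F * F :=
  eq_of_eqOn fun n => by
    refine EqOn.mono (n := n + 1) (f := hat F) ?_ (Nat.le_succ n)
    refine (hF.hat_eqOn (n + 1)).trans ?_
    rw [Finset.sum_range_succ', pow_zero, add_comm _ (1 : Fam k H H' o)]
    refine EqOn.add (EqOn.refl _ _) ?_
    simp only [pow_succ, ← Finset.sum_mul]
    exact (hF.hat_eqOn n).symm.mul_succ_left (EqOn.refl _ F) hF.nil hF.nil

/-- Uniqueness of the solutions of `X = A + F * X`. -/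
theorem IsLetter.unique {F A X Y : Fam k H H' o} (hF : IsLetter F) (hX : X = A + F * X)
    (hY : Y = A + F * Y) : X = Y :=
  eq_of_eqOn_succ fun n h => by
    rw [hX, hY]
    exact (EqOn.refl _ A).add ((EqOn.refl _ F).mul_succ_right h hF.nil hF.nil)

theorem IsLetter.hat_unique {F X : Fam k H H' o} (hF : IsLetter F) (hX : X = 1 + F * X) :
    X = hat F :=
  hF.unique hX hF.hat_eq

theorem IsLetter.hat_nil {F : Fam k H H' o} (hF : IsLetter F) (x : O) :
    hat F x x (of k .nil) = of k .nil := by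
  rw [hF.hat_eq, add_apply, mul_nil, hF.nil, map_zero, LinearMap.zero_apply, add_zero, one_nil]

theorem IsLetter.hat_congr {F G : Fam k H H' o} (hF : IsLetter F) (hG : IsLetter G) {n : ℕ}
    (h : EqOn n F G) : EqOn n (hat F) (hat G) := by
  induction n with
  | zero => exact eqOn_zero _ _
  | succ n ih =>
    rw [hF.hat_eq, hG.hat_eq]
    exact (EqOn.refl _ 1).add (h.mul_succ_right (ih (h.mono n.le_succ)) hF.nil hG.nil)

/-- Words of length at least two contribute to `hat F` only through values on shorter words. -/
theorem IsLetter.hat_eq_add {F : Fam k H H' o} (hF : IsLetter F) :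
    hat F = 1 + F + F * (F * hat F) := by
  conv_lhs => rw [hF.hat_eq, hF.hat_eq]
  noncomm_ring

/-- Every word is, in exactly one way, the concatenation of its letters. -/
theorem hat_lam : hat (lam k H) = id k H := by
  refine (isLetter_lam.hat_unique (ext fun x y c => ?_)).symm
  cases c with
  | nil => simp [mul_nil, lam_of, Chain.length]
  | cons f c =>
    rw [add_apply, one_cons, zero_add, mul_of, Chain.cutSum_cons,
      Chain.cutSum_eq_left]
    · simp [lam_of, Chain.length, Chain.append]
    · intro y t p f a b
      simp [lam_of, Chain.length]

theorem isLetter_lam_tau : IsLetter ((lam k H).comp (tau k H)) := isLetter_lam.comp_tau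

theorem hat_lam_tau : hat ((lam k H).comp (tau k H)) = tau k H := by
  refine (isLetter_lam_tau.hat_unique ?_).symm
  have h := isLetter_lam.hat_eq (k := k) (H := H)
  rw [hat_lam] at h
  have h' := congrArg (fun f => f.comp (tau k H)) h
  simp only [add_comp, mul_comp_tau, one_comp_tau] at h'
  exact h'

/-- `hat F` is a morphism of coalgebras. -/
theorem IsLetter.conv_hat {F : Fam k H H' o} (hF : IsLetter F) {W : Type*} [AddCommGroup W]
    [Module k W] {x z : O}
    (Ψ : ∀ y, Word k H' y (o z) →ₗ[k] Word k H' (o x) y →ₗ[k] W) (w : Word k H x z) :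
    conv Ψ (hat F x z w) = conv (fun y => (Ψ (o y)).compl₁₂ (hat F y z) (hat F x y)) w := by
  induction w using Word.induction with
  | zero => simp
  | add _ _ h₁ h₂ => simp only [map_add, h₁, h₂]
  | smul _ _ h => simp only [map_smul, h]
  | of c =>
  obtain ⟨n, hn⟩ : ∃ n, c.length < n := ⟨_, Nat.lt_succ_self _⟩
  induction n generalizing z with
  | zero => exact absurd hn (Nat.not_lt_zero _)
  | succ n ih =>
    have e₀ {x z : O} (c : Chain H x z) : hat F x z (of k c) = (1 : Fam k H H' o) x z (of k c) +
        Chain.cutSum (fun y a b => Word.mul (F y z (of k a)) (hat F x y (of k b))) c := by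
      conv_lhs => rw [hF.hat_eq]
      rw [add_apply, mul_of]
    -- A cut of `F(a) ⊗ hat F(b)` lies in front of the letter `F(a)` or inside `hat F(b)`. The
    -- latter cuts are known by induction: `b` is shorter than `c`, because `F` vanishes on the
    -- empty word and so only nonempty `a` matters.
    have e₁ (y : O) (a : Chain H y z) (b : Chain H x y) (hab : a.length + b.length = c.length) :
        conv Ψ (Word.mul (F y z (of k a)) (hat F x y (of k b))) =
          Ψ (o z) (of k .nil) (Word.mul (F y z (of k a)) (hat F x y (of k b))) +
          Chain.cutSum (fun t b' b'' => Ψ (o t) (Word.mul (F y z (of k a)) (hat F t y (of k b')))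
            (hat F x t (of k b''))) b := by
      cases a with
      | nil => simp [hF.nil, Chain.cutSum_zero]
      | cons f a =>
        have h := conv_mul_letter Ψ (of k .nil) (F y z (of k (.cons f a))) (hat F x y (of k b))
        have h' := hF.apply (of k (.cons f a))
        rw [lam] at h'
        rw [h', Word.nil_mul, Word.nil_mul, conv_of, Chain.cutSum_nil] at h
        rw [h]
        congr 1
        · simp only [LinearMap.compl₂_apply, LinearMap.flip_apply, Word.nil_mul]
        · simp only [Chain.length] at hab
          rw [ih _ b (by omega), conv_of]
          rfl
    have e₂ : conv Ψ ((1 : Fam k H H' o) x z (of k c)) =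
        Ψ (o z) (of k .nil) ((1 : Fam k H H' o) x z (of k c)) := by
      cases c <;> simp [conv_of, Chain.cutSum_nil]
    have e₃ (y : O) (a : Chain H y z) (b : Chain H x y) :
        Ψ (o y) (hat F y z (of k a)) (hat F x y (of k b)) =
        Ψ (o y) ((1 : Fam k H H' o) y z (of k a)) (hat F x y (of k b)) +
        Chain.cutSum (fun t a' a'' => Ψ (o y) (Word.mul (F t z (of k a')) (hat F y t (of k a'')))
          (hat F x y (of k b))) a := by
      rw [e₀ a, map_add, LinearMap.add_apply]
      congr 1
      exact Chain.map_cutSum ((Ψ (o y)).flip (hat F x y (of k b))) _ a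
    rw [e₀ c, map_add, Chain.map_cutSum, Chain.cutSum_congr c e₁, Chain.cutSum_add, conv_of]
    simp only [LinearMap.compl₁₂_apply, e₃]
    rw [Chain.cutSum_add]
    have e₄ : Chain.cutSum (fun y a b => Ψ (o y) ((1 : Fam k H H' o) y z (of k a))
        (hat F x y (of k b))) c = Ψ (o z) (of k .nil) (hat F x z (of k c)) := by
      rw [Chain.cutSum_eq_left, one_nil]
      intro y t p f a b
      simp
    rw [e₄, e₂, e₀ c, map_add, Chain.map_cutSum, add_assoc]
    congr 2
    exact (Chain.cutSum_assoc (fun y t a b d => Ψ (o y) (Word.mul (F t z (of k a))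
      (hat F y t (of k b))) (hat F x y (of k d))) c).symm

end Fam

/-! ### Composition of coalgebra morphisms, and coderivations -/

namespace Fam

variable {k : Type w₁} [Field k] {O : Type u} {O' : Type u'} {O'' : Type u''}
  {H : O → O → ℤ → Type v} [∀ x y p, AddCommGroup (H x y p)] [∀ x y p, Module k (H x y p)]
  {H' : O' → O' → ℤ → Type v'} [∀ x y p, AddCommGroup (H' x y p)] [∀ x y p, Module k (H' x y p)]
  {H'' : O'' → O'' → ℤ → Type v''} [∀ x y p, AddCommGroup (H'' x y p)]
  [∀ x y p, Module k (H'' x y p)]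
  {o : O → O'} {o' : O' → O''}

open Word

/-- Precomposition with a morphism of coalgebras is multiplicative for convolution; for a general
family it is not. -/
theorem IsLetter.mul_comp_hat {F : Fam k H H' o} (hF : IsLetter F) (f g : Fam k H' H'' o') :
    (f * g).comp (hat F) = f.comp (hat F) * g.comp (hat F) :=
  ext fun _ _ c => hF.conv_hat _ (of k c)

theorem one_comp_mul (f g : Fam k H H' o) :
    (1 : Fam k H' H'' o').comp (f * g) =
      (1 : Fam k H' H'' o').comp f * (1 : Fam k H' H'' o').comp g := ext fun x y c => by
  have key {x y z : O'} (a : Word k H' y z) (b : Word k H' x y) :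
      (1 : Fam k H' H'' o') x z (Word.mul a b) =
        Word.mul ((1 : Fam k H' H'' o') y z a) ((1 : Fam k H' H'' o') x y b) := by
    induction a using Word.induction with
    | zero => simp
    | add _ _ h₁ h₂ => simp [h₁, h₂]
    | smul _ _ h => simp [h]
    | of a =>
      induction b using Word.induction with
      | zero => simp
      | add _ _ h₁ h₂ => simp only [map_add, h₁, h₂]
      | smul _ _ h => simp only [map_smul, h]
      | of b => cases a <;> simp [Chain.append, Word.nil_mul]
  simp only [comp_apply, mul_of, Chain.map_cutSum, key]

theorem one_comp_one : (1 : Fam k H' H'' o').comp (1 : Fam k H H' o) = 1 :=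
  ext fun x y c => by cases c <;> simp

theorem IsLetter.one_comp_hat {F : Fam k H H' o} (hF : IsLetter F) :
    (1 : Fam k H' H'' o').comp (hat F) = 1 := by
  rw [hF.hat_eq, comp_add, one_comp_mul, hF.one_comp, zero_mul, add_zero, one_comp_one]

theorem IsLetter.lam_comp_hat {F : Fam k H H' o} (hF : IsLetter F) :
    (lam k H').comp (hat F) = F := by
  conv_lhs => rw [hF.hat_eq]
  rw [comp_add, lam_comp_mul, lam_comp_one, hF.one_comp, hF.one_comp_hat, hF.lam_comp]
  simp

theorem IsLetter.comp_hat {F : Fam k H H' o} (hF : IsLetter F) {G : Fam k H' H'' o'}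
    (hG : IsLetter G) : IsLetter (G.comp (hat F)) where
  lam_comp := by rw [← comp_assoc, hG.lam_comp]
  nil x := by rw [comp_apply, hF.hat_nil, hG.nil]

/-- The left side satisfies the equation X = 1 + (G ∘ hat F) * X which characterises the right side.
-/
theorem IsLetter.hat_comp_hat {F : Fam k H H' o} (hF : IsLetter F) {G : Fam k H' H'' o'}
    (hG : IsLetter G) : (hat G).comp (hat F) = hat (G.comp (hat F)) := by
  refine (hF.comp_hat hG).hat_unique ?_
  conv_lhs => rw [hG.hat_eq, add_comp, hF.one_comp_hat, hF.mul_comp_hat]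

/-- The coderivation from `hat F` to `hat G` with given values in the letters. -/
noncomputable def cod (F θ G : Fam k H H' o) : Fam k H H' o := hat F * (θ * hat G)

/-- The co-Leibniz rule. The letter produced by `θ` is not divided by a cut: if it lies to the left
of the cut, the right-hand part is a value of `hat G`, and if it lies to the right, the left-hand
part is a value of `hat F`. -/
theorem IsLetter.conv_cod {F θ G : Fam k H H' o} (hF : IsLetter F) (hθ : IsLetter θ)
    (hG : IsLetter G) {W : Type*} [AddCommGroup W] [Module k W] {x z : O}
    (Ψ : ∀ y, Word k H' y (o z) →ₗ[k] Word k H' (o x) y →ₗ[k] W) (c : Chain H x z) :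
    conv Ψ (cod F θ G x z (of k c)) =
      conv (fun y => (Ψ (o y)).compl₁₂ (cod F θ G y z) (hat G x y)) (of k c) +
        conv (fun y => (Ψ (o y)).compl₁₂ (hat F y z) (cod F θ G x y)) (of k c) := by
  have e₀ {x z : O} (c : Chain H x z) : cod F θ G x z (of k c) =
      Chain.cutSum (fun y a b => Chain.cutSum (fun s b' b'' => Word.mul (hat F y z (of k a))
        (Word.mul (θ s y (of k b')) (hat G x s (of k b'')))) b) c := by
    simp only [cod, mul_of, Chain.map_cutSum]
  have e₁ (y s : O) (a : Chain H y z) (b : Chain H s y) (d : Chain H x s) :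
      conv Ψ (Word.mul (hat F y z (of k a)) (Word.mul (θ s y (of k b)) (hat G x s (of k d)))) =
        Chain.cutSum (fun t a' a'' => Ψ (o t) (hat F t z (of k a')) (Word.mul
          (hat F y t (of k a'')) (Word.mul (θ s y (of k b)) (hat G x s (of k d))))) a +
        Chain.cutSum (fun t d' d'' => Ψ (o t) (Word.mul (hat F y z (of k a)) (Word.mul
          (θ s y (of k b)) (hat G t s (of k d')))) (hat G x t (of k d''))) d := by
    have h := conv_mul_letter Ψ (hat F y z (of k a)) (θ s y (of k b)) (hat G x s (of k d))
    have h' := hθ.apply (of k b)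
    rw [lam] at h'
    rw [h', hF.conv_hat, hG.conv_hat, conv_of, conv_of] at h
    rw [h]
    simp [Word.mul_assoc]
  rw [e₀, Chain.map_cutSum]
  simp only [Chain.map_cutSum, e₁, Chain.cutSum_add]
  rw [add_comm]
  congr 1
  · rw [conv_of]
    simp only [LinearMap.compl₁₂_apply, e₀]
    have e₂ {t : O} (a : Chain H t z) (w : Word k H' (o x) (o t)) :
        Ψ (o t) (Chain.cutSum (fun y a b => Chain.cutSum (fun s b' b'' =>
          Word.mul (hat F y z (of k a)) (Word.mul (θ s y (of k b')) (hat G t s (of k b'')))) b) a) w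
        = Chain.cutSum (fun y a b => Chain.cutSum (fun s b' b'' => Ψ (o t)
          (Word.mul (hat F y z (of k a)) (Word.mul (θ s y (of k b')) (hat G t s (of k b'')))) w) b)
          a := by
      rw [← LinearMap.flip_apply, Chain.map_cutSum]
      simp only [Chain.map_cutSum, LinearMap.flip_apply]
    simp only [e₂]
    rw [Chain.cutSum_assoc (fun t y a b d => Chain.cutSum (fun s b' b'' => Ψ (o t)
      (Word.mul (hat F y z (of k a)) (Word.mul (θ s y (of k b')) (hat G t s (of k b''))))
        (hat G x t (of k d))) b)]
    refine Chain.cutSum_congr c fun y a b _ => ?_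
    exact (Chain.cutSum_assoc (fun t s b d d' => Ψ (o t) (Word.mul (hat F y z (of k a)) (Word.mul
          (θ s y (of k b)) (hat G t s (of k d)))) (hat G x t (of k d'))) b).symm
  · rw [conv_of]
    simp only [LinearMap.compl₁₂_apply, e₀, Chain.map_cutSum]
    rw [← Chain.cutSum_assoc (fun y t a b d => Chain.cutSum (fun s d' d'' => Ψ (o t)
      (hat F t z (of k a)) (Word.mul (hat F y t (of k b)) (Word.mul (θ s y (of k d'))
        (hat G x s (of k d''))))) d)]
    refine Chain.cutSum_congr c fun y a b _ => ?_
    exact Chain.cutSum_comm _ _ _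

theorem IsLetter.mul_comp_cod {F θ G : Fam k H H' o} (hF : IsLetter F) (hθ : IsLetter θ)
    (hG : IsLetter G) (f g : Fam k H' H'' o') :
    (f * g).comp (cod F θ G) =
      f.comp (cod F θ G) * g.comp (hat G) + f.comp (hat F) * g.comp (cod F θ G) :=
  ext fun _ _ c => hF.conv_cod hθ hG _ c

theorem IsLetter.lam_comp_cod {F θ G : Fam k H H' o} (hF : IsLetter F) (hθ : IsLetter θ)
    (hG : IsLetter G) : (lam k H').comp (cod F θ G) = θ := by
  rw [cod, lam_comp_mul, one_comp_mul, hθ.one_comp, hF.one_comp_hat, lam_comp_mul, hθ.one_comp,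
    hG.one_comp_hat, hθ.lam_comp]
  simp

theorem IsLetter.one_comp_cod {F θ G : Fam k H H' o} (hθ : IsLetter θ) :
    (1 : Fam k H' H'' o').comp (cod F θ G) = 0 := by
  rw [cod, one_comp_mul, one_comp_mul, hθ.one_comp]
  simp

/-! ### The coderivation defined by the operations of an `A_∞`-category -/

/-- The coderivation with given values in the letters. -/
noncomputable def bar (b : Fam k H H fun x => x) : Fam k H H fun x => x := tau k H * (b * id k H)

/-- The Koszul sign of moving an odd map past the letters on its left is multiplicative, so `tau` is
itself a morphism of coalgebras. Thus `bar b` is a coderivation from `tau` to the identity, and the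
signed Leibniz rule is a case of the general one. -/
theorem bar_eq_cod (b : Fam k H H fun x => x) :
    bar b = cod ((lam k H).comp (tau k H)) b (lam k H) := by
  rw [bar, cod, hat_lam, hat_lam_tau]

section bar

variable {b : Fam k H H fun x => x} (hb : IsLetter b)

include hb

theorem IsLetter.mul_comp_bar (f g : Fam k H H' o) :
    (f * g).comp (bar b) = f.comp (bar b) * g + f.comp (tau k H) * g.comp (bar b) := by
  rw [bar_eq_cod, isLetter_lam_tau.mul_comp_cod hb isLetter_lam, hat_lam, hat_lam_tau]
  rfl

theorem IsLetter.one_comp_bar : (1 : Fam k H H' o).comp (bar b) = 0 := by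
  rw [bar_eq_cod, hb.one_comp_cod]

theorem IsLetter.lam_comp_bar : (lam k H).comp (bar b) = b := by
  rw [bar_eq_cod, isLetter_lam_tau.lam_comp_cod hb isLetter_lam]

theorem IsLetter.bar_nil (x : O) : bar b x x (of k .nil) = 0 := by
  rw [bar, mul_nil, mul_nil, hb.nil]
  simp

theorem IsLetter.comp_bar {f : Fam k H H' o} (hf : IsLetter f) : IsLetter (f.comp (bar b)) where
  lam_comp := by rw [← comp_assoc, hf.lam_comp]
  nil x := by rw [comp_apply, hb.bar_nil, map_zero]

/-- The square of an odd coderivation is a coderivation over the identity. The terms in which the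
two copies of `b` act on disjoint subwords cancel because `b` anticommutes with `tau`. -/
theorem IsLetter.bar_comp_bar (hτ : (tau k H).comp b = -b.comp (tau k H)) :
    (bar b).comp (bar b) = id k H * (b.comp (bar b) * id k H) := by
  have h₁ : (tau k H).comp (bar b) = -(id k H * (b.comp (tau k H) * tau k H)) := by
    rw [bar, tau_comp_mul, tau_comp_mul, hτ, tau_tau, comp_id]
    noncomm_ring
  have h₂ : (bar b).comp (bar b) = (tau k H).comp (bar b) * (b * id k H) +
      id k H * (b.comp (bar b) * id k H + b.comp (tau k H) * bar b) := by
    conv_lhs => rw [bar]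
    change (tau k H * (b * id k H)).comp (bar b) = _
    rw [hb.mul_comp_bar, hb.mul_comp_bar, tau_tau]
    rfl
  rw [h₂, h₁]
  conv_lhs => rw [bar]
  noncomm_ring

theorem IsLetter.bar_comp_bar_eq_zero (hτ : (tau k H).comp b = -b.comp (tau k H))
    (h : b.comp (bar b) = 0) : (bar b).comp (bar b) = 0 := by
  rw [hb.bar_comp_bar hτ, h, zero_mul, mul_zero]

variable {b' : Fam k H' H' fun x => x} (hb' : IsLetter b')
  {F : Fam k H H' o} (hF : IsLetter F) (hFτ : (tau k H').comp F = F.comp (tau k H))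

include hF hFτ

/-- The deviation of `hat F` from being a morphism of complexes. -/
theorem IsLetter.bar_comp_hat_sub :
    (bar b').comp (hat F) - (hat F).comp (bar b) =
      (b'.comp (hat F) - F.comp (bar b)) * hat F +
        F.comp (tau k H) * ((bar b').comp (hat F) - (hat F).comp (bar b)) := by
  have h₁ : (tau k H').comp (hat F) = 1 + F.comp (tau k H) * (tau k H').comp (hat F) := by
    conv_lhs => rw [hF.hat_eq, comp_add, tau_comp_one, tau_comp_mul, hFτ]
  have h₂ : (bar b').comp (hat F) = (tau k H').comp (hat F) * (b'.comp (hat F) * hat F) := by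
    rw [bar, hF.mul_comp_hat, hF.mul_comp_hat]
    rfl
  have h₃ : (bar b').comp (hat F) =
      b'.comp (hat F) * hat F + F.comp (tau k H) * (bar b').comp (hat F) := by
    rw [h₂]
    conv_lhs => rw [h₁]
    noncomm_ring
  have h₄ : (hat F).comp (bar b) =
      F.comp (bar b) * hat F + F.comp (tau k H) * (hat F).comp (bar b) := by
    conv_lhs => rw [hF.hat_eq, add_comp, hb.one_comp_bar, hb.mul_comp_bar, zero_add]
  conv_lhs => rw [h₃, h₄]
  noncomm_ring

/-- Once its letter component vanishes, the deviation D satisfies D = (F τ) * D, whose only solution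
is zero. So the functor equation need only be checked after projection to letters. -/
theorem IsLetter.bar_comp_hat (h : b'.comp (hat F) = F.comp (bar b)) :
    (bar b').comp (hat F) = (hat F).comp (bar b) := by
  have h₁ := hb.bar_comp_hat_sub (b' := b') hF hFτ
  rw [h, sub_self, zero_mul] at h₁
  refine sub_eq_zero.1 (hF.comp_tau.unique h₁ ?_)
  rw [mul_zero, add_zero]

include hb'

/-- On the shortest words where the deviation of `hat F` may be nonzero it takes values in letters:
in every other term some further factor `F` uses up a letter, and the deviation is evaluated on a
shorter word. Both transfer inductions rest on this. -/
theorem IsLetter.bar_comp_hat_eqOn {n : ℕ}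
    (h : EqOn n (b'.comp (hat F) - F.comp (bar b)) 0) :
    EqOn (n + 1) ((bar b').comp (hat F) - (hat F).comp (bar b))
      (b'.comp (hat F) - F.comp (bar b)) := by
  have hD : IsLetter (b'.comp (hat F) - F.comp (bar b)) :=
    (hF.comp_hat hb').sub (hb.comp_bar hF)
  have key := hb.bar_comp_hat_sub (b' := b') hF hFτ
  have h₀ : EqOn n ((bar b').comp (hat F) - (hat F).comp (bar b)) 0 := by
    induction n with
    | zero => exact eqOn_zero _ _
    | succ n ih =>
      have ih := ih (h.mono n.le_succ)
      rw [key]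
      have h₁ := h.mul (EqOn.refl _ (hat F))
      have h₂ := (EqOn.refl (n + 1) _).mul_succ_right ih hF.comp_tau.nil hF.comp_tau.nil
      have h₃ := h₁.add h₂
      rwa [zero_mul, mul_zero, zero_add] at h₃
  have h₁ := h.mul_succ_left (EqOn.refl (n + 1) (F * hat F))
    (fun x => by rw [mul_nil, hF.nil]; simp) (fun x => by rw [mul_nil, hF.nil]; simp)
  have h₂ := (EqOn.refl (n + 1) _).mul_succ_right h₀ hF.comp_tau.nil hF.comp_tau.nil
  have h₃ := ((EqOn.refl (n + 1) (b'.comp (hat F) - F.comp (bar b))).add h₁).add h₂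
  rw [zero_mul, mul_zero, add_zero, add_zero] at h₃
  refine EqOn.trans ?_ h₃
  have key' : (bar b').comp (hat F) - (hat F).comp (bar b) =
      (b'.comp (hat F) - F.comp (bar b)) + (b'.comp (hat F) - F.comp (bar b)) * (F * hat F) +
        F.comp (tau k H) * ((bar b').comp (hat F) - (hat F).comp (bar b)) := by
    refine key.trans ?_
    congr 1
    generalize b'.comp (hat F) - F.comp (bar b) = D
    conv_lhs => rw [hF.hat_eq]
    rw [mul_add, mul_one]
  conv_lhs => rw [key']
  exact EqOn.refl _ _

end bar

end Fam

namespace Fam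

variable {k : Type w₁} [Field k] {O : Type u} {O' : Type u'} {O'' : Type u''}
  {H : O → O → ℤ → Type v} [∀ x y p, AddCommGroup (H x y p)] [∀ x y p, Module k (H x y p)]
  {H' : O' → O' → ℤ → Type v'} [∀ x y p, AddCommGroup (H' x y p)] [∀ x y p, Module k (H' x y p)]
  {H'' : O'' → O'' → ℤ → Type v''} [∀ x y p, AddCommGroup (H'' x y p)]
  [∀ x y p, Module k (H'' x y p)]
  {o : O → O'} {o' : O' → O''}

open Word

/-! ### Homogeneous families -/

variable (k H) in
/-- The words of degree `d` in the suspension. -/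
noncomputable def gr (d : ℤ) (x y : O) : Submodule k (Word k H x y) :=
  Submodule.span k {w | ∃ c : Chain H x y, c.deg - c.length = d ∧ w = of k c}

theorem of_mem_gr {x y : O} (c : Chain H x y) {d : ℤ} (hd : c.deg - c.length = d) :
    of k c ∈ gr k H d x y :=
  Submodule.subset_span ⟨c, hd, rfl⟩

theorem gr_le {x y : O} {d : ℤ} {S : Submodule k (Word k H x y)}
    (h : ∀ c : Chain H x y, c.deg - c.length = d → of k c ∈ S) : gr k H d x y ≤ S :=
  Submodule.span_le.2 (by rintro _ ⟨c, hc, rfl⟩; exact h c hc)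

theorem mul_mem_gr {x y z : O} {d e : ℤ} {a : Word k H y z} {b : Word k H x y}
    (ha : a ∈ gr k H d y z) (hb : b ∈ gr k H e x y) : Word.mul a b ∈ gr k H (d + e) x z := by
  refine gr_le (S := (gr k H (d + e) x z).comap (Word.mul.flip b)) (fun c hc => ?_) ha
  refine gr_le (S := (gr k H (d + e) x z).comap (Word.mul (of k c))) (fun c' hc' => ?_) hb
  rw [Submodule.mem_comap, Word.mul_of]
  refine of_mem_gr _ ?_
  rw [Chain.deg_append, Chain.length_append]
  push_cast
  omega

/-- Families which are homogeneous of a given degree (in the suspension). -/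
def Homog (s : ℤ) (f : Fam k H H' o) : Prop :=
  ∀ (x y : O) (c : Chain H x y), f x y (of k c) ∈ gr k H' (c.deg - c.length + s) (o x) (o y)

theorem cutSum_mem {W : Type*} [AddCommGroup W] [Module k W] (S : Submodule k W) {x z : O}
    (Φ : ∀ y, Chain H y z → Chain H x y → W) (c : Chain H x z)
    (h : ∀ y (a : Chain H y z) (b : Chain H x y), a.append b = c → Φ y a b ∈ S) :
    Chain.cutSum Φ c ∈ S :=
  list_sum_mem fun w hw => by
    obtain ⟨s, hs, rfl⟩ := List.mem_map.1 hw
    exact h _ _ _ (Chain.append_of_mem_cuts _ _ hs)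

namespace Homog

variable {s s' : ℤ} {f g : Fam k H H' o}

theorem apply_mem (hf : Homog s f) {d : ℤ} {x y : O} {w : Word k H x y} (hw : w ∈ gr k H d x y) :
    f x y w ∈ gr k H' (d + s) (o x) (o y) := by
  refine gr_le (S := (gr k H' (d + s) (o x) (o y)).comap (f x y)) (fun c hc => ?_) hw
  subst hc
  exact hf x y c

theorem zero : Homog s (0 : Fam k H H' o) := fun _ _ _ => Submodule.zero_mem _

theorem add (hf : Homog s f) (hg : Homog s g) : Homog s (f + g) :=
  fun x y c => Submodule.add_mem _ (hf x y c) (hg x y c)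

theorem sub (hf : Homog s f) (hg : Homog s g) : Homog s (f - g) :=
  fun x y c => Submodule.sub_mem _ (hf x y c) (hg x y c)

theorem comp {f : Fam k H' H'' o'} (hf : Homog s f) (hg : Homog s' g) :
    Homog (s + s') (f.comp g) := fun x y c => by
  have := hf.apply_mem (hg x y c)
  rwa [show c.deg - c.length + s' + s = c.deg - c.length + (s + s') by ring] at this

theorem one : Homog 0 (1 : Fam k H H' o) := fun x y c => by
  cases c with
  | nil => rw [one_nil]; exact of_mem_gr _ (by simp [Chain.deg, Chain.length])
  | cons f c => rw [one_cons]; exact Submodule.zero_mem _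

theorem id : Homog 0 (Fam.id k H) := fun x y c => of_mem_gr c (by simp)

theorem lam : Homog 0 (Fam.lam k H) := fun x y c => by
  rw [lam_of]
  split_ifs
  · exact of_mem_gr c (by simp)
  · exact Submodule.zero_mem _

theorem tau : Homog 0 (Fam.tau k H) := fun x y c => by
  rw [tau_of]
  exact Submodule.smul_mem _ _ (of_mem_gr c (by simp))

theorem mul (hf : Homog s f) (hg : Homog s' g) : Homog (s + s') (f * g) := fun x y c => by
  rw [mul_of]
  refine cutSum_mem _ _ c fun t a b hab => ?_
  have := mul_mem_gr (hf _ _ a) (hg _ _ b)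
  rwa [show a.deg - a.length + s + (b.deg - b.length + s') = c.deg - c.length + (s + s') by
    rw [← hab, Chain.deg_append, Chain.length_append]; push_cast; ring] at this

theorem congr (hf : Homog s f) (h : s = s') : Homog s' f := h ▸ hf

theorem hat (hf : Homog 0 f) : Homog 0 (hat f) := fun x y c => by
  have h : ∀ n, Homog 0 (f ^ n) := by
    intro n
    induction n with
    | zero => exact one
    | succ n ih => rw [pow_succ]; exact (ih.mul hf).congr (zero_add 0)
  have h' : ∀ n, Homog 0 (∑ i ∈ Finset.range n, f ^ i) := by
    intro n
    induction n with
    | zero => exact zero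
    | succ n ih => rw [Finset.sum_range_succ]; exact ih.add (h n)
  have e : Fam.hat f x y (of k c) = _ := lift_of _ _ _
  rw [e]
  exact h' _ x y c

theorem bar {b : Fam k H H fun x => x} (hb : Homog s b) : Homog s (bar b) :=
  (tau.mul (hb.mul id)).congr (by ring)

theorem tau_apply {d : ℤ} {x y : O} {w : Word k H x y} (hw : w ∈ gr k H d x y) :
    Fam.tau k H x y w = sgn k d • w := by
  refine gr_le (S := LinearMap.eqLocus (Fam.tau k H x y) (sgn k d • LinearMap.id))
    (fun c hc => ?_) hw
  subst hc
  exact tau_of c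

theorem tau_comp (hf : Homog s f) :
    (Fam.tau k H').comp f = sgn k s • f.comp (Fam.tau k H) := ext fun x y c => by
  rw [comp_apply, tau_apply (hf x y c), smul_apply, comp_apply, tau_of, map_smul, smul_smul,
    sgn_add, mul_comm]

theorem tau_comp_zero (hf : Homog 0 f) : (Fam.tau k H').comp f = f.comp (Fam.tau k H) := by
  rw [hf.tau_comp, sgn_zero, one_smul]

theorem tau_comp_one (hf : Homog 1 f) : (Fam.tau k H').comp f = -f.comp (Fam.tau k H) := by
  rw [hf.tau_comp, sgn_one, neg_one_smul]

theorem tau_comp_neg_one (hf : Homog (-1) f) :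
    (Fam.tau k H').comp f = -f.comp (Fam.tau k H) := by
  rw [hf.tau_comp, sgn_congr (n := 1) ⟨-1, by ring⟩, sgn_one, neg_one_smul]

end Homog

/-- Existence of fixed points of maps which are contractive with respect to the length. -/
theorem exists_fixedPoint (Φ : Fam k H H' o → Fam k H H' o)
    (hl : ∀ f, IsLetter f → IsLetter (Φ f))
    (hΦ : ∀ n f g, IsLetter f → IsLetter g → EqOn n f g → EqOn (n + 1) (Φ f) (Φ g)) (s : ℤ)
    (hs : ∀ f, IsLetter f → Homog s f → Homog s (Φ f)) :
    ∃ f, IsLetter f ∧ Homog s f ∧ Φ f = f := by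
  let a : ℕ → Fam k H H' o := fun n => Φ^[n] 0
  have ha (n : ℕ) : a (n + 1) = Φ (a n) := Function.iterate_succ_apply' _ _ _
  have hl' (n : ℕ) : IsLetter (a n) := by
    induction n with
    | zero => exact ⟨comp_zero _, fun _ => rfl⟩
    | succ n ih => rw [ha]; exact hl _ ih
  have hs' (n : ℕ) : Homog s (a n) := by
    induction n with
    | zero => exact Homog.zero
    | succ n ih => rw [ha]; exact hs _ (hl' n) ih
  have h₁ (n : ℕ) : EqOn n (a n) (a (n + 1)) := by
    induction n with
    | zero => exact eqOn_zero _ _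
    | succ n ih => rw [ha n, ha (n + 1)]; exact hΦ _ _ _ (hl' n) (hl' (n + 1)) ih
  have h₂ (n m : ℕ) : EqOn n (a n) (a (n + m)) := by
    induction m with
    | zero => exact EqOn.refl _ _
    | succ m ih => exact ih.trans ((h₁ (n + m)).mono (Nat.le_add_right _ _))
  -- The iterate `a n` has its final values on words of length less than `n`, so the limit reads off
  -- each word at the stage given by its length plus one.
  let f : Fam k H H' o := fun x y => lift (fun c => a (c.length + 1) x y (of k c))
    { add := fun c f g d => by
        simp only [Chain.length_append, Chain.length, (of_isMulti k _ _).add, map_add]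
      smul := fun c f g d => by
        simp only [Chain.length_append, Chain.length, (of_isMulti k _ _).smul, map_smul] }
  have hf (n : ℕ) : EqOn n f (a n) := fun x y c hc => by
    refine (lift_of _ _ _).trans ?_
    obtain ⟨m, rfl⟩ := Nat.exists_eq_add_of_le (Nat.succ_le_of_lt hc)
    exact h₂ _ m x y c (Nat.lt_succ_self _)
  have hlf : IsLetter f :=
    { lam_comp := eq_of_eqOn fun n => by
        refine ((hf n).comp_left _).trans ?_
        rw [(hl' n).lam_comp]
        exact (hf n).symm
      nil := fun x => (hf 1 x x .nil Nat.one_pos).trans ((hl' 1).nil x) }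
  refine ⟨f, hlf, fun x y c => ?_, eq_of_eqOn fun n => ?_⟩
  · rw [hf (c.length + 1) x y c (Nat.lt_succ_self _)]
    exact hs' _ x y c
  · refine EqOn.mono (n := n + 1) ?_ n.le_succ
    refine (hΦ n f (a n) hlf (hl' n) (hf n)).trans ?_
    rw [← ha]
    exact (hf (n + 1)).symm

end Fam

/-! ### Translation between operations and families -/

namespace Chain

variable {O : Type u} {H : O → O → ℤ → Type v}

/-- The exponent of the sign which comes from moving suspensions past the letters of a word. -/
def eps {x : O} : ∀ {y : O}, Chain H x y → ℤ
  | _, nil => 0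
  | _, cons (p := p) _ c => p * c.length + c.eps

theorem eps_append {x y : O} : ∀ {z : O} (c : Chain H y z) (d : Chain H x y),
    (c.append d).eps = c.eps + d.eps + c.deg * d.length
  | _, nil, d => by simp [append, eps, deg]
  | _, cons f c, d => by
    simp only [append, eps, deg, eps_append c d, length_append]
    push_cast
    ring

end Chain

namespace Blocks

variable {O : Type u} {H : O → O → ℤ → Type v}

/-- The word which is cut into blocks. -/
def concat {x : O} : ∀ {y : O}, Blocks H x y → Chain H x y
  | _, nil => .nil
  | _, cons b β => b.append β.concat

/-- The sum of the exponents of the blocks. -/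
def eps {x : O} : ∀ {y : O}, Blocks H x y → ℤ
  | _, nil => 0
  | _, cons b β => b.eps + β.eps

theorem length_concat {x : O} : ∀ {y : O} (β : Blocks H x y), β.concat.length = β.length
  | _, nil => rfl
  | _, cons b β => by simp only [concat, Chain.length_append, length, length_concat β]

theorem concat_of_mem {x : O} : ∀ {y : O} (c : Chain H x y), ∀ β ∈ c.blockings, β.concat = c
  | _, .nil, β, h => by
    obtain rfl : β = _ := by simpa [Chain.blockings] using h
    rfl
  | _, .cons f c, β, h => by
    simp only [Chain.blockings, List.mem_flatMap] at h
    obtain ⟨β', h', h⟩ := h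
    have ih := concat_of_mem c β' h'
    subst ih
    cases β' with
    | nil =>
      simp only [Chain.pushBlocks, List.mem_singleton] at h
      subst h
      rfl
    | cons b β' =>
      simp only [Chain.pushBlocks, List.mem_cons, List.not_mem_nil, or_false] at h
      rcases h with rfl | rfl <;> rfl

variable {O' : Type u'} {H' : O' → O' → ℤ → Type v'} (obj : O → O')
  (f : ∀ {x y : O}, Chain H x y → ∀ q : ℤ, H' (obj x) (obj y) q)

theorem length_image {x : O} : ∀ {y : O} (β : Blocks H x y), (β.image obj f).length = β.count
  | _, nil => rfl
  | _, cons _ β => congrArg (· + 1) (length_image β)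

theorem deg_image {x : O} : ∀ {y : O} (β : Blocks H x y),
    (β.image obj f).deg = β.concat.deg + β.count - β.length
  | _, nil => rfl
  | _, cons b β => by
    simp only [image, Chain.deg, deg_image β, concat, Chain.deg_append, count, length]
    push_cast
    ring

/-- The consistency of the sign conventions: moving suspensions past the letters of each block and
then past the images of the blocks gives the sign for the whole word times the sign in the functor
relations. Hence the latter disappears after suspension. -/
theorem even_eps {x : O} : ∀ {y : O} (β : Blocks H x y),
    Even (β.eps + (β.image obj f).eps - (β.concat.eps + β.signExp))
  | _, nil => ⟨0, rfl⟩
  | _, cons b β => by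
    obtain ⟨r, hr⟩ := even_eps β
    simp only [image, eps, Chain.eps, concat, Chain.eps_append, signExp, length_image,
      length_concat]
    exact ⟨r, by linear_combination hr⟩

end Blocks

namespace Word

variable {k : Type w₁} [Field k] {O : Type u} {H : O → O → ℤ → Type v}
  [∀ x y p, AddCommGroup (H x y p)] [∀ x y p, Module k (H x y p)]

/-- The letter of degree `q` of a word. -/
def componentFun (q : ℤ) : ∀ {x y : O}, Chain H x y → H x y q
  | _, _, .nil => 0
  | _, _, .cons (p := p) f .nil => if h : p = q then h ▸ f else 0
  | _, _, .cons _ (.cons _ _) => 0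

theorem componentFun_isMulti (q : ℤ) (x y : O) :
    Chain.IsMulti k (componentFun q : Chain H x y → H x y q) where
  add c f g d := by
    rcases c with _ | ⟨e, _ | ⟨e', c⟩⟩ <;> rcases d with _ | ⟨e'', d⟩ <;>
      simp only [Chain.append, componentFun, add_zero]
    split_ifs with h
    · subst h; rfl
    · simp
  smul c a f d := by
    rcases c with _ | ⟨e, _ | ⟨e', c⟩⟩ <;> rcases d with _ | ⟨e'', d⟩ <;>
      simp only [Chain.append, componentFun, smul_zero]
    split_ifs with h
    · subst h; rfl
    · simp

variable (k) in
/-- The component in the letters of degree `q`. -/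
noncomputable def component (q : ℤ) (x y : O) : Word k H x y →ₗ[k] H x y q :=
  lift _ (componentFun_isMulti q x y)

@[simp]
theorem component_letter (q : ℤ) {x y : O} (f : H x y q) :
    component k q x y (letter x y q f) = f := by
  refine (lift_of _ _ _).trans ?_
  simp [componentFun]

theorem component_of_ne {p q : ℤ} (h : p ≠ q) {x y : O} (f : H x y p) :
    component k q x y (letter x y p f) = 0 := by
  refine (lift_of _ _ _).trans ?_
  simp [componentFun, h]

theorem letter_injective {q : ℤ} {x y : O} {f g : H x y q}
    (h : letter (k := k) x y q f = letter x y q g) : f = g := by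
  have := congrArg (component k q x y) h
  simpa using this

theorem letter_congr {x y : O} (F : ∀ q, H x y q) {p q : ℤ} (h : p = q) :
    letter (k := k) x y p (F p) = letter x y q (F q) := by rw [h]

theorem letter_component {d q : ℤ} (hq : d + 1 = q) {x y : O} {w : Word k H x y}
    (hw : w ∈ Fam.gr k H d x y) (hl : Fam.lam k H x y w = w) :
    letter x y q (component k q x y w) = w := by
  have h : letter x y q (component k q x y w) = Fam.lam k H x y w := by
    refine Fam.gr_le (S := LinearMap.eqLocus ((letter x y q) ∘ₗ (component k q x y))
      (Fam.lam k H x y)) (fun c hc => ?_) hw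
    rw [LinearMap.mem_eqLocus]
    rcases c with _ | ⟨f, _ | ⟨g, c⟩⟩
    · rw [LinearMap.comp_apply, component, lift_of, Fam.lam_of]
      simp [componentFun, Chain.length]
    · rw [Fam.lam_letter]
      rename_i p
      obtain rfl : p = q := by
        simp only [Chain.deg, Chain.length] at hc
        push_cast at hc
        omega
      exact congrArg (letter (k := k) x y p) (component_letter p f)
    · rw [LinearMap.comp_apply, component, lift_of, Fam.lam_of]
      simp [componentFun, Chain.length]
  rw [h, hl]

end Word

namespace Fam

variable {k : Type w₁} [Field k] {O : Type u} {O' : Type u'} {O'' : Type u''}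
  {H : O → O → ℤ → Type v} [∀ x y p, AddCommGroup (H x y p)] [∀ x y p, Module k (H x y p)]
  {H' : O' → O' → ℤ → Type v'} [∀ x y p, AddCommGroup (H' x y p)] [∀ x y p, Module k (H' x y p)]
  {o : O → O'}

open Word

variable (k) in
/-- Multilinear operations on words, homogeneous with respect to degree and length. -/
structure IsOp (s : ℤ) (m : ∀ x y : O, Chain H x y → ∀ q : ℤ, H' (o x) (o y) q) : Prop where
  nil : ∀ (x : O) (q : ℤ), m x x .nil q = 0
  deg : ∀ {x y : O} (c : Chain H x y) (q : ℤ), q ≠ c.deg + s - c.length → m x y c q = 0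
  add : ∀ {x y z w : O} {p : ℤ} (c : Chain H z w) (f g : H y z p) (d : Chain H x y)
    (q : ℤ), m x w (c.append (.cons (f + g) d)) q =
      m x w (c.append (.cons f d)) q + m x w (c.append (.cons g d)) q
  smul : ∀ {x y z w : O} {p : ℤ} (c : Chain H z w) (a : k) (f : H y z p)
    (d : Chain H x y) (q : ℤ), m x w (c.append (.cons (a • f) d)) q =
      a • m x w (c.append (.cons f d)) q

section IsOp

variable {s : ℤ} {m : ∀ x y : O, Chain H x y → ∀ q : ℤ, H' (o x) (o y) q}

/-- The family defined by a collection of operations. -/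
noncomputable def ofOp (hm : IsOp k s m) : Fam k H H' o := fun x y =>
  lift (fun c => sgn k c.eps • letter _ _ _ (m x y c (c.deg + s - c.length)))
    { add := fun {t r p} c f g d => by
        have e (h : H t r p) : (c.append (.cons h d)).deg + s - (c.append (.cons h d)).length =
            c.deg + (p + d.deg) + s - ((c.length + (d.length + 1) : ℕ) : ℤ) := by
          rw [Chain.deg_append, Chain.length_append]
          rfl
        rw [letter_congr (m x y (c.append (.cons f d))) (e f),
          letter_congr (m x y (c.append (.cons g d))) (e g),
          letter_congr (m x y (c.append (.cons (f + g) d))) (e (f + g)), hm.add, map_add, smul_add]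
        simp only [Chain.eps_append, Chain.eps, Chain.length]
      smul := fun {t r p} c a f d => by
        have e (h : H t r p) : (c.append (.cons h d)).deg + s - (c.append (.cons h d)).length =
            c.deg + (p + d.deg) + s - ((c.length + (d.length + 1) : ℕ) : ℤ) := by
          rw [Chain.deg_append, Chain.length_append]
          rfl
        rw [letter_congr (m x y (c.append (.cons f d))) (e f),
          letter_congr (m x y (c.append (.cons (a • f) d))) (e (a • f)), hm.smul, map_smul,
          smul_comm]
        simp only [Chain.eps_append, Chain.eps, Chain.length] }

theorem ofOp_of (hm : IsOp k s m) {x y : O} (c : Chain H x y) {q : ℤ}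
    (hq : c.deg + s - c.length = q) :
    ofOp hm x y (of k c) = sgn k c.eps • letter _ _ q (m x y c q) := by
  subst hq
  exact lift_of _ _ _

theorem isLetter_ofOp (hm : IsOp k s m) : IsLetter (ofOp hm) where
  lam_comp := ext fun x y c => by
    rw [comp_apply, ofOp_of hm c rfl, map_smul]
    exact congrArg _ (lam_letter _)
  nil x := by rw [ofOp_of hm _ rfl, hm.nil, map_zero, smul_zero]

theorem homog_ofOp (hm : IsOp k s m) : Homog (s - 1) (ofOp hm) := fun x y c => by
  rw [ofOp_of hm c rfl]
  refine Submodule.smul_mem _ _ (of_mem_gr _ ?_)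
  simp only [Chain.deg, Chain.length]
  push_cast
  ring

variable (f : Fam k H H' o)

/-- The operations defined by a family with values in the letters. -/
noncomputable def toOp (x y : O) (c : Chain H x y) (q : ℤ) : H' (o x) (o y) q :=
  sgn k c.eps • component k q _ _ (f x y (of k c))

variable {f}

theorem IsLetter.exists_letter (hf : IsLetter f) (hs : Homog (s - 1) f) {x y : O}
    (c : Chain H x y) :
    ∃ g : H' (o x) (o y) (c.deg + s - c.length), f x y (of k c) = Word.letter _ _ _ g :=
  ⟨_, (letter_component (d := c.deg - c.length + (s - 1)) (by ring) (hs x y c) (hf.apply (of k c))).symm⟩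

theorem isOp_toOp (hf : IsLetter f) (hs : Homog (s - 1) f) : IsOp k s (toOp f) where
  nil x q := by rw [toOp, hf.nil, map_zero, smul_zero]
  deg {x y} c q hq := by
    obtain ⟨g, hg⟩ := hf.exists_letter hs c
    rw [toOp, hg, component_of_ne (Ne.symm hq), smul_zero]
  add c g h d q := by
    simp only [toOp, Chain.eps_append, Chain.eps, Chain.length, (of_isMulti k _ _).add, map_add, smul_add]
  smul c a g d q := by
    simp only [toOp, Chain.eps_append, Chain.eps, Chain.length, (of_isMulti k _ _).smul, map_smul]
    rw [smul_comm]

theorem ofOp_toOp (hf : IsLetter f) (hs : Homog (s - 1) f) : ofOp (isOp_toOp hf hs) = f :=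
  ext fun x y c => by
    obtain ⟨g, hg⟩ := hf.exists_letter hs c
    rw [ofOp_of _ _ rfl, toOp, hg, component_letter, map_smul, smul_smul, sgn_mul_self, one_smul]

theorem toOp_ofOp (hm : IsOp k s m) {x y : O} (c : Chain H x y) (q : ℤ) :
    toOp (ofOp hm) x y c q = m x y c q := by
  by_cases hq : c.deg + s - c.length = q
  · rw [toOp, ofOp_of hm c hq, map_smul, component_letter, smul_smul, sgn_mul_self, one_smul]
  · rw [hm.deg c q (Ne.symm hq), (isOp_toOp (isLetter_ofOp hm) (homog_ofOp hm)).deg c q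
      (Ne.symm hq)]

end IsOp

variable {s : ℤ} {m : ∀ x y : O, Chain H x y → ∀ q : ℤ, H x y q} (hm : IsOp (o := fun x => x) k 2 m)
  {m' : ∀ x y : O', Chain H' x y → ∀ q : ℤ, H' x y q} (hm' : IsOp (o := fun x => x) k 2 m')
  {F : ∀ x y : O, Chain H x y → ∀ q : ℤ, H' (o x) (o y) q}

theorem bar_of {b : Fam k H H fun x => x} {x z : O} (c : Chain H x z) :
    bar b x z (of k c) = (c.splits.map fun t => sgn k (t.left.deg - t.left.length) •
      Word.mul (of k t.left) (Word.mul (b _ _ (of k t.mid)) (of k t.right))).sum := by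
  rw [Chain.sum_splits]
  simp only [bar, mul_of, Chain.map_cutSum, tau_of, id_apply, map_smul, LinearMap.smul_apply]

include hm in
-- The signs in the A_∞-relations are the difference between the suspension signs of a word and
-- those of its contractions, up to the Koszul sign contained in `bar`. Leaving `s` free covers both
-- uses: `s = 2` for the relations of a category and `s = 1` for the left side of the functor
-- relations.
theorem ofOp_comp_bar (hF : IsOp k s F) {x z : O} (c : Chain H x z) {q : ℤ}
    (hq : c.deg + s + 1 - c.length = q) :
    (ofOp hF).comp (bar (ofOp hm)) x z (of k c) =
      sgn k c.eps • letter _ _ q (c.splits.map fun t =>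
        t.sign • F x z (t.contract fun {x y} => m x y) q).sum := by
  rw [comp_apply, bar_of, map_list_sum, ← LinearMap.smul_apply, map_list_sum,
    List.map_map, List.map_map]
  refine congrArg List.sum (List.map_congr_left fun t ht => ?_)
  simp only [Function.comp_apply, LinearMap.smul_apply]
  have hc : t.left.append (t.mid.append t.right) = c := by
    simp only [Chain.splits, List.mem_flatMap, List.mem_map] at ht
    obtain ⟨a, ha, b, hb, rfl⟩ := ht
    rw [Chain.append_of_mem_cuts _ _ hb, Chain.append_of_mem_cuts _ _ ha]
  subst hc
  have e : Word.mul (of k t.left) (Word.mul (letter _ _ _ (m _ _ t.mid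
      (t.mid.deg + 2 - t.mid.length))) (of k t.right)) =
      of k (t.contract fun {x y} => m x y) :=
    (congrArg _ (Word.mul_of _ _)).trans (Word.mul_of _ _)
  rw [ofOp_of hm t.mid rfl]
  simp only [map_smul, LinearMap.smul_apply]
  rw [e, ofOp_of hF (q := q)]
  · rw [Units.smul_def, map_zsmul, ← Units.smul_def, Split.sign, sgn_smul (k := k)]
    simp only [smul_smul, ← sgn_add]
    congr 1
    refine sgn_congr ?_
    simp only [Split.contract, Chain.eps_append, Chain.eps, Chain.length_append, Chain.length]
    push_cast
    exact ⟨t.left.deg - t.left.length + t.right.length - t.mid.length * t.right.length -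
      t.mid.length * t.left.deg, by ring⟩
  · rw [← hq]
    simp only [Split.contract, Chain.deg_append, Chain.deg, Chain.length_append, Chain.length]
    push_cast
    ring

/-- The r-th convolution power sums over the cuttings into r nonempty blocks; the empty ones drop
out because the components vanish on empty words. The induction splits off the first block. -/
theorem hat_ofOp_of (hF : IsOp k 1 F) {x z : O} (c : Chain H x z) :
    hat (ofOp hF) x z (of k c) = (c.blockings.map fun β =>
      sgn k β.eps • of k (β.image o fun {x y} => F x y)).sum := by
  obtain ⟨n, hn⟩ : ∃ n, c.length < n := ⟨_, Nat.lt_succ_self _⟩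
  induction n generalizing z with
  | zero => exact absurd hn (Nat.not_lt_zero _)
  | succ n ih =>
    rw [(isLetter_ofOp hF).hat_eq, add_apply, mul_of]
    cases c with
    | nil =>
      rw [Chain.cutSum_nil, (isLetter_ofOp hF).nil]
      simp [Chain.blockings, Blocks.eps, Blocks.image]
    | cons f c =>
      rw [Chain.cutSum_cons, (isLetter_ofOp hF).nil, map_zero, LinearMap.zero_apply, zero_add,
        one_cons, zero_add, Chain.sum_blockings_cons]
      refine Chain.cutSum_congr c fun y a b hab => ?_
      rw [ih b (by simp only [Chain.length] at hn; omega), ofOp_of hF _ rfl, map_list_sum,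
        List.map_map]
      refine congrArg List.sum (List.map_congr_left fun β _ => ?_)
      simp only [Function.comp_apply, map_smul, LinearMap.smul_apply, smul_smul, ← sgn_add,
        Blocks.eps, Blocks.image]
      rw [add_comm]
      exact congrArg _ (Word.mul_of _ _)

include hm' in
theorem ofOp_comp_hat (hF : IsOp k 1 F) {x z : O} (c : Chain H x z) {q : ℤ}
    (hq : c.deg + 2 - c.length = q) :
    (ofOp hm').comp (hat (ofOp hF)) x z (of k c) =
      sgn k c.eps • letter _ _ q (c.blockings.map fun β =>
        β.signExp.negOnePow • m' _ _ (β.image o fun {x y} => F x y) q).sum := by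
  rw [comp_apply, hat_ofOp_of, map_list_sum, ← LinearMap.smul_apply, map_list_sum,
    List.map_map, List.map_map]
  refine congrArg List.sum (List.map_congr_left fun β hβ => ?_)
  have hc := Blocks.concat_of_mem _ _ hβ
  subst hc
  simp only [Function.comp_apply, LinearMap.smul_apply, map_smul]
  rw [ofOp_of hm' (q := q), Units.smul_def, map_zsmul, ← Units.smul_def, sgn_smul (k := k)]
  · simp only [smul_smul, ← sgn_add]
    congr 1
    exact sgn_congr (Blocks.even_eps _ _ _)
  · rw [← hq, Blocks.deg_image, Blocks.length_image, Blocks.length_concat]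
    ring

end Fam

/-! ### Strict units -/

namespace Fam

variable {k : Type w₁} [Field k] {O : Type u} {O' : Type u'} {O'' : Type u''}
  {H : O → O → ℤ → Type v} [∀ x y p, AddCommGroup (H x y p)] [∀ x y p, Module k (H x y p)]
  {H' : O' → O' → ℤ → Type v'} [∀ x y p, AddCommGroup (H' x y p)] [∀ x y p, Module k (H' x y p)]
  {H'' : O'' → O'' → ℤ → Type v''} [∀ x y p, AddCommGroup (H'' x y p)]
  [∀ x y p, Module k (H'' x y p)]
  {o : O → O'} {o' : O' → O''}

open Word

/-- The operations are strictly unital, evaluated on a word `a ⊗ e ⊗ d`. -/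
def UnitalAt (e : ∀ x, H x x 0) (b : Fam k H H fun x => x) {x y z : O} (a : Word k H y z)
    (d : Word k H x y) : Prop :=
  b x z (Word.mul a (Word.mul (letter y y 0 (e y)) d)) =
    Word.mul ((1 : Fam k H H fun x => x) y z a) (lam k H x y d) -
      Word.mul (lam k H y z (tau k H y z a)) ((1 : Fam k H H fun x => x) x y d)

/-- Strict unitality of a functor, evaluated on a word `a ⊗ e ⊗ d`. -/
def UnitalHomAt (e : ∀ x, H x x 0) (e' : ∀ x, H' x x 0) (F : Fam k H H' o) {x y z : O}
    (a : Word k H y z) (d : Word k H x y) : Prop :=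
  F x z (Word.mul a (Word.mul (letter y y 0 (e y)) d)) =
    Word.mul ((1 : Fam k H H' o) y z a)
      (Word.mul (letter (o y) (o y) 0 (e' (o y))) ((1 : Fam k H H' o) x y d))

theorem mul_letter_of {x y z : O} (e : H y y 0) (a : Chain H y z) (d : Chain H x y) :
    Word.mul (of k a) (Word.mul (letter y y 0 e) (of k d)) = of k (a.append (.cons e d)) := by
  exact (congrArg _ (Word.mul_of _ _)).trans (Word.mul_of _ _)

theorem unitalAt_of {e : ∀ x, H x x 0} {b : Fam k H H fun x => x} {x y z : O}
    (h : ∀ (a : Chain H y z) (d : Chain H x y), UnitalAt e b (of k a) (of k d))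
    (a : Word k H y z) (d : Word k H x y) : UnitalAt e b a d := by
  induction a using Word.induction with
  | zero => simp [UnitalAt]
  | add a a' ha ha' =>
    simp only [UnitalAt, map_add, LinearMap.add_apply] at ha ha' ⊢
    rw [ha, ha']
    abel
  | smul r a ha =>
    simp only [UnitalAt, map_smul, LinearMap.smul_apply] at ha ⊢
    rw [ha, smul_sub]
  | of a =>
    induction d using Word.induction with
    | zero => simp [UnitalAt]
    | add d d' hd hd' =>
      simp only [UnitalAt, map_add] at hd hd' ⊢
      rw [hd, hd']
      abel
    | smul r d hd =>
      simp only [UnitalAt, map_smul] at hd ⊢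
      rw [hd, smul_sub]
    | of d => exact h a d

theorem unitalHomAt_of {e : ∀ x, H x x 0} {e' : ∀ x, H' x x 0} {F : Fam k H H' o} {x y z : O}
    (h : ∀ (a : Chain H y z) (d : Chain H x y), UnitalHomAt e e' F (of k a) (of k d))
    (a : Word k H y z) (d : Word k H x y) : UnitalHomAt e e' F a d := by
  induction a using Word.induction with
  | zero => simp [UnitalHomAt]
  | add a a' ha ha' =>
    simp only [UnitalHomAt, map_add, LinearMap.add_apply] at ha ha' ⊢
    rw [ha, ha']
  | smul r a ha =>
    simp only [UnitalHomAt, map_smul, LinearMap.smul_apply] at ha ⊢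
    rw [ha]
  | of a =>
    induction d using Word.induction with
    | zero => simp [UnitalHomAt]
    | add d d' hd hd' =>
      simp only [UnitalHomAt, map_add] at hd hd' ⊢
      rw [hd, hd']
    | smul r d hd =>
      simp only [UnitalHomAt, map_smul] at hd ⊢
      rw [hd]
    | of d => exact h a d

/-- If `F` is strictly unital on shorter words, a proper block containing `e` contributes only if it
is `e` alone, so `hat F` passes through the unit. The one exception is the block consisting of the
whole word, which contributes the correction term. That term is a single letter, and in the
applications the next map annihilates letters. -/
theorem IsLetter.hat_unit_aux {e : ∀ x, H x x 0} {e' : ∀ x, H' x x 0} {F : Fam k H H' o}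
    (hF : IsLetter F) {n : ℕ} (hU : ∀ {x y z : O} (a : Chain H y z) (d : Chain H x y),
      a.length + d.length + 1 < n → UnitalHomAt e e' F (of k a) (of k d))
    {x y z : O} (a : Chain H y z) (d : Chain H x y) (hn : a.length + d.length + 1 < n + 1) :
    hat F x z (of k (a.append (.cons (e y) d))) =
      Word.mul (hat F y z (of k a)) (Word.mul (letter _ _ 0 (e' (o y))) (hat F x y (of k d))) +
        (F x z (of k (a.append (.cons (e y) d))) - Word.mul ((1 : Fam k H H' o) y z (of k a))
          (Word.mul (letter _ _ 0 (e' (o y))) ((1 : Fam k H H' o) x y (of k d)))) := by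
  obtain ⟨m, hm⟩ : ∃ m, a.length < m := ⟨_, Nat.lt_succ_self _⟩
  induction m generalizing z with
  | zero => exact absurd hm (Nat.not_lt_zero _)
  | succ m ih =>
    conv_lhs => rw [hF.hat_eq]
    rw [add_apply, show (1 : Fam k H H' o) x z (of k (a.append (.cons (e y) d))) = 0 from
      (lift_of _ _ _).trans (oneFun_append_cons _ _ _), zero_add, mul_of, Chain.cutSum_append_cons]
    -- The first block ends to the left of `e` in `h₁` and contains `e` in `h₂`. Together they
    -- recover `hat F` on `a` through the equation hat F = 1 + F * hat F.
    have h₁ : Chain.cutSum (fun t a' a'' => Word.mul (F t z (of k a'))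
        (hat F x t (of k (a''.append (.cons (e y) d))))) a =
        Word.mul ((F * hat F) y z (of k a))
          (Word.mul (letter _ _ 0 (e' (o y))) (hat F x y (of k d))) := by
      rw [mul_of, ← LinearMap.flip_apply, Chain.map_cutSum]
      refine Chain.cutSum_congr a fun t a' a'' h => ?_
      cases a' with
      | nil => simp [hF.nil]
      | cons f a' =>
        simp only [Chain.length] at h
        have hU' := hU a'' d (by omega)
        rw [UnitalHomAt, mul_letter_of] at hU'
        rw [ih a'' (by omega) (by omega), hU', sub_self, add_zero, LinearMap.flip_apply,
          Word.mul_assoc]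
    have h₂ : Chain.cutSum (fun t d' d'' => Word.mul (F t z (of k (a.append (.cons (e y) d'))))
        (hat F x t (of k d''))) d =
        Word.mul ((1 : Fam k H H' o) y z (of k a))
          (Word.mul (letter _ _ 0 (e' (o y))) (hat F x y (of k d))) +
        (F x z (of k (a.append (.cons (e y) d))) - Word.mul ((1 : Fam k H H' o) y z (of k a))
          (Word.mul (letter _ _ 0 (e' (o y))) ((1 : Fam k H H' o) x y (of k d)))) := by
      have e₁ : Word.mul ((1 : Fam k H H' o) y z (of k a))
          (Word.mul (letter _ _ 0 (e' (o y))) (hat F x y (of k d))) =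
          Chain.cutSum (fun t d' d'' => Word.mul (Word.mul ((1 : Fam k H H' o) y z (of k a))
          (Word.mul (letter _ _ 0 (e' (o y))) ((1 : Fam k H H' o) t y (of k d'))))
            (hat F x t (of k d''))) d := by
        conv_lhs => rw [← one_mul (hat F), mul_of, Chain.map_cutSum, Chain.map_cutSum]
        simp only [Word.mul_assoc]
      have e₂ : F x z (of k (a.append (.cons (e y) d))) - Word.mul ((1 : Fam k H H' o) y z (of k a))
          (Word.mul (letter _ _ 0 (e' (o y))) ((1 : Fam k H H' o) x y (of k d))) =
          Chain.cutSum (fun t d' d'' => Word.mul (F t z (of k (a.append (.cons (e y) d'))) -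
            Word.mul ((1 : Fam k H H' o) y z (of k a))
          (Word.mul (letter _ _ 0 (e' (o y))) ((1 : Fam k H H' o) t y (of k d'))))
            ((1 : Fam k H H' o) x t (of k d''))) d := by
        rw [Chain.cutSum_eq_right, one_nil, Word.mul_nil]
        intro t r p c f b
        simp
      rw [e₁, e₂, ← Chain.cutSum_add]
      refine Chain.cutSum_congr d fun t d' d'' h => ?_
      cases d'' with
      | nil =>
        rw [hF.hat_nil, one_nil, Word.mul_nil, Word.mul_nil, Word.mul_nil]
        abel
      | cons f d'' =>
        simp only [Chain.length] at h
        have hU' := hU a d' (by omega)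
        rw [UnitalHomAt, mul_letter_of] at hU'
        rw [hU', one_cons, map_zero, add_zero]
    rw [h₁, h₂, ← add_assoc, ← LinearMap.add_apply, ← map_add, ← add_apply, add_comm (F * _),
      ← hF.hat_eq]

theorem IsLetter.hat_unit {e : ∀ x, H x x 0} {e' : ∀ x, H' x x 0} {F : Fam k H H' o}
    (hF : IsLetter F) (hU : ∀ {x y z : O} (a : Word k H y z) (d : Word k H x y),
      UnitalHomAt e e' F a d) {x y z : O} (a : Chain H y z) (d : Chain H x y) :
    hat F x z (of k (a.append (.cons (e y) d))) =
      Word.mul (hat F y z (of k a))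
        (Word.mul (letter _ _ 0 (e' (o y))) (hat F x y (of k d))) := by
  have h := hU (of k a) (of k d)
  rw [UnitalHomAt, mul_letter_of] at h
  rw [hF.hat_unit_aux (n := a.length + d.length + 1) (fun a d _ => hU _ _) a d (by omega), h,
    sub_self, add_zero]

theorem IsLetter.unital_comp_hat {e : ∀ x, H x x 0} {e' : ∀ x, H' x x 0} {e'' : ∀ x, H'' x x 0}
    {F : Fam k H H' o} (hF : IsLetter F) (hU : ∀ {x y z : O} (a : Word k H y z) (d : Word k H x y),
      UnitalHomAt e e' F a d) {G : Fam k H' H'' o'}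
    (hU' : ∀ {x y z : O'} (a : Word k H' y z) (d : Word k H' x y),
      UnitalHomAt e' e'' G a d) {x y z : O} (a : Word k H y z) (d : Word k H x y) :
    UnitalHomAt e e'' (G.comp (hat F)) a d := by
  refine unitalHomAt_of (fun a d => ?_) a d
  have h {x y : O} (a : Chain H x y) : (1 : Fam k H' H'' o') _ _ (hat F _ _ (of k a)) =
      (1 : Fam k H H'' fun x => o' (o x)) _ _ (of k a) :=
    congrFun (congrArg DFunLike.coe (congrFun (congrFun
      (hF.one_comp_hat (H'' := H'') (o' := o')) x) y)) (of k a)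
  rw [UnitalHomAt, mul_letter_of, comp_apply, hF.hat_unit hU, hU', h, h]

end Fam

/-! ### `A_∞`-categories and functors as families -/

namespace AInfCat

open Fam Word

variable {k : Type w₁} [Field k] (C : AInfCat.{u, v} k)

theorem isOp : IsOp (o := fun x => x) k 2 fun x y => C.m (x := x) (y := y) where
  nil := C.m_nil
  deg := C.m_deg
  add := C.m_add
  smul := C.m_smul

/-- The operations as a family of linear maps. -/
noncomputable def fam : Fam k C.Hom C.Hom fun x => x := ofOp C.isOp

theorem isLetter_fam : IsLetter C.fam := isLetter_ofOp _

theorem homog_fam : Homog 1 C.fam := (homog_ofOp C.isOp).congr (by norm_num)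

theorem fam_comp_bar : C.fam.comp (bar C.fam) = 0 := ext fun x y c => by
  refine (ofOp_comp_bar C.isOp C.isOp c rfl).trans ?_
  rw [C.rel, map_zero, smul_zero]
  rfl

theorem fam_letter {x y : C.Obj} {p q : ℤ} (hq : p + 1 = q) (f : C.Hom x y p) :
    C.fam x y (of k (.cons f .nil)) = letter x y q (C.m (.cons f .nil) q) := by
  rw [fam, ofOp_of (q := q)]
  · simp [Chain.eps, Chain.length]
  · simp only [Chain.deg, Chain.length]
    push_cast
    omega

section ofFam

variable {O : Type u} {H : O → O → ℤ → Type v}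
  [∀ x y p, AddCommGroup (H x y p)] [∀ x y p, Module k (H x y p)]
  {b : Fam k H H fun x => x}

/-- The `A_∞`-category with given operations. -/
noncomputable def ofFam (hb : IsLetter b) (hs : Homog 1 b) (h : b.comp (bar b) = 0) :
    AInfCat.{u, v} k :=
  have hs' : Homog (2 - 1) b := hs.congr (by norm_num)
  have hm := isOp_toOp hb hs'
  { Obj := O
    Hom := H
    m := fun {x y} c q => toOp b x y c q
    m_nil := hm.nil
    m_deg := hm.deg
    m_add := hm.add
    m_smul := hm.smul
    rel := fun {x y} c q => by
      -- Only in this degree do the relations carry information; in any other degree each term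
      -- vanishes for degree reasons.
      by_cases hq : c.deg + 2 + 1 - c.length = q
      · have e := ofOp_comp_bar hm hm c hq
        rw [ofOp_toOp hb hs', h] at e
        have e' := congrArg (fun w => sgn k c.eps • component k q x y w) e
        simp only [map_smul, component_letter, smul_smul, sgn_mul_self, one_smul, Fam.zero_apply,
          map_zero, smul_zero] at e'
        exact e'.symm
      · refine List.sum_eq_zero fun t ht => ?_
        obtain ⟨s, hs, rfl⟩ := List.mem_map.1 ht
        rw [hm.deg, smul_zero]
        have hc : s.left.append (s.mid.append s.right) = c := by
          simp only [Chain.splits, List.mem_flatMap, List.mem_map] at hs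
          obtain ⟨a, ha, b, hb, rfl⟩ := hs
          rw [Chain.append_of_mem_cuts _ _ hb, Chain.append_of_mem_cuts _ _ ha]
        subst hc
        simp only [Split.contract, Chain.deg_append, Chain.deg, Chain.length_append,
          Chain.length] at hq ⊢
        push_cast at hq ⊢
        intro h'
        exact hq (by rw [h']; ring) }

end ofFam

end AInfCat

namespace Fam

theorem sgn_smul_injective {k : Type w₁} [Field k] {M : Type v} [AddCommGroup M] [Module k M]
    (n : ℤ) : Function.Injective (fun x : M => sgn k n • x) := fun x y h => by
  have := congrArg (fun z => sgn k n • z) h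
  simpa only [smul_smul, sgn_mul_self, one_smul] using this

end Fam

namespace AInfCat

open Fam Word

variable {k : Type w₁} [Field k] {O : Type u} {H : O → O → ℤ → Type v}
  [∀ x y p, AddCommGroup (H x y p)] [∀ x y p, Module k (H x y p)]
  {b : Fam k H H fun x => x}

theorem ofFam_fam (hb : IsLetter b) (hs : Homog 1 b) (h : b.comp (bar b) = 0) :
    (ofFam hb hs h).fam = b :=
  ofOp_toOp hb (hs.congr (by norm_num))

end AInfCat

namespace AInfFunctor

open Fam Word

variable {k : Type w₁} [Field k] {C : AInfCat.{u, v} k} {D : AInfCat.{u', v'} k}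
  {E : AInfCat.{u'', v''} k}

section

variable (F : AInfFunctor C D)

theorem isOp : IsOp k 1 fun x y => F.map (x := x) (y := y) where
  nil := F.map_nil
  deg := F.map_deg
  add := F.map_add
  smul := F.map_smul

/-- The components of an `A_∞`-functor as a family of linear maps. -/
noncomputable def fam : Fam k C.Hom D.Hom F.obj := ofOp F.isOp

theorem isLetter_fam : IsLetter F.fam := isLetter_ofOp _

theorem homog_fam : Homog 0 F.fam := (homog_ofOp F.isOp).congr (by norm_num)

theorem fam_comp_bar : F.fam.comp (bar C.fam) = D.fam.comp (hat F.fam) := ext fun x y c => by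
  have h₁ := ofOp_comp_bar C.isOp F.isOp c (q := c.deg + 2 - c.length) (by ring)
  have h₂ := ofOp_comp_hat D.isOp F.isOp c (q := c.deg + 2 - c.length) rfl
  refine h₁.trans (Eq.trans ?_ h₂.symm)
  rw [F.rel]

theorem fam_letter {x y : C.Obj} {p : ℤ} (f : C.Hom x y p) :
    F.fam x y (of k (.cons f .nil)) = letter _ _ p (F.map (.cons f .nil) p) := by
  rw [fam, ofOp_of (q := p)]
  · simp [Chain.eps, Chain.length]
  · simp only [Chain.deg, Chain.length]
    push_cast
    omega

end

section ofFam

variable {o : C.Obj → D.Obj} {F : Fam k C.Hom D.Hom o} (hF : IsLetter F) (hs : Homog 0 F)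
  (h : F.comp (bar C.fam) = D.fam.comp (hat F))

/-- The `A_∞`-functor with given components. -/
noncomputable def ofFam : AInfFunctor C D :=
  have hs' : Homog (1 - 1) F := hs.congr (by norm_num)
  have hm := isOp_toOp hF hs'
  { obj := o
    map := fun {x y} c q => toOp F x y c q
    map_nil := hm.nil
    map_deg := hm.deg
    map_add := hm.add
    map_smul := hm.smul
    rel := fun {x y} c q => by
      by_cases hq : c.deg + 2 - c.length = q
      · have e := ofOp_comp_bar C.isOp hm c (q := q) (by rw [← hq]; ring)
        have e₂ := ofOp_comp_hat D.isOp hm c hq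
        have e₃ := congrFun (congrArg DFunLike.coe (congrFun (congrFun h x) y)) (of k c)
        rw [ofOp_toOp hF hs'] at e e₂
        have e₄ := letter_injective (k := k) ((sgn_smul_injective (k := k) c.eps) (e.symm.trans (e₃.trans e₂)))
        exact e₄
      · rw [List.sum_eq_zero, List.sum_eq_zero]
        · intro t ht
          obtain ⟨β, hβ, rfl⟩ := List.mem_map.1 ht
          rw [D.m_deg, smul_zero]
          have hc := Blocks.concat_of_mem _ _ hβ
          subst hc
          rw [Blocks.deg_image, Blocks.length_image, ← Blocks.length_concat]
          intro h'
          exact hq (by rw [h']; ring)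
        · intro t ht
          obtain ⟨s, hs, rfl⟩ := List.mem_map.1 ht
          rw [hm.deg, smul_zero]
          have hc : s.left.append (s.mid.append s.right) = c := by
            simp only [Chain.splits, List.mem_flatMap, List.mem_map] at hs
            obtain ⟨a, ha, b, hb, rfl⟩ := hs
            rw [Chain.append_of_mem_cuts _ _ hb, Chain.append_of_mem_cuts _ _ ha]
          subst hc
          simp only [Split.contract, Chain.deg_append, Chain.deg, Chain.length_append,
            Chain.length] at hq ⊢
          push_cast at hq ⊢
          intro h'
          exact hq (by rw [h']; ring) }

theorem ofFam_fam : (ofFam hF hs h).fam = F :=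
  ofOp_toOp hF (hs.congr (by norm_num))

theorem ofFam_map_letter {x y : C.Obj} {p : ℤ} (f : C.Hom x y p) (q : ℤ) :
    (ofFam hF hs h).map (.cons f .nil) q = component k q _ _ (F x y (of k (.cons f .nil))) := by
  refine Eq.trans (b := toOp F x y (.cons f .nil) q) rfl ?_
  simp [toOp, Chain.eps, Chain.length]

end ofFam

/-- The composition of `A_∞`-functors. -/
noncomputable def comp (G : AInfFunctor D E) (F : AInfFunctor C D) : AInfFunctor C E :=
  ofFam (F := G.fam.comp (hat F.fam)) (F.isLetter_fam.comp_hat G.isLetter_fam)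
    ((G.homog_fam.comp F.homog_fam.hat).congr (by norm_num)) (by
      have h₁ := C.isLetter_fam.bar_comp_hat F.isLetter_fam F.homog_fam.tau_comp_zero
        F.fam_comp_bar.symm
      rw [← F.isLetter_fam.hat_comp_hat G.isLetter_fam, comp_assoc, ← h₁, ← comp_assoc,
        G.fam_comp_bar]
      rfl)

theorem comp_fam (G : AInfFunctor D E) (F : AInfFunctor C D) :
    (G.comp F).fam = G.fam.comp (hat F.fam) :=
  ofFam_fam _ _ _

theorem comp_map_letter (G : AInfFunctor D E) (F : AInfFunctor C D) {x y : C.Obj} {p : ℤ}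
    (f : C.Hom x y p) (q : ℤ) :
    (G.comp F).map (.cons f .nil) q = G.map (.cons (F.map (.cons f .nil) p) .nil) q := by
  have e : hat F.fam x y (of k (.cons f .nil)) = F.fam x y (of k (.cons f .nil)) := by
    rw [F.isLetter_fam.hat_eq, Fam.add_apply, one_cons, zero_add, Fam.mul_of, Chain.cutSum_cons,
      F.isLetter_fam.nil, Chain.cutSum_nil, F.isLetter_fam.hat_nil, Word.mul_nil]
    simp
  refine (ofFam_map_letter _ _ _ f q).trans ?_
  rw [Fam.comp_apply, e, F.fam_letter]
  refine (congrArg _ (G.fam_letter _)).trans ?_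
  by_cases h : p = q
  · subst h
    rw [component_letter]
  · rw [component_of_ne h, G.map_deg]
    simp only [Chain.deg, Chain.length]
    push_cast
    omega

end AInfFunctor

namespace UnitalAInfCat

open Fam Word

variable {k : Type w₁} [Field k] (C : UnitalAInfCat.{u, v} k)

/-- Only the binary operation sees units. Its two unit axioms acquire different signs under
suspension: `e ⊗ f` gives `f`, whereas `f ⊗ e` gives `-τ(f)`, that is (-1)^p f for `f` of degree p.
-/
theorem unitalAt {x y z : C.Obj} (a : Word k C.Hom y z) (d : Word k C.Hom x y) :
    UnitalAt C.one C.fam a d := by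
  refine unitalAt_of (fun a d => ?_) a d
  rw [UnitalAt, mul_letter_of, AInfCat.fam, ofOp_of _ _ rfl]
  by_cases h : (a.append (.cons (C.one y) d)).length = 2
  · rcases a with _ | ⟨f, _ | ⟨f', a⟩⟩
    · rcases d with _ | ⟨g, _ | ⟨g', d⟩⟩
      · simp [Chain.append, Chain.length] at h
      · rename_i p
        simp only [Chain.append, one_nil, one_cons, map_zero, sub_zero, Word.nil_mul, lam_letter]
        refine (congrArg (sgn k _ • ·) (letter_congr (k := k) (C.m (.cons (C.one y) (.cons g .nil)))
          (q := p) ?_)).trans ?_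
        · simp only [Chain.deg, Chain.length]
          push_cast
          ring
        · rw [C.m_one_left]
          simp only [Chain.eps, Chain.length]
          simp
          rfl
      · simp [Chain.append, Chain.length] at h
    · cases d with
      | nil =>
        rename_i p
        simp only [Chain.append, one_nil, one_cons, map_zero, LinearMap.zero_apply, zero_sub,
          tau_of, map_smul, lam_letter]
        refine (congrArg (sgn k _ • ·) (letter_congr (k := k)
          (C.m (.cons f (.cons (C.one _) .nil))) (q := p) ?_)).trans ?_
        · simp only [Chain.deg, Chain.length]
          push_cast
          ring
        rw [C.m_one_right, LinearMap.smul_apply, Word.mul_nil, ← neg_smul]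
        refine congrArg (· • letter _ _ p f) ?_
        rw [← neg_one_mul, ← sgn_one, ← sgn_add]
        refine sgn_congr ?_
        simp only [Chain.eps, Chain.length, Chain.deg]
        push_cast
        exact ⟨0, by ring⟩
      | cons g d => simp [Chain.append, Chain.length] at h
    · simp only [Chain.append, Chain.length, Chain.length_append] at h
      omega
  · rw [C.m_one a d _ h, map_zero, smul_zero]
    rw [Chain.length_append] at h
    rcases a with _ | ⟨f, _ | ⟨f', a⟩⟩
    · rcases d with _ | ⟨g, _ | ⟨g', d⟩⟩
      · simp [lam_of, Chain.length, tau_of]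
      · simp [Chain.length] at h
      · simp [lam_of, Chain.length]
    · cases d with
      | nil => simp [Chain.length] at h
      | cons g d => simp
    · cases d with
      | nil => simp [lam_of, Chain.length, tau_of]
      | cons g d => simp

theorem unital_letter_of {O : Type u} {H : O → O → ℤ → Type v} [∀ x y p, AddCommGroup (H x y p)]
    [∀ x y p, Module k (H x y p)] {b : Fam k H H fun x => x} {e : ∀ x, H x x 0}
    (he : ∀ {x y z : O} (a : Word k H y z) (d : Word k H x y), UnitalAt e b a d) {x y z : O}
    (c : Chain H y z) (d : Chain H x y) : b x z (of k (c.append (.cons (e y) d))) =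
      Word.mul ((1 : Fam k H H fun x => x) y z (of k c)) (lam k H x y (of k d)) -
        Word.mul (lam k H y z (tau k H y z (of k c))) ((1 : Fam k H H fun x => x) x y (of k d)) := by
  have h' := he (of k c) (of k d)
  rw [UnitalAt, mul_letter_of] at h'
  exact h'

section

variable {O : Type u} {H : O → O → ℤ → Type v} [∀ x y p, AddCommGroup (H x y p)]
  [∀ x y p, Module k (H x y p)] {b : Fam k H H fun x => x} {e : ∀ x, H x x 0}
  (he : ∀ {x y z : O} (a : Word k H y z) (d : Word k H x y), UnitalAt e b a d)

include he

theorem toOp_one_left {x y : O} {p : ℤ} (f : H x y p) :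
    toOp b x y (.cons (e y) (.cons f .nil)) p = f := by
  have h' := unital_letter_of he .nil (.cons f .nil)
  simp only [Chain.append, one_nil, one_cons, map_zero, sub_zero, Word.nil_mul,
    lam_letter] at h'
  rw [toOp, h']
  refine Eq.trans (congrArg _ (component_letter (k := k) p f)) ?_
  simp [Chain.eps, Chain.length]

theorem toOp_one_right {x y : O} {p : ℤ} (f : H x y p) :
    toOp b x y (.cons f (.cons (e x) .nil)) p = f := by
  have h' := unital_letter_of he (.cons f .nil) .nil
  simp only [Chain.append, one_nil, one_cons, map_zero, LinearMap.zero_apply, zero_sub,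
    tau_of, map_smul, lam_letter] at h'
  rw [toOp, h', LinearMap.smul_apply, Word.mul_nil, map_neg, map_smul]
  refine Eq.trans (congrArg (fun w => sgn k _ • -(sgn k _ • w))
    (component_letter (k := k) p f)) ?_
  rw [← neg_smul, smul_smul]
  refine Eq.trans (congrArg (· • f) ?_) (one_smul k f)
  rw [← neg_one_mul, ← sgn_one, ← sgn_add, ← sgn_add, ← sgn_zero (k := k)]
  refine sgn_congr ?_
  simp only [Chain.eps, Chain.length, Chain.deg]
  push_cast
  exact ⟨p, by ring⟩

theorem toOp_one {x y z : O} (c : Chain H y z) (d : Chain H x y) (q : ℤ)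
    (hl : (c.append (.cons (e y) d)).length ≠ 2) :
    toOp b x z (c.append (.cons (e y) d)) q = 0 := by
  rw [toOp, unital_letter_of he c d]
  rw [Chain.length_append] at hl
  rcases c with _ | ⟨f, _ | ⟨f', c⟩⟩
  · rcases d with _ | ⟨g, _ | ⟨g', d⟩⟩
    · simp [lam_of, Chain.length, tau_of]
    · simp [Chain.length] at hl
    · simp [lam_of, Chain.length]
  · cases d with
    | nil => simp [Chain.length] at hl
    | cons g d => simp
  · cases d with
    | nil => simp [lam_of, Chain.length, tau_of]
    | cons g d => simp

end

/-- A strictly unital `A_∞`-category, from the operations as a family of linear maps. -/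
noncomputable def ofFam {O : Type u} {H : O → O → ℤ → Type v} [∀ x y p, AddCommGroup (H x y p)]
    [∀ x y p, Module k (H x y p)] {b : Fam k H H fun x => x} (hb : IsLetter b) (hs : Homog 1 b)
    (h : b.comp (bar b) = 0) (e : ∀ x, H x x 0)
    (he : ∀ {x y z : O} (a : Word k H y z) (d : Word k H x y), UnitalAt e b a d) :
    UnitalAInfCat.{u, v} k :=
  { AInfCat.ofFam hb hs h with
    one := e
    m_one_left := toOp_one_left he
    m_one_right := toOp_one_right he
    m_one := toOp_one he }

end UnitalAInfCat

namespace AInfFunctor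

open Fam Word

variable {k : Type w₁} [Field k] {C : UnitalAInfCat.{u, v} k} {D : UnitalAInfCat.{u', v'} k}
  {E : UnitalAInfCat.{u'', v''} k}

theorem IsStrictlyUnital.unitalHomAt {F : AInfFunctor C.toAInfCat D.toAInfCat}
    (hF : F.IsStrictlyUnital) {x y z : C.Obj} (a : Word k C.Hom y z) (d : Word k C.Hom x y) :
    UnitalHomAt C.one D.one F.fam a d := by
  refine unitalHomAt_of (fun a d => ?_) a d
  rw [UnitalHomAt, mul_letter_of, AInfFunctor.fam, ofOp_of _ _ rfl]
  by_cases h : (a.append (.cons (C.one y) d)).length = 1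
  · rw [Chain.length_append] at h
    rcases a with _ | ⟨f, a⟩
    · rcases d with _ | ⟨g, d⟩
      · simp only [one_nil, Word.nil_mul, Word.mul_nil]
        refine (congrArg (sgn k _ • ·) (letter_congr (k := k) (F.map (.cons (C.one _) .nil))
          (q := 0) ?_)).trans ?_
        · simp only [Chain.append, Chain.deg, Chain.length]
          push_cast
        · rw [hF.map_one]
          simp [Chain.append, Chain.eps, Chain.length]
      · simp [Chain.length] at h
    · simp only [Chain.length] at h
      omega
  · rw [hF.map_one_eq_zero a d _ h, _root_.map_zero, smul_zero]
    rcases a with _ | ⟨f, a⟩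
    · rcases d with _ | ⟨g, d⟩
      · simp [Chain.append, Chain.length] at h
      · simp
    · simp

theorem isStrictlyUnital_of_fam {F : AInfFunctor C.toAInfCat D.toAInfCat}
    (h : ∀ {x y z : C.Obj} (a : Word k C.Hom y z) (d : Word k C.Hom x y),
      UnitalHomAt C.one D.one F.fam a d) : F.IsStrictlyUnital where
  map_one x := by
    have h' := h (of k (.nil : Chain C.Hom x x)) (of k .nil)
    rw [UnitalHomAt, mul_letter_of] at h'
    simp only [Chain.append, one_nil, Word.nil_mul, Word.mul_nil] at h'
    rw [fam_letter] at h'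
    exact letter_injective h'
  map_one_eq_zero {x y z} c d q hl := by
    have h' := h (of k c) (of k d)
    rw [UnitalHomAt, mul_letter_of] at h'
    rw [Chain.length_append] at hl
    have e := toOp_ofOp F.isOp (c.append (.cons (C.one y) d)) q
    rw [← e, toOp]
    change sgn k _ • component k q _ _ (F.fam x z _) = 0
    rw [h']
    rcases c with _ | ⟨f, c⟩
    · rcases d with _ | ⟨g, d⟩
      · simp [Chain.length] at hl
      · simp
    · simp

theorem IsStrictlyUnital.comp {G : AInfFunctor D.toAInfCat E.toAInfCat} (hG : G.IsStrictlyUnital)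
    {F : AInfFunctor C.toAInfCat D.toAInfCat} (hF : F.IsStrictlyUnital) :
    (G.comp F).IsStrictlyUnital :=
  isStrictlyUnital_of_fam fun a d => by
    rw [comp_fam]
    exact F.isLetter_fam.unital_comp_hat hF.unitalHomAt hG.unitalHomAt a d

end AInfFunctor

namespace Fam

variable {k : Type w₁} [Field k] {O : Type u} {O' : Type u'} {O'' : Type u''}
  {H : O → O → ℤ → Type v} [∀ x y p, AddCommGroup (H x y p)] [∀ x y p, Module k (H x y p)]
  {H' : O' → O' → ℤ → Type v'} [∀ x y p, AddCommGroup (H' x y p)] [∀ x y p, Module k (H' x y p)]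
  {H'' : O'' → O'' → ℤ → Type v''} [∀ x y p, AddCommGroup (H'' x y p)]
  [∀ x y p, Module k (H'' x y p)]
  {o : O → O'} {o' : O' → O''}

open Word

/-! ### Families which shorten words -/

theorem EqOn.mul_succ {n : ℕ} {f f' g g' : Fam k H H' o} (h : EqOn n f f') (h' : EqOn n g g')
    (hf : ∀ x, f x x (of k .nil) = 0) (hf' : ∀ x, f' x x (of k .nil) = 0)
    (hg : ∀ x, g x x (of k .nil) = 0) (hg' : ∀ x, g' x x (of k .nil) = 0) :
    EqOn (n + 1) (f * g) (f' * g') := fun x y c hc => by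
  simp only [mul_of]
  refine Chain.cutSum_congr c fun t a b hab => ?_
  cases a with
  | nil => rw [hf, hf']; simp
  | cons e a =>
    cases b with
    | nil => rw [hg, hg']; simp
    | cons e' b =>
      simp only [Chain.length] at hab
      rw [h _ _ (.cons e a) (by simp only [Chain.length]; omega),
        h' _ _ (.cons e' b) (by simp only [Chain.length]; omega)]

variable (k H) in
/-- The span of the words of length at most `n`. -/
noncomputable def fil (n : ℤ) (x y : O) : Submodule k (Word k H x y) :=
  Submodule.span k {w | ∃ d : Chain H x y, (d.length : ℤ) ≤ n ∧ w = of k d}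

theorem of_mem_fil {n : ℤ} {x y : O} (c : Chain H x y) (h : (c.length : ℤ) ≤ n) :
    of k c ∈ fil k H n x y :=
  Submodule.subset_span ⟨c, h, rfl⟩

theorem fil_le {x y : O} {n : ℤ} {S : Submodule k (Word k H x y)}
    (h : ∀ c : Chain H x y, (c.length : ℤ) ≤ n → of k c ∈ S) : fil k H n x y ≤ S :=
  Submodule.span_le.2 (by rintro _ ⟨c, hc, rfl⟩; exact h c hc)

theorem mul_mem_fil {x y z : O} {m n : ℤ} {a : Word k H y z} {b : Word k H x y}
    (ha : a ∈ fil k H m y z) (hb : b ∈ fil k H n x y) : Word.mul a b ∈ fil k H (m + n) x z := by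
  refine fil_le (S := (fil k H (m + n) x z).comap (Word.mul.flip b)) (fun c hc => ?_) ha
  refine fil_le (S := (fil k H (m + n) x z).comap (Word.mul (of k c))) (fun c' hc' => ?_) hb
  rw [Submodule.mem_comap, Word.mul_of]
  refine of_mem_fil _ ?_
  rw [Chain.length_append]
  push_cast
  omega

theorem lam_mem_fil {x y : O} (w : Word k H x y) : lam k H x y w ∈ fil k H 1 x y := by
  induction w using Word.induction with
  | zero => rw [map_zero]; exact Submodule.zero_mem _
  | add _ _ h h' => rw [map_add]; exact Submodule.add_mem _ h h'
  | smul _ _ h => rw [map_smul]; exact Submodule.smul_mem _ _ h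
  | of c =>
    rw [lam_of]
    split_ifs with h
    · exact of_mem_fil c (by omega)
    · exact Submodule.zero_mem _

/-- Families which shorten words by at least `s` letters. -/
def Lowers (s : ℤ) (f : Fam k H H' o) : Prop :=
  ∀ (x y : O) (c : Chain H x y), f x y (of k c) ∈ fil k H' (c.length - s) (o x) (o y)

namespace Lowers

variable {s s' : ℤ} {f g : Fam k H H' o}

theorem id : Lowers 0 (Fam.id k H) := fun x y c => of_mem_fil c (by simp)

theorem one : Lowers 0 (1 : Fam k H H' o) := fun x y c => by
  cases c with
  | nil => rw [one_nil]; exact of_mem_fil _ (by simp [Chain.length])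
  | cons f c => rw [one_cons]; exact Submodule.zero_mem _

theorem tau : Lowers 0 (Fam.tau k H) := fun x y c => by
  rw [tau_of]
  exact Submodule.smul_mem _ _ (of_mem_fil c (by simp))

theorem mul (hf : Lowers s f) (hg : Lowers s' g) : Lowers (s + s') (f * g) := fun x y c => by
  rw [mul_of]
  refine cutSum_mem _ _ _ fun t a b hab => ?_
  subst hab
  have := mul_mem_fil (hf _ _ a) (hg _ _ b)
  rwa [show (a.length : ℤ) - s + (b.length - s') = ((a.append b).length : ℕ) - (s + s') by
    rw [Chain.length_append]; push_cast; ring] at this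

theorem congr (hf : Lowers s f) (h : s = s') : Lowers s' f := h ▸ hf

theorem of_letter (hf : IsLetter f) : Lowers 0 f := fun x y c => by
  cases c with
  | nil => rw [hf.nil]; exact Submodule.zero_mem _
  | cons e c =>
    rw [← hf.apply]
    refine fil_le (fun d hd => of_mem_fil d ?_) (lam_mem_fil _)
    simp only [Chain.length]
    push_cast
    omega

theorem of_letter_of_eqOn (hf : IsLetter f) (h : EqOn 2 f 0) : Lowers 1 f := fun x y c => by
  by_cases hc : c.length < 2
  · rw [h x y c hc]
    exact Submodule.zero_mem _
  · rw [← hf.apply]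
    exact fil_le (fun d hd => of_mem_fil d (by omega)) (lam_mem_fil _)

theorem hat (hf : IsLetter f) : Lowers 0 (hat f) := fun x y c => by
  obtain ⟨n, hn⟩ : ∃ n, c.length < n := ⟨_, Nat.lt_succ_self _⟩
  induction n generalizing y with
  | zero => exact absurd hn (Nat.not_lt_zero _)
  | succ n ih =>
    rw [hf.hat_eq, add_apply]
    refine Submodule.add_mem _ (one x y c) ?_
    rw [mul_of]
    refine cutSum_mem _ _ _ fun t a b hab => ?_
    subst hab
    cases a with
    | nil => rw [hf.nil]; simp
    | cons e a =>
      rw [Chain.length_append] at hn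
      have := mul_mem_fil (of_letter hf _ _ (.cons e a)) (ih _ b (by
        simp only [Chain.length] at hn; omega))
      rwa [show (((Chain.cons e a).length : ℕ) : ℤ) - 0 + (b.length - 0) =
        (((Chain.cons e a).append b).length : ℕ) - 0 by
          rw [Chain.length_append]; push_cast; ring] at this

/-- From hat f - hat g = (f - g) * hat f + g * (hat f - hat g): every term contains a factor `f -
g`, which loses a letter, while the other factors do not lengthen words. -/
theorem hat_sub_hat (hf : IsLetter f) (hg : IsLetter g) (h : Lowers 1 (f - g)) :
    Lowers 1 (Fam.hat f - Fam.hat g) := fun x y c => by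
  obtain ⟨n, hn⟩ : ∃ n, c.length < n := ⟨_, Nat.lt_succ_self _⟩
  induction n generalizing y with
  | zero => exact absurd hn (Nat.not_lt_zero _)
  | succ n ih =>
    have e : Fam.hat f - Fam.hat g = (f - g) * Fam.hat f + g * (Fam.hat f - Fam.hat g) := by
      conv_lhs => rw [hf.hat_eq, hg.hat_eq]
      noncomm_ring
    rw [e, add_apply]
    refine Submodule.add_mem _ ((h.mul (hat hf)) x y c) ?_
    rw [mul_of]
    refine cutSum_mem _ _ _ fun t a b hab => ?_
    subst hab
    cases a with
    | nil => rw [hg.nil]; simp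
    | cons e a =>
      rw [Chain.length_append] at hn
      have := mul_mem_fil (of_letter hg _ _ (.cons e a)) (ih _ b (by
        simp only [Chain.length] at hn; omega))
      rwa [show (((Chain.cons e a).length : ℕ) : ℤ) - 0 + (b.length - 1) =
        (((Chain.cons e a).append b).length : ℕ) - 1 by
          rw [Chain.length_append]; push_cast; ring] at this

/-- Together with the vanishing of operations on letters, this is the source of the gain of one
letter in each induction step of the transfer. -/
theorem eqOn_comp {f f' : Fam k H' H'' o'} {n m : ℕ} (h : EqOn n f f') (hg : Lowers s g)
    (hm : (m : ℤ) ≤ n + s) : EqOn m (f.comp g) (f'.comp g) := fun x y c hc => by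
  rw [comp_apply, comp_apply]
  refine fil_le (S := LinearMap.eqLocus (f (o x) (o y)) (f' (o x) (o y))) (fun d hd => ?_)
    (hg x y c)
  exact h _ _ d (by omega)

end Lowers

theorem comp_lam_of_eqOn {f : Fam k H H' o} (h : EqOn 2 f 0) : f.comp (lam k H) = 0 :=
  ext fun x y c => by
    rw [comp_apply, lam_of]
    split_ifs with hc
    · exact h x y c (by omega)
    · rw [map_zero, zero_apply]

theorem eqOn_of_comp_lam {f : Fam k H H' o} (hf : ∀ x, f x x (of k .nil) = 0)
    (h : f.comp (lam k H) = 0) : EqOn 2 f 0 := fun x y c hc => by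
  cases c with
  | nil => exact hf x
  | cons e c =>
    cases c with
    | nil =>
      have := congrFun (congrArg DFunLike.coe (congrFun (congrFun h x) y))
        (of k (.cons e .nil))
      rwa [comp_apply, lam_of, if_pos (show (Chain.cons e Chain.nil).length = 1 from rfl)] at this
    | cons _ _ => simp only [Chain.length] at hc; omega

/-- Linear maps do not see long words. -/
theorem comp_hat_of_linear {f : Fam k H' H'' o'} (hf : f.comp (lam k H') = f) {F : Fam k H H' o}
    (hF : IsLetter F) : f.comp (hat F) = f.comp F := by
  rw [← hf, comp_assoc, hF.lam_comp_hat, comp_assoc, hF.lam_comp]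

theorem comp_bar_of_linear {f : Fam k H H' o} (hf : f.comp (lam k H) = f)
    {b : Fam k H H fun x => x} (hb : IsLetter b) : f.comp (bar b) = f.comp b := by
  rw [← hf, comp_assoc, hb.lam_comp_bar, comp_assoc, hb.lam_comp]

theorem IsLetter.comp_eq_zero {f : Fam k H' H'' o'} (hf : f.comp (lam k H') = 0) {F : Fam k H H' o}
    (hF : IsLetter F) : f.comp F = 0 := by
  rw [← hF.lam_comp, ← comp_assoc, hf, zero_comp]

theorem comp_one_eq_zero {f : Fam k H' H'' o'} (hf : ∀ x, f x x (of k .nil) = 0) :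
    f.comp (1 : Fam k H H' o) = 0 := ext fun x y c => by
  cases c with
  | nil => rw [comp_apply, one_nil, hf]; rfl
  | cons e c => rw [comp_apply, one_cons, map_zero]; rfl

/-- Since `f` annihilates letters, only products of at least two values of `F` matter, and each
factor is evaluated on a strictly shorter word. This makes the transfer recursions contractive. -/
theorem IsLetter.comp_hat_eqOn_succ {f : Fam k H' H'' o'} (hf : IsLetter f)
    (hl : f.comp (lam k H') = 0) {F G : Fam k H H' o} (hF : IsLetter F) (hG : IsLetter G) {n : ℕ}
    (h : EqOn n F G) : EqOn (n + 1) (f.comp (hat F)) (f.comp (hat G)) := by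
  rw [hF.hat_eq_add, hG.hat_eq_add]
  simp only [comp_add, comp_one_eq_zero hf.nil, hF.comp_eq_zero hl, hG.comp_eq_zero hl, zero_add]
  refine EqOn.comp_left (EqOn.mul_succ h (h.mul (hF.hat_congr hG h)) hF.nil hG.nil ?_ ?_) f
  · intro x
    rw [mul_nil, hF.nil]
    simp
  · intro x
    rw [mul_nil, hG.nil]
    simp

theorem IsLetter.comp_hat_comp_lam {f : Fam k H' H'' o'} (hf : IsLetter f)
    (hl : f.comp (lam k H') = 0) {F : Fam k H H' o} (hF : IsLetter F) :
    (f.comp (hat F)).comp (lam k H) = 0 := by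
  have h0 : IsLetter (0 : Fam k H H' o) := ⟨comp_zero _, fun _ => rfl⟩
  have h := hf.comp_hat_eqOn_succ hl hF h0 (n := 1) (fun x y c hc => by
    cases c with
    | nil => exact hF.nil x
    | cons _ _ => simp only [Chain.length] at hc; omega)
  have e : hat (0 : Fam k H H' o) = 1 := by rw [h0.hat_eq, zero_mul, add_zero]
  rw [e, comp_one_eq_zero hf.nil] at h
  exact comp_lam_of_eqOn h

end Fam

namespace Fam

variable {k : Type w₁} [Field k] {O : Type u}
  {H : O → O → ℤ → Type v} [∀ x y p, AddCommGroup (H x y p)] [∀ x y p, Module k (H x y p)]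
  {H' : O → O → ℤ → Type v'} [∀ x y p, AddCommGroup (H' x y p)] [∀ x y p, Module k (H' x y p)]

open Word

/-! ### Homotopy transfer -/

/-- The linear part of a family of operations. -/
noncomputable def linPart (b : Fam k H H fun x => x) : Fam k H H fun x => x := b.comp (lam k H)

theorem linPart_comp_lam (b : Fam k H H fun x => x) : (linPart b).comp (lam k H) = linPart b := by
  rw [linPart, comp_assoc, lam_lam]

/-- The operations of arity at least two. -/
noncomputable def higherPart (b : Fam k H H fun x => x) : Fam k H H fun x => x := b - linPart b

/-- The operations of the minimal model. -/
noncomputable def transfer (b : Fam k H H fun x => x) (p : Fam k H H' fun x => x)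
    (I : Fam k H' H fun x => x) : Fam k H' H' fun x => x :=
  p.comp ((higherPart b).comp (hat I))

/-- A strong deformation retraction of the complexes of morphisms, with zero differential on the
retract. -/
structure Retraction (b : Fam k H H fun x => x) (i : Fam k H' H fun x => x)
    (p : Fam k H H' fun x => x) (h : Fam k H H fun x => x) : Prop where
  b_letter : IsLetter b
  b_homog : Homog 1 b
  b_bar : b.comp (bar b) = 0
  i_letter : IsLetter i
  p_letter : IsLetter p
  h_letter : IsLetter h
  i_lam : i.comp (lam k H') = i
  p_lam : p.comp (lam k H) = p
  h_lam : h.comp (lam k H) = h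
  i_homog : Homog 0 i
  p_homog : Homog 0 p
  h_homog : Homog (-1) h
  p_i : p.comp i = lam k H'
  h_i : h.comp i = 0
  p_h : p.comp h = 0
  h_h : h.comp h = 0
  b_i : (linPart b).comp i = 0
  p_b : p.comp (linPart b) = 0
  b_b : (linPart b).comp (linPart b) = 0
  b_h : (linPart b).comp h + h.comp (linPart b) = lam k H - i.comp p

namespace Retraction

variable {b : Fam k H H fun x => x} {i : Fam k H' H fun x => x} {p : Fam k H H' fun x => x}
  {h : Fam k H H fun x => x} (r : Retraction b i p h)

include r

theorem linPart_letter : IsLetter (linPart b) := r.b_letter.comp isLetter_lam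

theorem higherPart_letter : IsLetter (higherPart b) := r.b_letter.sub r.linPart_letter

theorem higherPart_lam : (higherPart b).comp (lam k H) = 0 := by
  rw [higherPart, sub_comp, linPart_comp_lam b, linPart, sub_self]

theorem linPart_homog : Homog 1 (linPart b) := (r.b_homog.comp Homog.lam).congr (by norm_num)

theorem higherPart_homog : Homog 1 (higherPart b) := r.b_homog.sub r.linPart_homog

/-- The relation `b ∘ bar b = 0` with the linear part d of the first factor separated; d² = 0
removes the term of d with itself. -/
theorem linPart_comp_higherPart :
    (linPart b).comp (higherPart b) = -(higherPart b).comp (bar b) := by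
  have e : b.comp (bar b) = (linPart b).comp (bar b) + (higherPart b).comp (bar b) := by
    rw [← add_comp, higherPart, add_sub_cancel]
  have e' := comp_bar_of_linear (linPart_comp_lam b) r.b_letter
  have e'' : (linPart b).comp b = (linPart b).comp (higherPart b) := by
    rw [higherPart, comp_sub, r.b_b, sub_zero]
  rw [r.b_bar, e', e''] at e
  exact eq_neg_of_add_eq_zero_left e.symm

/-- The recursive equation for the inclusion of the minimal model. -/
theorem exists_incl : ∃ I : Fam k H' H fun x => x, IsLetter I ∧ Homog 0 I ∧
    i - h.comp ((higherPart b).comp (hat I)) = I :=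
  exists_fixedPoint (fun I => i - h.comp ((higherPart b).comp (hat I)))
    (fun I hI => r.i_letter.sub (r.h_letter.comp (hI.comp_hat r.higherPart_letter)))
    (fun n I J hI hJ hIJ => (EqOn.refl _ _).sub (EqOn.comp_left
      (r.higherPart_letter.comp_hat_eqOn_succ r.higherPart_lam hI hJ hIJ) h)) 0
    (fun I _ hI => r.i_homog.sub
      ((r.h_homog.comp (r.higherPart_homog.comp hI.hat)).congr (by norm_num)))

section incl

variable {I : Fam k H' H fun x => x} (hI : IsLetter I) (hs : Homog 0 I)
  (e : i - h.comp ((higherPart b).comp (hat I)) = I)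

include hI

theorem transfer_letter : IsLetter (transfer b p I) :=
  r.p_letter.comp (hI.comp_hat r.higherPart_letter)

theorem transfer_lam : (transfer b p I).comp (lam k H') = 0 := by
  rw [transfer, comp_assoc, r.higherPart_letter.comp_hat_comp_lam r.higherPart_lam hI, comp_zero]

include hs in
theorem transfer_homog : Homog 1 (transfer b p I) :=
  (r.p_homog.comp (r.higherPart_homog.comp hs.hat)).congr (by norm_num)

include e

theorem p_comp_incl : p.comp I = lam k H' := by
  rw [← e, comp_sub, r.p_i, ← comp_assoc, r.p_h, zero_comp, sub_zero]

theorem h_comp_incl : h.comp I = 0 := by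
  rw [← e, comp_sub, r.h_i, ← comp_assoc, r.h_h, zero_comp, sub_zero]

theorem incl_lam : I.comp (lam k H') = i := by
  conv_lhs => rw [← e]
  rw [sub_comp, r.i_lam, comp_assoc, r.higherPart_letter.comp_hat_comp_lam r.higherPart_lam hI,
    comp_zero, sub_zero]

/-- By the recursion d I = -d h b_{≥2} hat I. Replacing d h by 1 - i p - h d cancels the term b_{≥2}
hat I and leaves the transferred operation and a term in the image of h. -/
theorem comp_incl : b.comp (hat I) =
    i.comp (transfer b p I) + h.comp ((linPart b).comp ((higherPart b).comp (hat I))) := by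
  have e₁ : b.comp (hat I) = (linPart b).comp I + (higherPart b).comp (hat I) := by
    rw [← comp_hat_of_linear (linPart_comp_lam b) hI, ← add_comp, higherPart, add_sub_cancel]
  have e₂ : (linPart b).comp I = -(((linPart b).comp h).comp ((higherPart b).comp (hat I))) := by
    conv_lhs => rw [← e]
    rw [comp_sub, r.b_i, zero_sub, comp_assoc]
  have e₃ : (linPart b).comp h = lam k H - i.comp p - h.comp (linPart b) := by
    rw [← r.b_h, add_sub_cancel_right]
  rw [e₁, e₂, e₃, sub_comp, sub_comp, ← comp_assoc (lam k H), r.higherPart_letter.lam_comp,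
    transfer, comp_assoc, comp_assoc]
  abel

theorem incl_comp_bar : I.comp (bar (transfer b p I)) =
    i.comp (transfer b p I) -
      h.comp ((higherPart b).comp ((hat I).comp (bar (transfer b p I)))) := by
  refine (congrArg (fun J => comp J (bar (transfer b p I))) e).symm.trans ?_
  rw [sub_comp, comp_bar_of_linear r.i_lam (r.transfer_letter hI), comp_assoc, comp_assoc]

/-- The deviation of `I` from the functor equation is -h b_{≥2} applied to the deviation of `hat I`
on whole words. This is contractive, as b_{≥2} annihilates letters. -/
theorem comp_incl_sub : b.comp (hat I) - I.comp (bar (transfer b p I)) =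
    -h.comp ((higherPart b).comp ((bar b).comp (hat I) - (hat I).comp (bar (transfer b p I)))) := by
  rw [r.comp_incl hI e, r.incl_comp_bar hI e, ← comp_assoc (linPart b), r.linPart_comp_higherPart,
    neg_comp, comp_neg, comp_sub, comp_sub, comp_assoc]
  abel

include hs

/-- Induction on the length. If the deviation vanishes on words of length less than n, then on words
of length n the deviation of `hat I` is a letter by `bar_comp_hat_eqOn`, so b_{≥2} annihilates it,
and `comp_incl_sub` concludes. -/
theorem comp_hat_incl : b.comp (hat I) = I.comp (bar (transfer b p I)) := by
  refine sub_eq_zero.1 (eq_of_eqOn_succ fun n hn => ?_)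
  have h₁ := (r.transfer_letter hI).bar_comp_hat_eqOn r.b_letter hI hs.tau_comp_zero hn
  have h₂ := EqOn.comp_left (EqOn.comp_left h₁ (higherPart b)) h
  have h₃ : (higherPart b).comp (b.comp (hat I) - I.comp (bar (transfer b p I))) = 0 :=
    ((hI.comp_hat r.b_letter).sub ((r.transfer_letter hI).comp_bar hI)).comp_eq_zero
      r.higherPart_lam
  rw [h₃, comp_zero] at h₂
  conv_lhs => rw [r.comp_incl_sub hI e]
  have h₄ := h₂.neg
  rwa [neg_zero] at h₄

theorem bar_comp_hat_incl : (bar b).comp (hat I) = (hat I).comp (bar (transfer b p I)) :=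
  (r.transfer_letter hI).bar_comp_hat hI hs.tau_comp_zero (r.comp_hat_incl hI hs e)

/-- Moving the coderivation through `hat I` gives p b_{≥2} (bar b) hat I = -p d b_{≥2} hat I, which
vanishes because p d = 0. -/
theorem transfer_comp_bar : (transfer b p I).comp (bar (transfer b p I)) = 0 := by
  conv_lhs => rw [transfer]
  rw [comp_assoc, comp_assoc]
  conv_lhs =>
    enter [2, 2]
    change (hat I).comp (bar (transfer b p I))
    rw [← r.bar_comp_hat_incl hI hs e]
  rw [← comp_assoc (higherPart b), ← neg_neg ((higherPart b).comp (bar b)),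
    ← r.linPart_comp_higherPart, neg_comp, comp_neg, comp_assoc, ← comp_assoc p, r.p_b, zero_comp,
    neg_zero]

end incl

end Retraction

end Fam

/-! ### Homotopy transfer: the projection to the minimal model -/

namespace Fam

variable {k : Type w₁} [Field k] {O : Type u}
  {H : O → O → ℤ → Type v} [∀ x y p, AddCommGroup (H x y p)] [∀ x y p, Module k (H x y p)]
  {H' : O → O → ℤ → Type v'} [∀ x y p, AddCommGroup (H' x y p)] [∀ x y p, Module k (H' x y p)]

open Word

/-- The extension of a homotopy to words. -/
noncomputable def extHomotopy (h g : Fam k H H fun x => x) : Fam k H H fun x => x :=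
  tau k H * (h * hat g)

theorem extHomotopy_eq_cod (h g : Fam k H H fun x => x) :
    extHomotopy h g = cod ((lam k H).comp (tau k H)) h g := by
  rw [extHomotopy, cod, hat_lam_tau]

theorem bar_add (b b' : Fam k H H fun x => x) : bar (b + b') = bar b + bar b' := by
  rw [bar, bar, bar, add_mul, mul_add]

theorem id_eq : id k H = 1 + id k H * lam k H := by
  conv_lhs => rw [← hat_lam, isLetter_lam.hat_eq', hat_lam]

theorem IsLetter.hat_comp_lam {F : Fam k H H' fun x => x} (hF : IsLetter F) :
    (hat F).comp (lam k H) = F.comp (lam k H) := by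
  have h₁ : EqOn 1 F 0 := fun x y c hc => by
    cases c with
    | nil => exact hF.nil x
    | cons _ _ => simp only [Chain.length] at hc; omega
  have h₂ := h₁.mul_succ (h₁.mul (EqOn.refl 1 (hat F))) hF.nil (fun _ => rfl)
    (fun x => by rw [mul_nil, hF.nil]; simp) (fun x => by rw [zero_mul]; rfl)
  rw [zero_mul] at h₂
  rw [hF.hat_eq_add, add_comp, comp_lam_of_eqOn h₂, add_zero, add_comp, one_comp_lam, zero_add]

namespace Retraction

variable {b : Fam k H H fun x => x} {i : Fam k H' H fun x => x} {p : Fam k H H' fun x => x}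
  {h : Fam k H H fun x => x} (r : Retraction b i p h)

include r

theorem i_p_letter : IsLetter (i.comp p) := r.i_letter.comp r.p_letter

theorem lowers_extHomotopy : Lowers 0 (extHomotopy h (i.comp p)) :=
  (Lowers.tau.mul ((Lowers.of_letter r.h_letter).mul (Lowers.hat r.i_p_letter))).congr (by norm_num)

theorem lowers_bar_higherPart : Lowers 1 (bar (higherPart b)) :=
  (Lowers.tau.mul ((Lowers.of_letter_of_eqOn r.higherPart_letter
    (eqOn_of_comp_lam r.higherPart_letter.nil r.higherPart_lam)).mul Lowers.id)).congr (by norm_num)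

theorem homog_extHomotopy : Homog (-1) (extHomotopy h (i.comp p)) :=
  (Homog.tau.mul (r.h_homog.mul
    ((r.i_homog.comp r.p_homog).congr (s' := 0) (by norm_num)).hat)).congr (by norm_num)

theorem linPart_mul_hat : (linPart b * id k H).comp (hat (i.comp p)) = 0 := by
  rw [r.i_p_letter.mul_comp_hat, comp_hat_of_linear (linPart_comp_lam b) r.i_p_letter, ← comp_assoc,
    r.b_i, zero_comp, zero_mul]

theorem bar_linPart_comp_hat : (bar (linPart b)).comp (hat (i.comp p)) = 0 := by
  rw [bar, r.i_p_letter.mul_comp_hat, r.linPart_mul_hat, mul_zero]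

theorem hat_comp_bar_linPart : (hat (i.comp p)).comp (bar (linPart b)) = 0 := by
  have hb := r.linPart_letter
  have h₁ : (i.comp p).comp (linPart b) = 0 := by rw [comp_assoc, r.p_b, comp_zero]
  have e : (hat (i.comp p)).comp (bar (linPart b)) =
      0 + (i.comp p).comp (tau k H) * (hat (i.comp p)).comp (bar (linPart b)) := by
    conv_lhs => rw [r.i_p_letter.hat_eq]
    rw [add_comp, hb.one_comp_bar, hb.mul_comp_bar, comp_bar_of_linear _ hb, h₁, zero_mul]
    · rw [zero_add]
    · rw [comp_assoc, r.p_lam]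
  exact r.i_p_letter.comp_tau.unique e (by rw [mul_zero, add_zero])

theorem bar_linPart_comp_bar_linPart : (bar (linPart b)).comp (bar (linPart b)) = 0 :=
  r.linPart_letter.bar_comp_bar_eq_zero r.linPart_homog.tau_comp_one
    (by rw [comp_bar_of_linear (linPart_comp_lam b) r.linPart_letter, r.b_b])

/-- The tensor trick: h acts on one letter, with `i p` on all letters to its right and the identity,
up to sign, on those to its left. The terms in which d acts to the left of h cancel, those in which
d meets `i p` vanish, and the remaining ones telescope. -/
theorem bar_linPart_extHomotopy :
    (bar (linPart b)).comp (extHomotopy h (i.comp p)) +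
      (extHomotopy h (i.comp p)).comp (bar (linPart b)) = id k H - hat (i.comp p) := by
  have hb := r.linPart_letter
  have hg := r.i_p_letter
  set g := i.comp p with hg'
  have hc : (extHomotopy h g) = tau k H * (h * hat g) := rfl
  have e₁ : (linPart b * id k H).comp (extHomotopy h g) =
      (linPart b).comp h * hat g + (linPart b).comp (tau k H) * extHomotopy h g := by
    conv_lhs => rw [extHomotopy_eq_cod, isLetter_lam_tau.mul_comp_cod r.h_letter hg, hat_lam_tau,
      ← extHomotopy_eq_cod]
    congr 2
    rw [← linPart_comp_lam b, comp_assoc, extHomotopy_eq_cod, isLetter_lam_tau.lam_comp_cod r.h_letter hg,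
      comp_assoc, r.h_letter.lam_comp]
  have e₂ : (bar (linPart b)).comp (extHomotopy h g) =
      id k H * ((linPart b).comp h * hat g) +
        id k H * ((linPart b).comp (tau k H) * extHomotopy h g) := by
    conv_lhs => rw [bar, extHomotopy_eq_cod, isLetter_lam_tau.mul_comp_cod r.h_letter hg,
      r.linPart_mul_hat, mul_zero, zero_add, hat_lam_tau, ← extHomotopy_eq_cod, tau_tau, e₁,
      mul_add]
  have e₃ : (h * hat g).comp (bar (linPart b)) = h.comp (linPart b) * hat g := by
    rw [hb.mul_comp_bar, r.hat_comp_bar_linPart, mul_zero, add_zero, comp_bar_of_linear r.h_lam hb]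
  have e₄ : (tau k H).comp (bar (linPart b)) =
      -(id k H * ((linPart b).comp (tau k H) * tau k H)) := by
    rw [bar, tau_comp_mul, tau_comp_mul, r.linPart_homog.tau_comp_one, tau_tau, comp_id, neg_mul,
      mul_neg]
  have e₅ : (extHomotopy h g).comp (bar (linPart b)) =
      -(id k H * ((linPart b).comp (tau k H) * extHomotopy h g)) +
        id k H * (h.comp (linPart b) * hat g) := by
    conv_lhs => rw [extHomotopy, hb.mul_comp_bar, e₃, e₄, tau_tau]
    rw [hc]
    noncomm_ring
  -- The resolvent identity for the geometric series 1/(1 - λ) = id and 1/(1 - g): their difference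
  -- is their product with λ - g in between.
  have e₆ : id k H * (lam k H * hat g) - id k H * (g * hat g) = id k H - hat g := by
    have h₁ := id_eq (k := k) (H := H)
    have h₂ := hg.hat_eq
    have h₃ : g * hat g = hat g - 1 := eq_sub_of_add_eq' h₂.symm
    have h₄ : id k H * lam k H = id k H - 1 := eq_sub_of_add_eq' h₁.symm
    rw [← _root_.mul_assoc, h₄, h₃]
    noncomm_ring
  rw [e₂, e₅, ← e₆, ← mul_sub, ← sub_mul, ← r.b_h]
  noncomm_ring

section proj

variable {I : Fam k H' H fun x => x} (hI : IsLetter I) (hs : Homog 0 I)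
  (e : i - h.comp ((higherPart b).comp (hat I)) = I)

theorem extHomotopy_letter {S : Fam k H H' fun x => x} (hS : IsLetter S) :
    IsLetter (S.comp (extHomotopy h (i.comp p))) where
  lam_comp := by rw [← comp_assoc, hS.lam_comp]
  nil x := by
    rw [comp_apply, extHomotopy, mul_nil, mul_nil, r.h_letter.nil]
    simp

include hI hs

/-- The recursive equation for the projection to the minimal model. -/
theorem exists_proj : ∃ P : Fam k H H' fun x => x, IsLetter P ∧ Homog 0 P ∧
    p + ((transfer b p I).comp (hat P) - P.comp (bar (higherPart b))).comp
      (extHomotopy h (i.comp p)) = P := by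
  have hμ := r.transfer_letter hI
  refine exists_fixedPoint (fun P => p + ((transfer b p I).comp (hat P) -
    P.comp (bar (higherPart b))).comp (extHomotopy h (i.comp p))) (fun P hP => ?_)
    (fun n P P' hP hP' hPP' => ?_) 0 (fun P _ hP => ?_)
  · exact r.p_letter.add (r.extHomotopy_letter
      ((hP.comp_hat hμ).sub (r.higherPart_letter.comp_bar hP)))
  -- The extended homotopy does not lengthen words. One letter is gained in each term in front of
  -- it: the transferred operations annihilate letters, and the coderivation of b_{≥2} shortens
  -- words.
  · refine (EqOn.refl _ _).add (r.lowers_extHomotopy.eqOn_comp (n := n + 1) ?_ (by push_cast; omega))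
    refine (hμ.comp_hat_eqOn_succ (r.transfer_lam hI) hP hP' hPP').sub ?_
    exact r.lowers_bar_higherPart.eqOn_comp hPP' (by push_cast; omega)
  · refine r.p_homog.add (((((r.transfer_homog hI hs).comp hP.hat).congr (s' := 1)
      (by norm_num)).sub ?_).comp r.homog_extHomotopy |>.congr (by norm_num))
    exact (hP.comp r.higherPart_homog.bar).congr (by norm_num)

omit hs in
theorem proj_lam {P : Fam k H H' fun x => x}
    (eP : p + ((transfer b p I).comp (hat P) - P.comp (bar (higherPart b))).comp
      (extHomotopy h (i.comp p)) = P) (hP : IsLetter P) : P.comp (lam k H) = p := by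
  have hμ := r.transfer_letter hI
  have h₀ : IsLetter (0 : Fam k H H' fun x => x) := ⟨comp_zero _, fun _ => rfl⟩
  have h₁ : EqOn 1 P 0 := fun x y c hc => by
    cases c with
    | nil => exact hP.nil x
    | cons _ _ => simp only [Chain.length] at hc; omega
  have h₂ : EqOn 2 ((transfer b p I).comp (hat P) - P.comp (bar (higherPart b))) 0 := by
    have h₃ := hμ.comp_hat_eqOn_succ (r.transfer_lam hI) hP h₀ h₁
    have h₄ := r.lowers_bar_higherPart.eqOn_comp (m := 2) h₁ (by norm_num)
    have h₅ : hat (0 : Fam k H H' fun x => x) = 1 := by rw [h₀.hat_eq, zero_mul, add_zero]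
    rw [h₅, comp_one_eq_zero hμ.nil] at h₃
    have h₆ := h₃.sub h₄
    rwa [zero_comp, sub_zero] at h₆
  have h₃ := r.lowers_extHomotopy.eqOn_comp (m := 2) h₂ (by norm_num)
  refine (congrArg (fun J => comp J (lam k H)) eP).symm.trans ?_
  rw [add_comp, r.p_lam, comp_lam_of_eqOn h₃, add_zero]

include e

theorem extHomotopy_comp_hat_incl : (extHomotopy h (i.comp p)).comp (hat I) = 0 := by
  rw [extHomotopy, hI.mul_comp_hat, hI.mul_comp_hat, comp_hat_of_linear r.h_lam hI,
    r.h_comp_incl hI e, zero_mul, mul_zero]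

variable {P : Fam k H H' fun x => x} (hP : IsLetter P) (hPs : Homog 0 P)
  (eP : p + ((transfer b p I).comp (hat P) - P.comp (bar (higherPart b))).comp
      (extHomotopy h (i.comp p)) = P)

include hP eP

/-- The side conditions h i = 0 and h h = 0 give h I = 0, so the extended homotopy vanishes on the
image of `hat I`; hence the correction term of `P` does too, and p I is the projection to letters.
-/
theorem proj_comp_hat_incl : P.comp (hat I) = lam k H' := by
  refine (congrArg (fun J => comp J (hat I)) eP).symm.trans ?_
  rw [add_comp, comp_assoc, r.extHomotopy_comp_hat_incl hI hs e, comp_zero, add_zero,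
    comp_hat_of_linear r.p_lam hI, r.p_comp_incl hI e]

theorem hat_proj_comp_hat_incl : (hat P).comp (hat I) = id k H' := by
  rw [hI.hat_comp_hat hP]
  refine Eq.trans ?_ hat_lam
  exact congrArg hat (r.proj_comp_hat_incl hI hs e hP eP)

theorem proj_sub_comp_hat_incl :
    ((transfer b p I).comp (hat P) - P.comp (bar b)).comp (hat I) = 0 := by
  rw [sub_comp, comp_assoc, r.hat_proj_comp_hat_incl hI hs e hP eP, comp_assoc,
    r.bar_comp_hat_incl hI hs e, ← comp_assoc, r.proj_comp_hat_incl hI hs e hP eP,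
    (r.transfer_letter hI).lam_comp_bar]
  exact sub_self _

/-- Let R be the deviation of `P` from the functor equation and S = b' hat P - P bar b_{≥2}, so that
R = S - P bar d. Since p d = 0, the recursion gives P bar d = S H bar d, and the contraction
identity rewrites H bar d. In the result S may be replaced by R, because P bar d vanishes after `hat
(i p)` and after bar d. -/
theorem proj_sub_eq :
    (transfer b p I).comp (hat P) - P.comp (bar b) =
      ((transfer b p I).comp (hat P) - P.comp (bar b)).comp (hat (i.comp p)) +
      (((transfer b p I).comp (hat P) - P.comp (bar b)).comp (bar (linPart b))).comp
        (extHomotopy h (i.comp p)) := by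
  have hb : P.comp (bar b) = P.comp (bar (linPart b)) + P.comp (bar (higherPart b)) := by
    rw [← comp_add, ← bar_add, higherPart, add_sub_cancel]
  set S := (transfer b p I).comp (hat P) - P.comp (bar (higherPart b)) with hS
  have hR : (transfer b p I).comp (hat P) - P.comp (bar b) = S - P.comp (bar (linPart b)) := by
    rw [hb, hS]
    abel
  have h₁ : P.comp (bar (linPart b)) = S.comp ((extHomotopy h (i.comp p)).comp (bar (linPart b))) := by
    refine (congrArg (fun J => comp J (bar (linPart b))) eP).symm.trans ?_
    rw [add_comp, comp_bar_of_linear r.p_lam r.linPart_letter, r.p_b, zero_add, comp_assoc]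
  have h₂ : (extHomotopy h (i.comp p)).comp (bar (linPart b)) = id k H - hat (i.comp p) -
      (bar (linPart b)).comp (extHomotopy h (i.comp p)) := by
    rw [← r.bar_linPart_extHomotopy, add_sub_cancel_left]
  have h₃ : (S - P.comp (bar (linPart b))).comp (hat (i.comp p)) = S.comp (hat (i.comp p)) := by
    rw [sub_comp, comp_assoc, r.bar_linPart_comp_hat, comp_zero, sub_zero]
  have h₄ : (S - P.comp (bar (linPart b))).comp (bar (linPart b)) = S.comp (bar (linPart b)) := by
    rw [sub_comp, comp_assoc, r.bar_linPart_comp_bar_linPart, comp_zero, sub_zero]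
  rw [hR, h₃, h₄]
  conv_lhs => rw [h₁, h₂, comp_sub, comp_sub, comp_id, ← comp_assoc]
  abel

include hPs

/-- Induction on the length by means of `proj_sub_eq`. For the last term, R bar d = R bar b - R bar
b_{≥2}: the second part evaluates R on shorter words, and the first is -b' applied to the deviation
of `hat P`, which is a letter on the words in question and is annihilated by b'. The term with `hat
(i p)` is compared with the image of `hat I`, on which R vanishes. -/
theorem comp_hat_proj : (transfer b p I).comp (hat P) = P.comp (bar b) := by
  have hμ := r.transfer_letter hI
  refine sub_eq_zero.1 (eq_of_eqOn_succ fun n hn => ?_)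
  have hlin := r.proj_sub_comp_hat_incl hI hs e hP eP
  have h₀ := r.proj_sub_eq hI hs e hP eP
  have h₁ := r.b_letter.bar_comp_hat_eqOn hμ hP hPs.tau_comp_zero hn
  set R := (transfer b p I).comp (hat P) - P.comp (bar b) with hR
  have hRl : IsLetter R := (hP.comp_hat hμ).sub (r.b_letter.comp_bar hP)
  have h₂ : R.comp (bar b) = -(transfer b p I).comp
      ((bar (transfer b p I)).comp (hat P) - (hat P).comp (bar b)) := by
    rw [hR, sub_comp, comp_assoc, comp_assoc, r.b_letter.bar_comp_bar_eq_zero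
      r.b_homog.tau_comp_one r.b_bar, comp_zero, comp_sub, ← comp_assoc _ (bar (transfer b p I)),
      r.transfer_comp_bar hI hs e, zero_comp, sub_zero, zero_sub, neg_neg]
  have h₃ : EqOn (n + 1) (R.comp (bar b)) 0 := by
    rw [h₂]
    have h₄ := (h₁.comp_left (transfer b p I)).neg
    rwa [hRl.comp_eq_zero (r.transfer_lam hI), neg_zero] at h₄
  have h₄ : EqOn (n + 1) (R.comp (bar (higherPart b))) 0 := by
    have := r.lowers_bar_higherPart.eqOn_comp (m := n + 1) hn (by push_cast; omega)
    rwa [zero_comp] at this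
  have h₅ : EqOn (n + 1) (R.comp (bar (linPart b))) 0 := by
    have h₆ : R.comp (bar (linPart b)) = R.comp (bar b) - R.comp (bar (higherPart b)) := by
      rw [← comp_sub, eq_sub_of_add_eq (bar_add (linPart b) (higherPart b)).symm, higherPart,
        add_sub_cancel]
    rw [h₆]
    have := h₃.sub h₄
    rwa [sub_zero] at this
  have h₆ := r.lowers_extHomotopy.eqOn_comp (m := n + 1) h₅ (by push_cast; omega)
  rw [zero_comp] at h₆
  have h₇ : EqOn (n + 1) (R.comp (hat (i.comp p))) 0 := by
    have hIp := r.p_letter.comp_hat hI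
    -- The families `I ∘ hat p` and `i ∘ p` have the same linear part, so their extensions to words
    -- differ by terms that lose a letter. The extension of the former is `hat I ∘ hat p`, on which
    -- R vanishes.
    have h₈ : Lowers 1 (I.comp (hat p) - i.comp p) := by
      refine Lowers.of_letter_of_eqOn (hIp.sub r.i_p_letter) ?_
      refine eqOn_of_comp_lam (hIp.sub r.i_p_letter).nil ?_
      rw [sub_comp, comp_assoc, r.p_letter.hat_comp_lam, comp_assoc, r.p_lam, ← r.incl_lam hI e,
        comp_assoc, r.p_letter.lam_comp]
      exact sub_self _
    have h₉ := (Lowers.hat_sub_hat hIp r.i_p_letter h₈).eqOn_comp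
      (m := n + 1) hn (by push_cast; omega)
    have h₁₀ : R.comp (hat (I.comp (hat p))) = 0 := by
      have : hat (I.comp (hat p)) = (hat I).comp (hat p) := (r.p_letter.hat_comp_hat hI).symm
      rw [this, ← comp_assoc, hlin, zero_comp]
    rw [zero_comp, comp_sub, h₁₀, zero_sub] at h₉
    have := h₉.neg
    rwa [neg_neg, neg_zero] at this
  have h₁₁ := h₇.add h₆
  rw [zero_add] at h₁₁
  rw [h₀]
  exact h₁₁

end proj

end Retraction

end Fam

/-! ### Strict units in products of families and in coderivations -/

namespace Chain

variable {O : Type u} {H : O → O → ℤ → Type v} {W : Type u'} [AddCommGroup W]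

theorem cutSum_neg {x z : O} (Φ : ∀ y, Chain H y z → Chain H x y → W) (c : Chain H x z) :
    cutSum (fun y a b => -Φ y a b) c = -cutSum Φ c :=
  (map_cutSum (negAddMonoidHom : W →+ W) Φ c).symm

theorem cutSum_sub {x z : O} (Φ Ψ : ∀ y, Chain H y z → Chain H x y → W) (c : Chain H x z) :
    cutSum (fun y a b => Φ y a b - Ψ y a b) c = cutSum Φ c - cutSum Ψ c := by
  simp only [sub_eq_add_neg, cutSum_add, cutSum_neg]

end Chain

namespace Fam

variable {k : Type w₁} [Field k] {O : Type u}
  {H : O → O → ℤ → Type v} [∀ x y p, AddCommGroup (H x y p)] [∀ x y p, Module k (H x y p)]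
  {H' : O → O → ℤ → Type v'} [∀ x y p, AddCommGroup (H' x y p)] [∀ x y p, Module k (H' x y p)]

open Word

theorem mul_apply_mul (f g : Fam k H H fun x => x) {x y z : O} (a : Chain H y z)
    (w : Word k H x y) : Word.mul ((f * g) y z (of k a)) w =
      Chain.cutSum (fun t a' a'' => Word.mul (f t z (of k a'))
        (Word.mul (g y t (of k a'')) w)) a := by
  rw [mul_of, ← LinearMap.flip_apply, Chain.map_cutSum]
  simp only [LinearMap.flip_apply, Word.mul_assoc]

theorem mul_mul_apply (f g : Fam k H H fun x => x) {x y z : O} (w : Word k H y z)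
    (d : Chain H x y) : Word.mul w ((f * g) x y (of k d)) =
      Chain.cutSum (fun t d' d'' => Word.mul (Word.mul w (f t y (of k d')))
        (g x t (of k d''))) d := by
  rw [mul_of, Chain.map_cutSum]
  simp only [Word.mul_assoc]

@[simp]
theorem lam_apply_letter {x y : O} {q : ℤ} (f : H x y q) :
    lam k H x y (letter x y q f) = letter x y q f := lam_letter f

theorem congr_apply {f g : Fam k H H' fun x => x} (h : f = g) {x y : O} (w : Word k H x y) :
    f x y w = g x y w := by rw [h]

section

variable {e : ∀ x, H x x 0} {e' : ∀ x, H' x x 0}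

theorem unitalHomAt_iff_of_ne {F : Fam k H H' fun x => x} {x y z : O} (a : Chain H y z)
    (d : Chain H x y) (h : a.length + d.length ≠ 0) :
    UnitalHomAt e e' F (of k a) (of k d) ↔ F x z (of k (a.append (.cons (e y) d))) = 0 := by
  rw [UnitalHomAt, mul_letter_of]
  rcases a with _ | ⟨f, a⟩
  · rcases d with _ | ⟨g, d⟩
    · simp [Chain.length] at h
    · simp
  · simp

theorem unitalHomAt_nil_iff {F : Fam k H H' fun x => x} (x : O) :
    UnitalHomAt e e' F (of k (.nil : Chain H x x)) (of k .nil) ↔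
      F x x (letter x x 0 (e x)) = letter x x 0 (e' x) := by
  rw [UnitalHomAt]
  simp only [one_nil, Word.nil_mul, Word.mul_nil]

theorem unitalHomAt_of_linear {F : Fam k H H' fun x => x} (hF : F.comp (lam k H) = F)
    (h : ∀ x, F x x (letter x x 0 (e x)) = letter x x 0 (e' x)) {x y z : O} (a : Word k H y z)
    (d : Word k H x y) : UnitalHomAt e e' F a d := by
  refine unitalHomAt_of (fun a d => ?_) a d
  by_cases hl : a.length + d.length = 0
  · rcases a with _ | ⟨f, a⟩
    · rcases d with _ | ⟨g, d⟩
      · exact (unitalHomAt_nil_iff _).2 (h _)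
      · simp [Chain.length] at hl
    · simp only [Chain.length] at hl
      omega
  · rw [unitalHomAt_iff_of_ne a d hl, ← hF, comp_apply, lam_of, if_neg, map_zero]
    rw [Chain.length_append]
    simp only [Chain.length]
    omega

theorem linear_unital {h : Fam k H H' fun x => x} (hl : h.comp (lam k H) = h)
    (he : ∀ x, h x x (letter x x 0 (e x)) = 0) {x y z : O} (a : Chain H y z) (d : Chain H x y) :
    h x z (of k (a.append (.cons (e y) d))) = 0 := by
  rcases a with _ | ⟨f, a⟩
  · rcases d with _ | ⟨g, d⟩
    · exact he _
    · rw [← hl, comp_apply, lam_of, if_neg, map_zero]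
      simp [Chain.append, Chain.length]
  · rw [← hl, comp_apply, lam_of, if_neg, map_zero]
    rw [Chain.length_append]
    simp only [Chain.length]
    omega

theorem tau_unit {x y z : O} (a : Word k H y z) (d : Word k H x y) :
    tau k H x z (Word.mul a (Word.mul (letter y y 0 (e y)) d)) =
      -Word.mul (tau k H y z a) (Word.mul (letter y y 0 (e y)) (tau k H x y d)) := by
  have h : tau k H y y (letter y y 0 (e y)) = -letter y y 0 (e y) := by
    refine (tau_of (Chain.cons (e y) .nil)).trans ?_
    simp only [Chain.deg, Chain.length]
    rw [show sgn k (0 + 0 - ((0 + 1 : ℕ) : ℤ)) = -1 by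
      rw [sgn_congr (n := 1) ⟨-1, by norm_num⟩, sgn_one], neg_one_smul]
    rfl
  rw [tau_mul_apply, tau_mul_apply, h, map_neg, LinearMap.neg_apply, map_neg]

/-- The unit lies in the subword on which `G`, `tau` or `θ` acts; these cases give the three terms
in this order. The minus sign arises because `e` has odd degree in the suspension, so that τ(e) =
-e. -/
theorem tau_mul_mul_unit {θ G : Fam k H H fun x => x}
    (hG : ∀ {x y z : O} (a : Chain H y z) (d : Chain H x y),
      G x z (of k (a.append (.cons (e y) d))) =
        Word.mul (G y z (of k a)) (Word.mul (letter y y 0 (e y)) (G x y (of k d))))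
    {x y z : O} (a : Chain H y z) (d : Chain H x y) :
    (tau k H * (θ * G)) x z (of k (a.append (.cons (e y) d))) =
      Word.mul ((tau k H * (θ * G)) y z (of k a)) (Word.mul (letter y y 0 (e y)) (G x y (of k d))) -
        Word.mul (tau k H y z (of k a)) (Word.mul (letter y y 0 (e y))
          ((tau k H * (θ * G)) x y (of k d))) +
      Chain.cutSum (fun t a' a'' => Word.mul (tau k H t z (of k a'))
        (Chain.cutSum (fun s d' d'' => Word.mul (θ s t (of k (a''.append (.cons (e y) d'))))
          (G x s (of k d''))) d)) a := by
  have h₁ {t : O} (a : Chain H y t) : (θ * G) x t (of k (a.append (.cons (e y) d))) =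
      Word.mul ((θ * G) y t (of k a)) (Word.mul (letter y y 0 (e y)) (G x y (of k d))) +
        Chain.cutSum (fun s d' d'' => Word.mul (θ s t (of k (a.append (.cons (e y) d'))))
          (G x s (of k d''))) d := by
    rw [mul_of, Chain.cutSum_append_cons]
    refine congrArg (· + _) ?_
    rw [mul_apply_mul]
    exact Chain.cutSum_congr a fun t a' a'' _ => by rw [hG]
  rw [mul_of, Chain.cutSum_append_cons]
  simp only [h₁, map_add]
  rw [Chain.cutSum_add]
  have h₂ : Chain.cutSum (fun t a' a'' => Word.mul (tau k H t z (of k a'))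
      (Word.mul ((θ * G) y t (of k a'')) (Word.mul (letter y y 0 (e y)) (G x y (of k d))))) a =
      Word.mul ((tau k H * (θ * G)) y z (of k a))
        (Word.mul (letter y y 0 (e y)) (G x y (of k d))) := by
    rw [mul_apply_mul]
  have h₃ : Chain.cutSum (fun t d' d'' => Word.mul (tau k H t z (of k (a.append (.cons (e y) d'))))
      ((θ * G) x t (of k d''))) d = -Word.mul (tau k H y z (of k a))
        (Word.mul (letter y y 0 (e y)) ((tau k H * (θ * G)) x y (of k d))) := by
    rw [← Word.mul_assoc, mul_mul_apply, ← Chain.cutSum_neg]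
    refine Chain.cutSum_congr d fun t d' d'' _ => ?_
    rw [← mul_letter_of, tau_unit, map_neg, LinearMap.neg_apply]
    simp only [Word.mul_assoc]
  rw [h₂, h₃]
  abel

/-- The coderivation defined by strictly unital operations. -/
theorem bar_unit {b : Fam k H H fun x => x}
    (hb : ∀ {x y z : O} (a : Word k H y z) (d : Word k H x y), UnitalAt e b a d)
    {x y z : O} (a : Chain H y z) (d : Chain H x y) :
    bar b x z (of k (a.append (.cons (e y) d))) =
      Word.mul (bar b y z (of k a)) (Word.mul (letter y y 0 (e y)) (of k d)) -
        Word.mul (tau k H y z (of k a)) (Word.mul (letter y y 0 (e y)) (bar b x y (of k d))) +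
      (Word.mul ((1 : Fam k H H fun x => x) y z (of k a)) (of k d) -
        Word.mul (tau k H y z (of k a)) ((1 : Fam k H H fun x => x) x y (of k d))) := by
  refine (tau_mul_mul_unit (θ := b) (G := id k H) (fun a d => (mul_letter_of _ a d).symm)
    a d).trans ?_
  refine congrArg₂ (· + ·) rfl ?_
  have h₁ {t : O} (a : Chain H y t) :
      Chain.cutSum (fun s d' d'' => Word.mul (b s t (of k (a.append (.cons (e y) d'))))
        (id k H x s (of k d''))) d =
      Word.mul ((1 : Fam k H H fun x => x) y t (of k a)) ((lam k H * id k H) x y (of k d)) -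
        Word.mul (((lam k H).comp (tau k H)) y t (of k a)) (of k d) := by
    have h₂ : Word.mul (((lam k H).comp (tau k H)) y t (of k a)) (of k d) =
        Word.mul (((lam k H).comp (tau k H)) y t (of k a))
          (((1 : Fam k H H fun x => x) * id k H) x y (of k d)) := by rw [one_mul]; rfl
    rw [h₂, mul_mul_apply, mul_mul_apply, ← Chain.cutSum_sub]
    refine Chain.cutSum_congr d fun t d' d'' _ => ?_
    have h₃ := hb (of k a) (of k d')
    rw [UnitalAt, mul_letter_of] at h₃
    rw [h₃, map_sub, LinearMap.sub_apply]
    rfl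
  simp only [h₁, map_sub]
  have h₂ : (lam k H * id k H) x y (of k d) = of k d - (1 : Fam k H H fun x => x) x y (of k d) := by
    have := isLetter_lam.hat_eq (k := k) (H := H)
    rw [hat_lam] at this
    exact congr_apply (eq_sub_of_add_eq' this.symm) _
  have h₃ : (tau k H * (lam k H).comp (tau k H)) y z (of k a) =
      tau k H y z (of k a) - (1 : Fam k H H fun x => x) y z (of k a) := by
    have := isLetter_lam_tau.hat_eq' (k := k) (H := H)
    rw [hat_lam_tau] at this
    exact congr_apply (eq_sub_of_add_eq' this.symm) _
  have h₄ : Chain.cutSum (fun t a' a'' => Word.mul (tau k H t z (of k a'))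
      (Word.mul ((1 : Fam k H H fun x => x) y t (of k a'')) ((lam k H * id k H) x y (of k d))) -
      Word.mul (tau k H t z (of k a')) (Word.mul (((lam k H).comp (tau k H)) y t (of k a''))
        (of k d))) a =
      Word.mul ((tau k H * 1) y z (of k a)) ((lam k H * id k H) x y (of k d)) -
        Word.mul ((tau k H * (lam k H).comp (tau k H)) y z (of k a)) (of k d) := by
    rw [Chain.cutSum_sub, mul_apply_mul, mul_apply_mul]
  rw [h₄, h₂, h₃, mul_one]
  simp only [map_sub, LinearMap.sub_apply]
  abel

end

/-- The passage from words to linear combinations of words of bounded length. It lets an induction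
on length be applied to values of families that do not lengthen words. -/
theorem unital_fil {M : Type*} [AddCommGroup M] [Module k M] {e : ∀ x, H x x 0} {x y z : O}
    {m n : ℤ} (S : Word k H x z →ₗ[k] M)
    (hS : ∀ (a : Chain H y z) (d : Chain H x y), (a.length : ℤ) ≤ m → (d.length : ℤ) ≤ n →
      S (of k (a.append (.cons (e y) d))) = 0) {a : Word k H y z} {d : Word k H x y}
    (ha : a ∈ fil k H m y z) (hd : d ∈ fil k H n x y) :
    S (Word.mul a (Word.mul (letter y y 0 (e y)) d)) = 0 := by
  refine fil_le (S := LinearMap.ker (S ∘ₗ Word.mul.flip (Word.mul (letter y y 0 (e y)) d)))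
    (fun c hc => ?_) ha
  refine fil_le (S := LinearMap.ker (S ∘ₗ Word.mul (of k c) ∘ₗ Word.mul (letter y y 0 (e y))))
    (fun c' hc' => ?_) hd
  rw [LinearMap.mem_ker, LinearMap.comp_apply, LinearMap.comp_apply, mul_letter_of]
  exact hS c c' hc hc'

theorem unitalHomAt_fil {e : ∀ x, H x x 0} {e' : ∀ x, H' x x 0} {F : Fam k H H' fun x => x}
    {x y z : O} {m n : ℤ}
    (hS : ∀ (a : Chain H y z) (d : Chain H x y), (a.length : ℤ) ≤ m → (d.length : ℤ) ≤ n →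
      UnitalHomAt e e' F (of k a) (of k d)) {a : Word k H y z} {d : Word k H x y}
    (ha : a ∈ fil k H m y z) (hd : d ∈ fil k H n x y) : UnitalHomAt e e' F a d := by
  refine fil_le (S := LinearMap.eqLocus
    (F x z ∘ₗ Word.mul.flip (Word.mul (letter y y 0 (e y)) d))
    (Word.mul.flip (Word.mul (letter y y 0 (e' y)) ((1 : Fam k H H' fun x => x) x y d)) ∘ₗ
      (1 : Fam k H H' fun x => x) y z)) (fun c hc => ?_) ha
  refine fil_le (S := LinearMap.eqLocus
    (F x z ∘ₗ Word.mul (of k c) ∘ₗ Word.mul (letter y y 0 (e y)))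
    (Word.mul ((1 : Fam k H H' fun x => x) y z (of k c)) ∘ₗ
      Word.mul (letter y y 0 (e' y)) ∘ₗ (1 : Fam k H H' fun x => x) x y))
    (fun c' hc' => ?_) hd
  exact hS c c' hc hc'

end Fam

/-! ### Strict unitality of the transferred structure -/

namespace Fam.Retraction

open Word

variable {k : Type w₁} [Field k] {O : Type u}
  {H : O → O → ℤ → Type v} [∀ x y p, AddCommGroup (H x y p)] [∀ x y p, Module k (H x y p)]
  {H' : O → O → ℤ → Type v'} [∀ x y p, AddCommGroup (H' x y p)] [∀ x y p, Module k (H' x y p)]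
  {b : Fam k H H fun x => x} {i : Fam k H' H fun x => x} {p : Fam k H H' fun x => x}
  {h : Fam k H H fun x => x} (r : Retraction b i p h)
  {u : ∀ x, H x x 0} {u' : ∀ x, H' x x 0}
  (hb : ∀ {x y z : O} (a : Word k H y z) (d : Word k H x y), UnitalAt u b a d)
  (hi : ∀ x, i x x (letter x x 0 (u' x)) = letter x x 0 (u x))
  (hp : ∀ x, p x x (letter x x 0 (u x)) = letter x x 0 (u' x))
  (hh : ∀ x, h x x (letter x x 0 (u x)) = 0)

include r

include hb in
-- The unit axioms involve only the binary operation, and the unary one vanishes on units; so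
-- nothing changes when the linear part is removed.
theorem higherPart_unital {x y z : O} (a : Word k H y z) (d : Word k H x y) :
    UnitalAt u (higherPart b) a d := by
  refine unitalAt_of (fun a d => ?_) a d
  have h₁ : linPart b x z (of k (a.append (.cons (u y) d))) = 0 := by
    refine linear_unital (linPart_comp_lam b) (fun x => ?_) a d
    have h₂ := hb (of k (.nil : Chain H x x)) (of k .nil)
    rw [UnitalAt] at h₂
    simp only [one_nil, Word.nil_mul, Word.mul_nil] at h₂
    rw [linPart, comp_apply, lam_apply_letter, h₂, lam_of, tau_of, map_smul, lam_of]
    simp [Chain.length]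
  have h₂ := hb (of k a) (of k d)
  rw [UnitalAt, mul_letter_of] at h₂ ⊢
  rw [higherPart, sub_apply, h₁, sub_zero, h₂]

variable {I : Fam k H' H fun x => x} (hI : IsLetter I) (hs : Homog 0 I)
  (e : i - h.comp ((higherPart b).comp (hat I)) = I)

include hb in
/-- The operations of arity at least two, applied to `F ⊗ ⋯ ⊗ e ⊗ ⋯ ⊗ F`. -/
theorem higherPart_mul_letter {O₁ : Type*} {H₁ : O₁ → O₁ → ℤ → Type*}
    [∀ x y p, AddCommGroup (H₁ x y p)] [∀ x y p, Module k (H₁ x y p)] {o : O₁ → O}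
    {F : Fam k H₁ H o} (hF : IsLetter F) {x y z : O₁} (a : Chain H₁ y z) (d : Chain H₁ x y) :
    higherPart b _ _ (Word.mul (hat F y z (of k a)) (Word.mul (letter _ _ 0 (u (o y)))
      (hat F x y (of k d)))) =
      Word.mul ((1 : Fam k H₁ H o) y z (of k a)) (F x y (of k d)) -
        Word.mul (tau k H _ _ (F y z (of k a))) ((1 : Fam k H₁ H o) x y (of k d)) := by
  rw [r.higherPart_unital hb]
  have h₁ {x y : O₁} (c : Chain H₁ x y) : (1 : Fam k H H fun x => x) _ _ (hat F _ _ (of k c)) =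
      (1 : Fam k H₁ H o) _ _ (of k c) :=
    congrFun (congrArg DFunLike.coe (congrFun (congrFun
      (hF.one_comp_hat (H'' := H) (o' := fun x => x)) x) y)) (of k c)
  have h₂ {x y : O₁} (c : Chain H₁ x y) : lam k H _ _ (hat F _ _ (of k c)) = F _ _ (of k c) :=
    congrFun (congrArg DFunLike.coe (congrFun (congrFun hF.lam_comp_hat x) y)) (of k c)
  have h₃ {x y : O} (w : Word k H x y) : lam k H _ _ (tau k H x y w) = tau k H x y (lam k H _ _ w) :=
    (congr_apply (tau_lam (k := k) (H := H)) w).symm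
  rw [h₁, h₁, h₃, h₂, h₂]

include hb hi hI e

/-- Induction on the length. On a longer word with a unit only -h b_{≥2} hat I can contribute. By
`hat_unit_aux` the argument of b_{≥2} is `hat I(a) ⊗ e ⊗ hat I(d)` plus a letter, which is
annihilated. The first term gives, up to sign, values of `I` on `a` or on `d`, and these are killed
by h I = 0. -/
theorem incl_unital_of_lt (n : ℕ) : ∀ {x y z : O} (a : Chain H' y z) (d : Chain H' x y),
    a.length + d.length + 1 < n → UnitalHomAt u' u I (of k a) (of k d) := by
  induction n with
  | zero => exact fun _ _ hn => absurd hn (Nat.not_lt_zero _)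
  | succ n ih =>
    intro x y z a d hn
    by_cases hl : a.length + d.length = 0
    · rcases a with _ | ⟨f, a⟩
      · rcases d with _ | ⟨g, d⟩
        · refine (unitalHomAt_nil_iff _).2 ?_
          rw [← hi]
          have := congr_apply (r.incl_lam hI e) (letter x x 0 (u' x))
          rwa [comp_apply, lam_apply_letter] at this
        · simp [Chain.length] at hl
      · simp only [Chain.length] at hl
        omega
    · have h₁ := hI.hat_unit_aux ih a d hn
      have h₂ : Word.mul ((1 : Fam k H' H fun x => x) y z (of k a))
          (Word.mul (letter _ _ 0 (u y)) ((1 : Fam k H' H fun x => x) x y (of k d))) = 0 := by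
        rcases a with _ | ⟨f, a⟩
        · rcases d with _ | ⟨g, d⟩
          · simp [Chain.length] at hl
          · simp
        · simp
      rw [h₂, sub_zero] at h₁
      rw [unitalHomAt_iff_of_ne a d hl]
      have h₃ : i x z (of k (a.append (.cons (u' y) d))) = 0 :=
        (unitalHomAt_iff_of_ne a d hl).1 (unitalHomAt_of_linear r.i_lam hi _ _)
      have h₄ : higherPart b x z (I x z (of k (a.append (.cons (u' y) d)))) = 0 :=
        congr_apply (hI.comp_eq_zero r.higherPart_lam) _
      refine (congr_apply e.symm _).trans ?_
      have h₅ (c : Chain H' x y) : h x y (I x y (of k c)) = 0 := congr_apply (r.h_comp_incl hI e) _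
      have h₆ (c : Chain H' y z) : h y z (tau k H y z (I y z (of k c))) = 0 := by
        have := congr_apply r.h_homog.tau_comp_neg_one (I y z (of k c))
        rw [comp_apply, neg_apply, comp_apply] at this
        rw [← neg_eq_zero, ← this, congr_apply (r.h_comp_incl hI e) (of k c) |> fun t => (t :
          h y z (I y z (of k c)) = 0), map_zero]
      rw [sub_apply, h₃, comp_apply, comp_apply, h₁, map_add, h₄, add_zero,
        r.higherPart_mul_letter hb hI, map_sub, zero_sub, neg_eq_zero, sub_eq_zero]
      rcases a with _ | ⟨f, a⟩
      · rw [one_nil, Word.nil_mul, hI.nil, map_zero, map_zero, LinearMap.zero_apply, map_zero]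
        exact h₅ _
      · rw [one_cons, map_zero, LinearMap.zero_apply, map_zero]
        rcases d with _ | ⟨g, d⟩
        · rw [one_nil, Word.mul_nil]
          exact (h₆ _).symm
        · simp

theorem incl_unital {x y z : O} (a : Word k H' y z) (d : Word k H' x y) :
    UnitalHomAt u' u I a d :=
  unitalHomAt_of (fun a d => r.incl_unital_of_lt hb hi hI e _ a d (Nat.lt_succ_self _)) a d

/-- Here b_{≥2} passes from `e ⊗ I(d)` to `I(d)`, and p I is the projection to letters. -/
theorem transfer_unital {x y z : O} (a : Word k H' y z) (d : Word k H' x y) :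
    UnitalAt u' (transfer b p I) a d := by
  refine unitalAt_of (fun a d => ?_) a d
  have h₁ (x y : O) (c : Chain H' x y) : p x y (I x y (of k c)) = lam k H' x y (of k c) :=
    congr_apply (r.p_comp_incl hI e) _
  have h₂ (x y : O) (c : Chain H' x y) : p x y (tau k H x y (I x y (of k c))) =
      lam k H' x y (tau k H' x y (of k c)) := by
    refine (congr_apply r.p_homog.tau_comp_zero (I x y (of k c))).symm.trans ?_
    rw [comp_apply, h₁]
    exact congr_apply tau_lam (of k c)
  rw [UnitalAt, mul_letter_of, transfer, comp_apply, comp_apply,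
    hI.hat_unit (r.incl_unital hb hi hI e), r.higherPart_mul_letter hb hI, map_sub]
  congr 1
  · rcases a with _ | ⟨f, a⟩
    · rw [one_nil, one_nil, Word.nil_mul, Word.nil_mul, h₁]
    · simp
  · rcases d with _ | ⟨g, d⟩
    · rw [one_nil, one_nil, Word.mul_nil, Word.mul_nil, h₂]
    · simp

include hp hh hs

variable {P : Fam k H H' fun x => x} (hP : IsLetter P) (hPs : Homog 0 P)
  (eP : p + ((transfer b p I).comp (hat P) - P.comp (bar (higherPart b))).comp
      (extHomotopy h (i.comp p)) = P)

include hP hPs in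
-- Both terms of the difference take the value 1(a) P(d) - τP(a) 1(d) on `a ⊗ e ⊗ d`. For the second
-- one, the terms in which the coderivation acts on `a` or on `d` alone leave a shorter word
-- containing a unit; there `P` is strictly unital by induction, and its prescribed value is zero
-- because a value of the coderivation has no empty component.
theorem proj_aux_unital {n : ℕ} (ih : ∀ {x y z : O} (a : Chain H y z) (d : Chain H x y),
    a.length + d.length + 1 < n → UnitalHomAt u u' P (of k a) (of k d)) {x y z : O}
    (a : Chain H y z) (d : Chain H x y) (hn : a.length + d.length + 1 < n + 1) :
    ((transfer b p I).comp (hat P) - P.comp (bar (higherPart b))) x z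
      (of k (a.append (.cons (u y) d))) = 0 := by
  have hμ := r.transfer_letter hI
  have h₁ := hP.hat_unit_aux ih a d hn
  have h₂ : transfer b p I x z (P x z (of k (a.append (.cons (u y) d)))) = 0 :=
    congr_apply (hP.comp_eq_zero (r.transfer_lam hI)) _
  have h₃ : transfer b p I x z (Word.mul ((1 : Fam k H H' fun x => x) y z (of k a))
      (Word.mul (letter _ _ 0 (u' y)) ((1 : Fam k H H' fun x => x) x y (of k d)))) = 0 := by
    rcases a with _ | ⟨f, a⟩
    · rcases d with _ | ⟨g, d⟩
      · rw [one_nil, Word.nil_mul]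
        have := congr_apply (r.transfer_lam hI) (letter x x 0 (u' x))
        rw [comp_apply, lam_apply_letter] at this
        exact (congrArg _ (Word.mul_nil _)).trans this
      · simp
    · simp
  have h₄ {x y : O} (c : Chain H x y) : (1 : Fam k H' H' fun x => x) _ _ (hat P _ _ (of k c)) =
      (1 : Fam k H H' fun x => x) _ _ (of k c) :=
    congr_apply (hP.one_comp_hat (o' := fun x => x)) _
  have h₅ {x y : O} (c : Chain H x y) : lam k H' _ _ (hat P _ _ (of k c)) = P _ _ (of k c) :=
    congr_apply hP.lam_comp_hat _
  have h₆ {x y : O} (w : Word k H' x y) :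
      lam k H' _ _ (tau k H' x y w) = tau k H' x y (lam k H' _ _ w) :=
    (congr_apply (tau_lam (k := k) (H := H')) w).symm
  have h₇ := r.transfer_unital hb hi hI e (hat P y z (of k a)) (hat P x y (of k d))
  rw [UnitalAt, h₄, h₄, h₆, h₅, h₅] at h₇
  have hone {x y : O} (c : Chain H x y) : (1 : Fam k H H' fun x => x) x y
      (bar (higherPart b) x y (of k c)) = 0 :=
    congr_apply (r.higherPart_letter.one_comp_bar (H' := H') (o := fun x => x)) _
  have h₈ : P x z (Word.mul (bar (higherPart b) y z (of k a))
      (Word.mul (letter y y 0 (u y)) (of k d))) = 0 := by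
    have := unitalHomAt_fil (e := u) (e' := u') (F := P) (m := a.length - 1) (n := d.length)
      (fun a' d' h h' => ih a' d' (by omega)) (r.lowers_bar_higherPart y z a)
      (of_mem_fil d le_rfl)
    rw [UnitalHomAt, hone] at this
    rw [this]
    simp
  have h₉ : P x z (Word.mul (tau k H y z (of k a))
      (Word.mul (letter y y 0 (u y)) (bar (higherPart b) x y (of k d)))) = 0 := by
    have := unitalHomAt_fil (e := u) (e' := u') (F := P) (m := a.length - 0) (n := d.length - 1)
      (fun a' d' h h' => ih a' d' (by omega)) (Lowers.tau y z a)
      (r.lowers_bar_higherPart x y d)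
    rw [UnitalHomAt, hone] at this
    rw [this]
    simp
  rw [sub_apply, comp_apply, comp_apply, h₁, map_add, map_sub, h₂, h₃, sub_zero, add_zero, h₇,
    bar_unit (r.higherPart_unital hb), map_add, map_sub, map_sub, h₈, h₉, sub_zero, zero_add,
    sub_eq_zero]
  congr 1
  · rcases a with _ | ⟨f, a⟩
    · rw [one_nil, one_nil, Word.nil_mul, Word.nil_mul]
    · simp
  · rcases d with _ | ⟨g, d⟩
    · rw [one_nil, one_nil, Word.mul_nil, Word.mul_nil]
      exact congr_apply hPs.tau_comp_zero (of k a)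
    · simp

include hP hPs eP

/-- As h is linear and h(e) = 0, the extended homotopy sends `a ⊗ e ⊗ d` to words in which `e` is
still a letter, namely to H(a) ⊗ e ⊗ hat(ip)(d) - τ(a) ⊗ e ⊗ H(d). These are no longer than the
given word, so `proj_aux_unital` shows that the correction to p vanishes. -/
theorem proj_unital_of_lt (n : ℕ) : ∀ {x y z : O} (a : Chain H y z) (d : Chain H x y),
    a.length + d.length + 1 < n → UnitalHomAt u u' P (of k a) (of k d) := by
  induction n with
  | zero => exact fun _ _ hn => absurd hn (Nat.not_lt_zero _)
  | succ n ih =>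
    intro x y z a d hn
    have h₁ := fun (a' : Chain H y z) (d' : Chain H x y) (ha : (a'.length : ℤ) ≤ a.length - 0)
      (hd : (d'.length : ℤ) ≤ d.length - 0) =>
      r.proj_aux_unital hb hi hp hh hI hs e hP hPs ih a' d' (by omega)
    have hg {x y z : O} (a : Word k H y z) (d : Word k H x y) : UnitalHomAt u u (i.comp p) a d :=
      unitalHomAt_of_linear (by rw [comp_assoc, r.p_lam])
        (fun x => by rw [comp_apply, hp, hi]) a d
    have h₂ : extHomotopy h (i.comp p) x z (of k (a.append (.cons (u y) d))) =
        Word.mul (extHomotopy h (i.comp p) y z (of k a))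
          (Word.mul (letter y y 0 (u y)) (hat (i.comp p) x y (of k d))) -
        Word.mul (tau k H y z (of k a)) (Word.mul (letter y y 0 (u y))
          (extHomotopy h (i.comp p) x y (of k d))) := by
      refine (tau_mul_mul_unit (e := u) (r.i_p_letter.hat_unit hg) a d).trans ?_
      refine (congrArg (_ + ·) ?_).trans (add_zero _)
      simp only [linear_unital r.h_lam hh, map_zero, LinearMap.zero_apply, Chain.cutSum_zero]
    have h₃ : P x z (of k (a.append (.cons (u y) d))) = p x z (of k (a.append (.cons (u y) d))) := by
      refine (congr_apply eP.symm _).trans ?_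
      rw [add_apply, comp_apply, h₂, map_sub]
      have h₄ := unital_fil _ h₁ (r.lowers_extHomotopy y z a) (Lowers.hat r.i_p_letter x y d)
      have h₅ := unital_fil _ h₁ (Lowers.tau y z a) (r.lowers_extHomotopy x y d)
      rw [h₄, h₅, sub_zero, add_zero]
    have h₄ := unitalHomAt_of_linear r.p_lam hp (of k a) (of k d)
    rw [UnitalHomAt, mul_letter_of] at h₄ ⊢
    rw [h₃, h₄]

theorem proj_unital {x y z : O} (a : Word k H y z) (d : Word k H x y) :
    UnitalHomAt u u' P a d :=
  unitalHomAt_of (fun a d =>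
    r.proj_unital_of_lt hb hi hp hh hI hs e hP hPs eP _ a d (Nat.lt_succ_self _)) a d

end Fam.Retraction

/-! ### Contractions of complexes of vector spaces -/

/-- A section of `d` over its range extends to all of `W`, and a vector outside the range may be
sent to zero by the extension. Nonexactness of the units is needed at this point. -/
theorem LinearMap.exists_pseudoinverse {k : Type*} [Field k] {V W : Type*} [AddCommGroup V]
    [Module k V] [AddCommGroup W] [Module k W] (d : V →ₗ[k] W) (w : W)
    (hw : w = 0 ∨ w ∉ LinearMap.range d) :
    ∃ s : W →ₗ[k] V, (∀ v, d (s (d v)) = d v) ∧ s w = 0 := by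
  obtain ⟨g, hg⟩ := d.rangeRestrict.exists_rightInverse_of_surjective
    (LinearMap.range_eq_top.2 d.surjective_rangeRestrict)
  have h (g' : W →ₗ[k] V) (hg' : g' ∘ₗ d.range.subtype = g) (v : V) : d (g' (d v)) = d v := by
    have h₁ : g' (d v) = g (d.rangeRestrict v) :=
      congrFun (congrArg DFunLike.coe hg') (d.rangeRestrict v)
    rw [h₁]
    exact congrArg Subtype.val (congrFun (congrArg DFunLike.coe hg) (d.rangeRestrict v))
  rcases hw with rfl | hw
  · obtain ⟨g', hg'⟩ := LinearMap.exists_extend g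
    exact ⟨g', h g' hg', map_zero _⟩
  · obtain ⟨g', hg', hw'⟩ := LinearMap.exists_extend_of_notMem g hw 0
    exact ⟨g', h g' hg', hw'⟩

/-- The sets `T p` consist of cycles which the homotopy has to kill and the projection has to fix;
they will be the units. -/
theorem exists_contraction {k : Type*} [Field k] {V : ℤ → Type*} [∀ p, AddCommGroup (V p)]
    [∀ p, Module k (V p)] (d : ∀ p q, V p →ₗ[k] V q) (hd : ∀ p q r v, d q r (d p q v) = 0)
    (T : ∀ p, Set (V p)) (hT : ∀ p q, ∃ s : V q →ₗ[k] V p,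
      (∀ v, d p q (s (d p q v)) = d p q v) ∧ ∀ v ∈ T q, s v = 0)
    (hTd : ∀ p q, ∀ v ∈ T p, d p q v = 0) :
    ∃ (h : ∀ q p, V q →ₗ[k] V p) (π : ∀ p, V p →ₗ[k] V p),
      (∀ p q r, p + 1 = q → q + 1 = r → ∀ v,
        d p q (h q p v) + h r q (d q r v) = v - π q v) ∧
      (∀ p q r, p + 1 = q → q + 1 = r → ∀ v, h q p (h r q v) = 0) ∧
      (∀ q r, q + 1 = r → ∀ v, π q (h r q v) = 0) ∧
      (∀ p q, p + 1 = q → ∀ v, h q p (π q v) = 0) ∧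
      (∀ q r, q + 1 = r → ∀ v, d q r (π q v) = 0) ∧
      (∀ p q, p + 1 = q → ∀ v, π q (d p q v) = 0) ∧
      (∀ q v, π q (π q v) = π q v) ∧
      (∀ q p, p + 1 = q → ∀ v ∈ T q, h q p v = 0) ∧ ∀ q, ∀ v ∈ T q, π q v = v := by
  choose s hs hsT using hT
  -- Passing from s to s d s keeps d h₀ d = d and adds h₀ d h₀ = h₀.
  let h₀ : ∀ q p, V q →ₗ[k] V p := fun q p => s p q ∘ₗ d p q ∘ₗ s p q
  have e₁ (p q v) : d p q (h₀ q p (d p q v)) = d p q v := by simp [h₀, hs]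
  have e₂ (p q v) : h₀ q p (d p q (h₀ q p v)) = h₀ q p v := by simp [h₀, hs]
  have e₃ (p q) : ∀ v ∈ T q, h₀ q p v = 0 := fun v hv => by simp [h₀, hsT p q v hv]
  -- The correction makes the homotopy square to zero: h₀ d h = h, hence h h = h₀ h - h₀ h₀ d h = 0.
  let h : ∀ q p, V q →ₗ[k] V p := fun q p => h₀ q p - h₀ q p ∘ₗ h₀ (q + 1) q ∘ₗ d q (q + 1)
  have hh (q p v) : h q p v = h₀ q p v - h₀ q p (h₀ (q + 1) q (d q (q + 1) v)) := rfl
  let π : ∀ p, V p →ₗ[k] V p := fun q =>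
    LinearMap.id - d (q - 1) q ∘ₗ h q (q - 1) - h (q + 1) q ∘ₗ d q (q + 1)
  have hπ (q v) : π q v = v - d (q - 1) q (h q (q - 1) v) - h (q + 1) q (d q (q + 1) v) := rfl
  have f₁ (p q v) : h q p (d p q v) = h₀ q p (d p q v) := by rw [hh, hd]; simp
  have f₂ (p q) (hpq : p + 1 = q) (v) : h q p (d p q (h q p v)) = h q p v := by
    rw [f₁, hh, map_sub, map_sub, e₂, e₂]
  have f₃ (p q v) : d p q (h q p (d p q v)) = d p q v := by rw [f₁, e₁]
  have f₄ (p q r) (hqr : q + 1 = r) (v) : h q p (h r q v) = 0 := by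
    subst hqr
    rw [hh q p, hh (q + 1) q, map_sub (d q (q + 1)), map_sub (h₀ (q + 1) q), e₂, e₂, sub_self]
  refine ⟨h, π, ?_, fun p q r _ hqr v => f₄ p q r hqr v, ?_, ?_, ?_, ?_, ?_, ?_, ?_⟩
  · rintro p q r hpq rfl v
    obtain rfl : p = q - 1 := by omega
    rw [hπ]
    abel
  · rintro q r rfl v
    rw [hπ, f₂ _ _ rfl, f₄ _ _ _ rfl]
    simp
  · rintro p q hpq v
    obtain rfl : p = q - 1 := by omega
    rw [hπ, map_sub, map_sub, f₂ _ _ hpq, f₄ _ _ _ rfl]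
    simp
  · rintro q r rfl v
    rw [hπ, map_sub, map_sub, f₃, hd]
    simp
  · rintro p q hpq v
    obtain rfl : p = q - 1 := by omega
    rw [hπ, f₃, hd]
    simp
  · intro q v
    have hpq : q - 1 + 1 = q := by omega
    have g₁ : h q (q - 1) (π q v) = 0 := by
      rw [hπ, map_sub, map_sub, f₂ _ _ hpq, f₄ _ _ _ rfl]
      simp
    have g₂ : d q (q + 1) (π q v) = 0 := by
      rw [hπ, map_sub, map_sub, f₃, hd]
      simp
    rw [hπ q (π q v), g₁, g₂]
    simp
  · intro q p _ v hv
    rw [hh, e₃ _ _ v hv, hTd _ _ v hv]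
    simp
  · intro q v hv
    rw [hπ, hh, e₃ _ _ v hv, hTd _ _ v hv]
    simp

namespace Fam

variable {k : Type w₁} [Field k] {O : Type u}
  {H : O → O → ℤ → Type v} [∀ x y p, AddCommGroup (H x y p)] [∀ x y p, Module k (H x y p)]
  {H' : O → O → ℤ → Type v'} [∀ x y p, AddCommGroup (H' x y p)] [∀ x y p, Module k (H' x y p)]

open Word

/-! ### Families given by linear maps -/

/-- The value on a word of a collection of linear maps. -/
noncomputable def linFun {σ : ℤ → ℤ} (φ : ∀ x y p, H x y p →ₗ[k] H' x y (σ p)) :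
    ∀ {x y : O}, Chain H x y → Word k H' x y
  | _, _, .nil => 0
  | _, _, .cons (p := p) f .nil => letter _ _ (σ p) (φ _ _ p f)
  | _, _, .cons _ (.cons _ _) => 0

/-- The family which is given by linear maps on the letters. -/
noncomputable def ofLin {σ : ℤ → ℤ} (φ : ∀ x y p, H x y p →ₗ[k] H' x y (σ p)) :
    Fam k H H' fun x => x := fun x y => lift (linFun φ)
  { add := fun c f g d => by
      rcases c with _ | ⟨e, _ | ⟨e', c⟩⟩ <;> rcases d with _ | ⟨e'', d⟩ <;>
        simp only [Chain.append, linFun, add_zero, map_add]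
    smul := fun c a f d => by
      rcases c with _ | ⟨e, _ | ⟨e', c⟩⟩ <;> rcases d with _ | ⟨e'', d⟩ <;>
        simp only [Chain.append, linFun, smul_zero, map_smul] }

section

variable {σ : ℤ → ℤ} (φ : ∀ x y p, H x y p →ₗ[k] H' x y (σ p))

theorem ofLin_of {x y : O} (c : Chain H x y) : ofLin φ x y (of k c) = linFun φ c :=
  lift_of _ _ _

theorem ofLin_letter {x y : O} {p : ℤ} (f : H x y p) :
    ofLin φ x y (letter x y p f) = letter x y (σ p) (φ x y p f) :=
  lift_of _ _ _

theorem ofLin_lam : (ofLin φ).comp (lam k H) = ofLin φ := ext fun x y c => by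
  rw [comp_apply, lam_of]
  rcases c with _ | ⟨f, _ | ⟨g, c⟩⟩
  · rw [if_neg (by simp [Chain.length]), map_zero, ofLin_of, linFun]
  · rfl
  · rw [if_neg (by simp [Chain.length]), map_zero, ofLin_of, linFun]

theorem isLetter_ofLin : IsLetter (ofLin φ) where
  lam_comp := ext fun x y c => by
    rcases c with _ | ⟨f, _ | ⟨g, c⟩⟩
    · rw [comp_apply, ofLin, lift_of, linFun, map_zero]
    · refine (congrArg (lam k H' x y) (ofLin_letter φ f)).trans ?_
      rw [lam_apply_letter]
      exact (ofLin_letter φ f).symm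
    · rw [comp_apply, ofLin, lift_of, linFun, map_zero]
  nil x := lift_of _ _ _

theorem homog_ofLin {s : ℤ} (hs : ∀ p, σ p = p + s) : Homog s (ofLin φ) := fun x y c => by
  rcases c with _ | ⟨f, _ | ⟨g, c⟩⟩
  · rw [(isLetter_ofLin φ).nil]
    exact Submodule.zero_mem _
  · refine (ofLin_letter φ f).symm ▸ of_mem_gr _ ?_
    simp only [Chain.deg, Chain.length, hs]
    ring
  · rw [ofLin, lift_of, linFun]
    exact Submodule.zero_mem _

end

theorem ext_linear {f g : Fam k H H' fun x => x} (hf : f.comp (lam k H) = f)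
    (hg : g.comp (lam k H) = g)
    (h : ∀ x y p (e : H x y p), f x y (letter x y p e) = g x y (letter x y p e)) : f = g :=
  ext fun x y c => by
    rw [← hf, ← hg, comp_apply, comp_apply, lam_of]
    rcases c with _ | ⟨e, _ | ⟨e', c⟩⟩
    · simp [Chain.length]
    · exact h _ _ _ e
    · simp [Chain.length]

end Fam

/-! ### Quasi-isomorphisms -/

namespace AInfFunctor

variable {k : Type w₁} [Field k] {C : AInfCat.{u, v} k} {D : AInfCat.{u', v'} k}
  {E : AInfCat.{u'', v''} k}

theorem cohomologyMap_injective_iff (F : AInfFunctor C D) (x y : C.Obj) (p : ℤ) :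
    Function.Injective (F.cohomologyMap x y p) ↔ ∀ f, C.m₁ x y p (p + 1) f = 0 →
      ∀ g, D.m₁ _ _ (p - 1) p g = F.map₁ x y p f → ∃ f', C.m₁ x y (p - 1) p f' = f := by
  rw [← LinearMap.ker_eq_bot, LinearMap.ker_eq_bot']
  constructor
  · intro h f hf g hg
    have := h (Submodule.Quotient.mk ⟨f, hf⟩) ((Submodule.Quotient.mk_eq_zero _).2 ⟨g, hg⟩)
    exact (Submodule.Quotient.mk_eq_zero _).1 this
  · intro h f hf
    obtain ⟨⟨f, hf'⟩, rfl⟩ := Submodule.Quotient.mk_surjective _ f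
    obtain ⟨g, hg⟩ := (Submodule.Quotient.mk_eq_zero _).1 hf
    exact (Submodule.Quotient.mk_eq_zero _).2 (h f hf' g hg)

theorem cohomologyMap_surjective_iff (F : AInfFunctor C D) (x y : C.Obj) (p : ℤ) :
    Function.Surjective (F.cohomologyMap x y p) ↔ ∀ g, D.m₁ _ _ p (p + 1) g = 0 →
      ∃ f, C.m₁ x y p (p + 1) f = 0 ∧ ∃ g', D.m₁ _ _ (p - 1) p g' = F.map₁ x y p f - g := by
  constructor
  · intro h g hg
    obtain ⟨f, hf⟩ := h (Submodule.Quotient.mk ⟨g, hg⟩)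
    obtain ⟨⟨f, hf'⟩, rfl⟩ := Submodule.Quotient.mk_surjective _ f
    exact ⟨f, hf', (Submodule.Quotient.eq _).1 hf⟩
  · intro h g
    obtain ⟨⟨g, hg⟩, rfl⟩ := Submodule.Quotient.mk_surjective _ g
    obtain ⟨f, hf, hfg⟩ := h g hg
    exact ⟨Submodule.Quotient.mk ⟨f, hf⟩, (Submodule.Quotient.eq _).2 hfg⟩

theorem cohomologyMap_comp (G : AInfFunctor D E) (F : AInfFunctor C D) (x y : C.Obj) (p : ℤ)
    (c : C.cohomology x y p) : (G.comp F).cohomologyMap x y p c =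
      G.cohomologyMap _ _ p (F.cohomologyMap x y p c) := by
  obtain ⟨⟨f, hf⟩, rfl⟩ := Submodule.Quotient.mk_surjective _ c
  exact congrArg Submodule.Quotient.mk (Subtype.ext (comp_map_letter G F f p))

theorem IsQuasiIso.comp {G : AInfFunctor D E} (hG : G.IsQuasiIso) {F : AInfFunctor C D}
    (hF : F.IsQuasiIso) : (G.comp F).IsQuasiIso := by
  refine ⟨hG.1.comp hF.1, fun x y p => ?_⟩
  rw [show ⇑((G.comp F).cohomologyMap x y p) = (G.cohomologyMap _ _ p) ∘ (F.cohomologyMap x y p)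
    from funext (cohomologyMap_comp G F x y p)]
  exact (hG.2 _ _ p).comp (hF.2 x y p)

end AInfFunctor

/-! ### Minimal models -/

namespace UnitalAInfCat

open Fam Word

variable {k : Type w₁} [Field k]

/-- The units are not coboundaries. -/
def UnitsNonexact (C : UnitalAInfCat.{u, v} k) : Prop :=
  ∀ (x : C.Obj) (f : C.Hom x x (-1)), C.m₁ x x (-1) 0 f ≠ C.one x

/-- A decomposition of the complexes of morphisms into cohomology and a contractible part. -/
structure Splitting (C : UnitalAInfCat.{u, v} k) where
  h : ∀ (x y : C.Obj) (q p : ℤ), C.Hom x y q →ₗ[k] C.Hom x y p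
  π : ∀ (x y : C.Obj) (p : ℤ), C.Hom x y p →ₗ[k] C.Hom x y p
  d_h : ∀ x y p q r, p + 1 = q → q + 1 = r → ∀ v,
    C.m₁ x y p q (h x y q p v) + h x y r q (C.m₁ x y q r v) = v - π x y q v
  h_h : ∀ x y p q r, p + 1 = q → q + 1 = r → ∀ v, h x y q p (h x y r q v) = 0
  π_h : ∀ x y q r, q + 1 = r → ∀ v, π x y q (h x y r q v) = 0
  h_π : ∀ x y p q, p + 1 = q → ∀ v, h x y q p (π x y q v) = 0
  d_π : ∀ x y q r, q + 1 = r → ∀ v, C.m₁ x y q r (π x y q v) = 0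
  π_d : ∀ x y p q, p + 1 = q → ∀ v, π x y q (C.m₁ x y p q v) = 0
  π_π : ∀ x y q v, π x y q (π x y q v) = π x y q v
  h_one : ∀ x p, p + 1 = 0 → h x x 0 p (C.one x) = 0
  π_one : ∀ x, π x x 0 (C.one x) = C.one x

variable (C : UnitalAInfCat.{u, v} k)

theorem m₁_m₁ {x y : C.Obj} (p q r : ℤ) (f : C.Hom x y p) :
    C.m₁ x y q r (C.m₁ x y p q f) = 0 := by
  by_cases hp : p + 1 = q
  · by_cases hq : q + 1 = r
    · have h := congrFun (congrArg DFunLike.coe (congrFun (congrFun C.fam_comp_bar x) y))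
        (of k (.cons f .nil))
      have e : bar C.fam x y (of k (.cons f .nil)) = C.fam x y (of k (.cons f .nil)) := by
        rw [bar, Fam.mul_of, Chain.cutSum_cons, Chain.cutSum_nil, Fam.mul_nil, C.isLetter_fam.nil,
          Fam.mul_of, Chain.cutSum_cons, Chain.cutSum_nil, C.isLetter_fam.nil]
        simp [tau_of, Chain.deg, Chain.length, Fam.id_apply, Word.mul_nil, Word.nil_mul]
      rw [Fam.comp_apply, e, C.fam_letter hp] at h
      exact letter_injective (((C.fam_letter hq _).symm.trans h).trans (map_zero _).symm)
    · exact C.m_deg _ _ (by simp only [Chain.deg, Chain.length]; push_cast; omega)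
  · have : C.m₁ x y p q f = 0 :=
      C.m_deg _ _ (by simp only [Chain.deg, Chain.length]; push_cast; omega)
    rw [this, map_zero]

theorem m₁_one (x : C.Obj) (q : ℤ) : C.m₁ x x 0 q (C.one x) = 0 :=
  C.m_one .nil .nil q (by simp [Chain.append, Chain.length])

variable {C}

theorem UnitsNonexact.nonempty_splitting (hC : C.UnitsNonexact) : Nonempty C.Splitting := by
  have key (x y : C.Obj) := exists_contraction (V := C.Hom x y) (C.m₁ x y) C.m₁_m₁
    (fun p => {f | C.IsOne f}) (fun p q => by
      -- A unit exists only for `x = y` and `q = 0`, where the pseudoinverse is chosen to kill it;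
      -- elsewhere the condition on units is empty.
      by_cases h : ∃ f : C.Hom x y q, C.IsOne f
      · obtain ⟨f, hf⟩ := h
        cases hf
        obtain ⟨s, hs, hs'⟩ := (C.m₁ x x p 0).exists_pseudoinverse (C.one x) (Or.inr (by
          rintro ⟨f, hf⟩
          -- For other values of `p` the map from degree `p` to degree 0 is zero for degree reasons.
          -- The unit would then be zero, hence the coboundary of zero.
          by_cases hp : p = -1
          · subst hp
            exact hC x f hf
          · refine hC x 0 ?_
            rw [← hf, map_zero]
            exact (C.m_deg _ _ (by simp only [Chain.deg, Chain.length]; push_cast; omega)).symm))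
        refine ⟨s, hs, fun f hf => ?_⟩
        cases hf
        exact hs'
      · obtain ⟨s, hs, -⟩ := (C.m₁ x y p q).exists_pseudoinverse 0 (Or.inl rfl)
        exact ⟨s, hs, fun f hf => absurd ⟨f, hf⟩ h⟩)
    (fun p q f hf => by
      cases hf
      exact C.m₁_one _ _)
  choose h π h₁ h₂ h₃ h₄ h₅ h₆ h₇ h₈ h₉ using key
  exact ⟨{ h := h, π := π, d_h := h₁, h_h := h₂, π_h := h₃, h_π := h₄, d_π := h₅, π_d := h₆
           π_π := h₇, h_one := fun x p hp => h₈ x x 0 p hp _ (.one x)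
           π_one := fun x => h₉ x x 0 _ (.one x) }⟩

namespace Splitting

variable (s : C.Splitting)

/-- The morphisms of the minimal model. -/
abbrev Hom (x y : C.Obj) (p : ℤ) : Type v := LinearMap.range (s.π x y p)

noncomputable def inclFam : Fam k s.Hom C.Hom fun x => x :=
  ofLin (σ := fun p => p) fun x y p => (LinearMap.range (s.π x y p)).subtype

noncomputable def projFam : Fam k C.Hom s.Hom fun x => x :=
  ofLin (σ := fun p => p) fun x y p => (s.π x y p).rangeRestrict

noncomputable def homotopyFam : Fam k C.Hom C.Hom fun x => x :=
  ofLin (σ := fun p => p - 1) fun x y p => s.h x y p (p - 1)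

theorem inclFam_letter {x y : C.Obj} {p : ℤ} (f : s.Hom x y p) :
    s.inclFam x y (letter x y p f) = letter x y p f.1 := ofLin_letter _ _

theorem projFam_letter {x y : C.Obj} {p : ℤ} (f : C.Hom x y p) :
    s.projFam x y (letter x y p f) = letter x y p ((s.π x y p).rangeRestrict f) := ofLin_letter _ _

theorem homotopyFam_letter {x y : C.Obj} {p q : ℤ} (hq : q + 1 = p) (f : C.Hom x y p) :
    s.homotopyFam x y (letter x y p f) = letter x y q (s.h x y p q f) := by
  obtain rfl : q = p - 1 := by omega
  exact ofLin_letter _ _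

theorem linPart_letter {x y : C.Obj} {p q : ℤ} (hq : p + 1 = q) (f : C.Hom x y p) :
    linPart C.fam x y (letter x y p f) = letter x y q (C.m₁ x y p q f) := by
  rw [linPart, Fam.comp_apply, lam_apply_letter]
  exact C.fam_letter hq f

theorem rangeRestrict_val {x y : C.Obj} {p : ℤ} (f : s.Hom x y p) :
    (s.π x y p).rangeRestrict f.1 = f := by
  obtain ⟨f, g, rfl⟩ := f
  exact Subtype.ext (s.π_π x y p g)

theorem retraction : Retraction C.fam s.inclFam s.projFam s.homotopyFam where
  b_letter := C.isLetter_fam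
  b_homog := C.homog_fam
  b_bar := C.fam_comp_bar
  i_letter := isLetter_ofLin _
  p_letter := isLetter_ofLin _
  h_letter := isLetter_ofLin _
  i_lam := ofLin_lam _
  p_lam := ofLin_lam _
  h_lam := ofLin_lam _
  i_homog := homog_ofLin _ fun p => (add_zero p).symm
  p_homog := homog_ofLin _ fun p => (add_zero p).symm
  h_homog := homog_ofLin _ fun p => sub_eq_add_neg p 1
  p_i := ext_linear (by rw [comp_assoc, inclFam, ofLin_lam]) lam_lam fun x y p f => by
    rw [Fam.comp_apply, inclFam_letter, projFam_letter, rangeRestrict_val, lam_apply_letter]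
  h_i := ext_linear (by rw [comp_assoc, inclFam, ofLin_lam]) rfl fun x y p f => by
    obtain ⟨f, g, rfl⟩ := f
    rw [Fam.comp_apply, inclFam_letter, s.homotopyFam_letter (q := p - 1) (by ring), s.h_π, map_zero]
    · rfl
    · ring
  p_h := ext_linear (by rw [comp_assoc, homotopyFam, ofLin_lam]) rfl fun x y p f => by
    rw [Fam.comp_apply, s.homotopyFam_letter (q := p - 1) (by ring), projFam_letter,
      show (s.π x y (p - 1)).rangeRestrict (s.h x y p (p - 1) f) = 0 from
        Subtype.ext (s.π_h x y (p - 1) p (by ring) f), map_zero]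
    rfl
  h_h := ext_linear (by rw [comp_assoc, homotopyFam, ofLin_lam]) rfl fun x y p f => by
    rw [Fam.comp_apply, s.homotopyFam_letter (q := p - 1) (by ring),
      s.homotopyFam_letter (q := p - 2) (by ring), s.h_h, map_zero]
    · rfl
    · ring
    · ring
  b_i := ext_linear (by rw [comp_assoc, inclFam, ofLin_lam]) rfl fun x y p f => by
    obtain ⟨f, g, rfl⟩ := f
    rw [Fam.comp_apply, inclFam_letter, linPart_letter rfl, s.d_π _ _ _ _ rfl, map_zero]
    rfl
  p_b := ext_linear (by rw [comp_assoc, linPart_comp_lam]) rfl fun x y p f => by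
    rw [Fam.comp_apply, linPart_letter rfl, projFam_letter,
      show (s.π x y (p + 1)).rangeRestrict (C.m₁ x y p (p + 1) f) = 0 from
        Subtype.ext (s.π_d x y p (p + 1) rfl f), map_zero]
    rfl
  b_b := ext_linear (by rw [comp_assoc, linPart_comp_lam]) rfl fun x y p f => by
    rw [Fam.comp_apply, linPart_letter rfl, linPart_letter rfl, C.m₁_m₁, map_zero]
    rfl
  b_h := ext_linear
    (by rw [add_comp, comp_assoc, comp_assoc, linPart_comp_lam, homotopyFam, ofLin_lam])
    (by rw [sub_comp, comp_assoc, lam_lam, projFam, ofLin_lam]) fun x y p f => by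
    have e₁ := linPart_letter (q := p) (by ring) (s.h x y p (p - 1) f)
    have e₂ := linPart_letter (q := p + 1) rfl f
    have e₃ := s.homotopyFam_letter (q := p) rfl (C.m₁ x y p (p + 1) f)
    rw [Fam.add_apply, Fam.sub_apply, Fam.comp_apply, Fam.comp_apply, Fam.comp_apply,
      s.homotopyFam_letter (q := p - 1) (by ring), e₁, e₂, e₃, lam_apply_letter,
      projFam_letter, inclFam_letter, ← map_add, s.d_h x y (p - 1) p (p + 1) (by ring) rfl, map_sub]
    rfl

/-- The units of the minimal model. -/
def one (x : C.Obj) : s.Hom x x 0 := ⟨C.one x, C.one x, s.π_one x⟩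

/-- The solutions `I` and `P` of the transfer recursions become the two functors. Their linear parts
are the inclusion of the image of `π` and `π` itself, which are mutually inverse on cohomology
because 1 - π is null-homotopic by `h`. -/
theorem nonempty_minimalModel (s : C.Splitting) : Nonempty (MinimalModel.{u, v, u, v, w₁} C) := by
  have r := s.retraction
  have hb {x y z : C.Obj} (a : Word k C.Hom y z) (d : Word k C.Hom x y) :
      UnitalAt C.one C.fam a d := C.unitalAt a d
  have hi (x : C.Obj) : s.inclFam x x (letter x x 0 (s.one x)) = letter x x 0 (C.one x) :=
    s.inclFam_letter _
  have hp (x : C.Obj) : s.projFam x x (letter x x 0 (C.one x)) = letter x x 0 (s.one x) := by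
    rw [← hi, inclFam_letter, projFam_letter, rangeRestrict_val]
  have hh (x : C.Obj) : s.homotopyFam x x (letter x x 0 (C.one x)) = 0 := by
    rw [s.homotopyFam_letter (q := -1) (by norm_num), s.h_one _ _ (by norm_num), map_zero]
  obtain ⟨I, hI, hs, e⟩ := r.exists_incl
  obtain ⟨P, hP, hPs, eP⟩ := r.exists_proj hI hs
  have hμ (x y : C.Obj) (p : ℤ) (f : s.Hom x y p) :
      transfer C.fam s.projFam I x y (letter x y p f) = 0 := by
    have h := congr_apply (r.transfer_lam (p := s.projFam) hI) (letter x y p f)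
    rwa [Fam.comp_apply, lam_apply_letter] at h
  let M : UnitalAInfCat.{u, v} k := ofFam (r.transfer_letter hI) (r.transfer_homog hI hs)
    (r.transfer_comp_bar hI hs e) s.one (r.transfer_unital hb hi hI e)
  have hM : M.fam = transfer C.fam s.projFam I := AInfCat.ofFam_fam (r.transfer_letter hI)
    (r.transfer_homog hI hs) (r.transfer_comp_bar hI hs e)
  let F : AInfFunctor M.toAInfCat C.toAInfCat := AInfFunctor.ofFam (o := fun x => x) hI hs
    (by rw [hM]; exact (r.comp_hat_incl hI hs e).symm)
  let G : AInfFunctor C.toAInfCat M.toAInfCat := AInfFunctor.ofFam (o := fun x => x) hP hPs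
    (by rw [hM]; exact (r.comp_hat_proj hI hs e hP hPs eP).symm)
  have hF : F.fam = I := AInfFunctor.ofFam_fam _ _ _
  have hG : G.fam = P := AInfFunctor.ofFam_fam _ _ _
  have hm {x y : M.Obj} {p : ℤ} (f : M.Hom x y p) (q : ℤ) : M.m (.cons f .nil) q = 0 := by
    by_cases hq : p + 1 = q
    · refine letter_injective (k := k) ((M.fam_letter hq f).symm.trans (Eq.trans ?_ (map_zero _).symm))
      rw [hM]
      exact hμ x y p f
    · exact M.m_deg _ _ (by simp only [Chain.deg, Chain.length]; push_cast; omega)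
  have hF₁ (x y : C.Obj) (p : ℤ) (f : s.Hom x y p) : F.map₁ x y p f = f.1 := by
    refine letter_injective (k := k) ((F.fam_letter f).symm.trans ?_)
    have h := congr_apply (r.incl_lam hI e) (letter (H := s.Hom) x y p f)
    rw [Fam.comp_apply, lam_apply_letter, inclFam_letter] at h
    rw [hF]
    exact h
  have hG₁ (x y : C.Obj) (p : ℤ) (f : C.Hom x y p) :
      G.map₁ x y p f = (s.π x y p).rangeRestrict f := by
    refine letter_injective (k := k) ((G.fam_letter f).symm.trans ?_)
    have h := congr_apply (r.proj_lam hI eP hP) (letter x y p f)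
    rw [Fam.comp_apply, lam_apply_letter, projFam_letter] at h
    rw [hG]
    exact h
  have hd (x y : C.Obj) (p : ℤ) (f : C.Hom x y p) (hf : C.m₁ x y p (p + 1) f = 0) :
      C.m₁ x y (p - 1) p (s.h x y p (p - 1) f) = f - s.π x y p f := by
    have := s.d_h x y (p - 1) p (p + 1) (by ring) rfl f
    rwa [hf, map_zero, add_zero] at this
  refine ⟨{
    cat := M
    isMinimal := hm
    incl := F
    incl_unital := AInfFunctor.isStrictlyUnital_of_fam fun a d => by
      rw [hF]
      exact r.incl_unital hb hi hI e a d
    incl_quasiIso := ⟨Function.bijective_id, fun (x y : C.Obj) p => ⟨?_, ?_⟩⟩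
    proj := G
    proj_unital := AInfFunctor.isStrictlyUnital_of_fam fun a d => by
      rw [hG]
      exact r.proj_unital hb hi hp hh hI hs e hP hPs eP a d
    proj_quasiIso := ⟨Function.bijective_id, fun (x y : C.Obj) p => ⟨?_, ?_⟩⟩ }⟩
  · refine (F.cohomologyMap_injective_iff x y p).2 ?_
    intro (f : s.Hom x y p) _ (g : C.Hom x y (p - 1)) hg
    refine ⟨(0 : s.Hom x y (p - 1)), (hm (x := x) (y := y) _ _).trans ?_⟩
    refine Eq.trans ?_ (s.rangeRestrict_val f)
    rw [← hF₁ x y p f, ← hg]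
    exact Subtype.ext (s.π_d x y (p - 1) p (by ring) g).symm
  · refine (F.cohomologyMap_surjective_iff x y p).2 ?_
    intro (g : C.Hom x y p) hg
    refine ⟨(s.π x y p).rangeRestrict g, hm _ _, -s.h x y p (p - 1) g, ?_⟩
    refine (map_neg (C.m₁ x y (p - 1) p) _).trans ?_
    refine (congrArg Neg.neg (hd x y p g hg)).trans ?_
    rw [neg_sub]
    exact congrArg (· - g) (hF₁ x y p ((s.π x y p).rangeRestrict g)).symm
  · refine (G.cohomologyMap_injective_iff x y p).2 ?_
    intro f hf g hg
    refine ⟨s.h x y p (p - 1) f, ?_⟩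
    have h₁ : (s.π x y p).rangeRestrict f = 0 := by
      rw [← hG₁, ← hg]
      exact hm g _
    rw [hd x y p f hf, show s.π x y p f = 0 from congrArg Subtype.val h₁, sub_zero]
  · refine (G.cohomologyMap_surjective_iff x y p).2 ?_
    intro (g : s.Hom x y p) _
    obtain ⟨g', hg'⟩ := g.2
    refine ⟨g.1, ?_, 0, ?_⟩
    · rw [← hg']
      exact s.d_π x y p (p + 1) rfl g'
    · rw [map_zero]
      exact (sub_eq_zero.2 ((hG₁ x y p g.1).trans (s.rangeRestrict_val g))).symm

end Splitting

theorem UnitsNonexact.nonempty_minimalModel (hC : C.UnitsNonexact) :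
    Nonempty (MinimalModel.{u, v, u, v, w₁} C) :=
  hC.nonempty_splitting.elim fun s => s.nonempty_minimalModel

end UnitalAInfCat

/-! ### Functors to the unitally positive `A_∞`-category -/

namespace UnitalAInfCat

variable {k : Type w₁} [Field k] {C : UnitalAInfCat.{u, v} k}

theorem IsOne.eq {x y : C.Obj} {p : ℤ} {f g : C.Hom x y p} (hf : C.IsOne f) (hg : C.IsOne g) :
    f = g := by
  cases hf
  cases hg
  rfl

theorem mem_span_isOne {x y : C.Obj} {p : ℤ} {f : C.Hom x y p}
    (hf : f ∈ Submodule.span k {f | C.IsOne f}) : f = 0 ∨ ∃ g, C.IsOne g ∧ ∃ a : k, f = a • g := by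
  induction hf using Submodule.span_induction with
  | zero => exact Or.inl rfl
  | mem f hf => exact Or.inr ⟨f, hf, 1, (one_smul _ _).symm⟩
  | add f g _ _ hf hg =>
    obtain rfl | ⟨f', hf', a, rfl⟩ := hf
    · rwa [zero_add]
    obtain rfl | ⟨g', hg', b, rfl⟩ := hg
    · rw [add_zero]
      exact Or.inr ⟨f', hf', a, rfl⟩
    obtain rfl := hf'.eq hg'
    exact Or.inr ⟨f', hf', a + b, (add_smul _ _ _).symm⟩
  | smul r f _ hf =>
    obtain rfl | ⟨f', hf', a, rfl⟩ := hf
    · exact Or.inl (smul_zero _)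
    · exact Or.inr ⟨f', hf', r * a, (mul_smul _ _ _).symm⟩

/-- All morphisms of nonpositive degree are multiples of units. -/
def IsPositive (C : UnitalAInfCat.{u, v} k) : Prop :=
  ∀ {x y : C.Obj} {p : ℤ} (f : C.Hom x y p), p ≤ 0 → f ∈ Submodule.span k {f | C.IsOne f}

end UnitalAInfCat

namespace AInfFunctor

open UnitalAInfCat

variable {k : Type w₁} [Field k] {C : UnitalAInfCat.{u, v} k} {D : UnitalAInfCat.{u', v'} k}
  {F : AInfFunctor C.toAInfCat D.toAInfCat}

/-- If all n letters have positive degree, the value has degree |c| + 1 - n ≥ 1. Otherwise some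
letter is a combination of units, and by strict unitality only a word of length one survives, whose
value is again a combination of units. -/
theorem IsStrictlyUnital.map_mem_positivePart (hF : F.IsStrictlyUnital) (hC : C.IsPositive)
    {x y : C.Obj} (c : Chain C.Hom x y) (q : ℤ) :
    F.map c q ∈ D.positivePart (F.obj x) (F.obj y) q := by
  rcases lt_or_ge 0 q with hq | hq
  · simp [positivePart, hq]
  rcases c.length_le_deg_or with h | ⟨y', w', p', a, g, b, hp', rfl⟩
  · rw [F.map_deg _ _ (by omega)]
    exact Submodule.zero_mem _
  · have hg := hC g hp'
    induction hg using Submodule.span_induction with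
    | zero => rw [F.map_zero]; exact Submodule.zero_mem _
    | add f g _ _ hf hg => rw [F.map_add]; exact Submodule.add_mem _ hf hg
    | smul r f _ hf => rw [F.map_smul]; exact Submodule.smul_mem _ r hf
    | mem f hf =>
      cases hf with
      | one =>
        by_cases hl : (a.append (.cons (C.one _) b)).length = 1
        · rw [Chain.length_append] at hl
          simp only [Chain.length] at hl
          rcases a with _ | ⟨f, a⟩ <;> rcases b with _ | ⟨f', b⟩ <;>
            simp only [Chain.length] at hl <;> try omega
          by_cases hq0 : q = 0
          · subst hq0
            rw [Chain.append, hF.map_one, positivePart, if_neg (lt_irrefl _)]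
            exact Submodule.subset_span (.one _)
          · rw [F.map_deg _ _ (by
              simp only [Chain.append, Chain.deg, Chain.length]
              push_cast
              omega)]
            exact Submodule.zero_mem _
        · rw [hF.map_one_eq_zero _ _ _ hl]
          exact Submodule.zero_mem _

/-- A strictly unital functor from a positive category, as a functor to the unitally positive
category of its target. -/
def positiveLift (hF : F.IsStrictlyUnital) (hC : C.IsPositive) :
    AInfFunctor C.toAInfCat D.unitallyPositive where
  obj := F.obj
  map c q := ⟨F.map c q, hF.map_mem_positivePart hC c q⟩
  map_nil x q := Subtype.ext (F.map_nil x q)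
  map_deg c q h := Subtype.ext (F.map_deg c q h)
  map_add c f g d q := Subtype.ext (F.map_add c f g d q)
  map_smul c a f d q := Subtype.ext (F.map_smul c a f d q)
  rel {x y} c q := by
    have hβ {x y : C.Obj} (β : Blocks C.Hom x y) :
        D.positiveIncl (β.image F.obj fun c q => ⟨F.map c q, hF.map_mem_positivePart hC c q⟩) =
          β.image F.obj F.map := by
      induction β with
      | nil => rfl
      | cons b β ih => exact congrArg (Chain.cons _) ih
    have hu {M : Type v'} [AddCommGroup M] [Module k M] (S : Submodule k M) (ε : ℤˣ) (f : S) :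
        ((ε • f : S) : M) = ε • (f : M) := by
      rcases Int.units_eq_one_or ε with rfl | rfl <;> simp
    have hs {M : Type v'} [AddCommGroup M] [Module k M] (S : Submodule k M) {ι : Type _}
        (l : List ι) (f : ι → S) : ((l.map f).sum : M) = (l.map fun i => (f i : M)).sum := by
      induction l with
      | nil => rfl
      | cons i l ih => exact congrArg ((f i : M) + ·) ih
    refine Subtype.ext ((hs _ _ _).trans (Eq.trans ?_ (hs _ _ _).symm))
    refine Eq.trans (congrArg List.sum (List.map_congr_left fun s _ => ?_)) ((F.rel c q).trans
      (congrArg List.sum (List.map_congr_left fun β _ => ?_)))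
    · exact hu _ _ _
    · refine Eq.trans ?_ (hu _ _ _).symm
      exact congrArg (fun c => β.signExp.negOnePow • D.m c q) (hβ β).symm

theorem IsStrictlyUnital.exists_isOne {C : UnitalAInfCat.{u, v} k} {D : UnitalAInfCat.{u', v'} k}
    {F : AInfFunctor C.toAInfCat D.toAInfCat} (hF : F.IsStrictlyUnital)
    (hobj : Function.Injective F.obj) {x y : C.Obj} {p : ℤ} {g : D.Hom (F.obj x) (F.obj y) p}
    (hg : D.IsOne g) : ∃ f : C.Hom x y p, C.IsOne f ∧ F.map₁ x y p f = g := by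
  -- The endpoints are generalised to variables so that `IsOne` can be destructed; the equality of
  -- morphisms then becomes heterogeneous.
  have key {a b : D.Obj} {p : ℤ} (g : D.Hom a b p) (hg : D.IsOne g) : ∀ (x y : C.Obj),
      F.obj x = a → F.obj y = b → ∃ f : C.Hom x y p, C.IsOne f ∧ HEq (F.map₁ x y p f) g := by
    cases hg
    rintro x y rfl hy
    obtain rfl := hobj hy
    exact ⟨C.one _, .one _, heq_of_eq (hF.map_one _)⟩
  obtain ⟨f, hf, hfg⟩ := key g hg x y rfl rfl
  exact ⟨f, hf, eq_of_heq hfg⟩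

theorem IsStrictlyUnital.exists_mem_span_isOne {C : UnitalAInfCat.{u, v} k}
    {D : UnitalAInfCat.{u', v'} k} {F : AInfFunctor C.toAInfCat D.toAInfCat}
    (hF : F.IsStrictlyUnital) (hobj : Function.Injective F.obj) {x y : C.Obj} {p : ℤ}
    {g : D.Hom (F.obj x) (F.obj y) p} (hg : g ∈ Submodule.span k {f | D.IsOne f}) :
    ∃ f ∈ Submodule.span k {f : C.Hom x y p | C.IsOne f}, F.map₁ x y p f = g := by
  obtain rfl | ⟨g, hg', a, rfl⟩ := UnitalAInfCat.mem_span_isOne hg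
  · exact ⟨0, Submodule.zero_mem _, _root_.map_zero _⟩
  · obtain ⟨f, hf, rfl⟩ := hF.exists_isOne hobj hg'
    exact ⟨a • f, Submodule.smul_mem _ _ (Submodule.subset_span hf), _root_.map_smul _ _ _⟩

/-- Both differentials vanish, so the linear component itself must be bijective. In positive degrees
this is assumed; in the other degrees both sides are spanned by units, which correspond to each
other and are nonzero in the target. -/
theorem positiveLift_isQuasiIso (hF : F.IsStrictlyUnital) (hC : C.IsPositive)
    (hCm : C.IsMinimal) (hDm : D.IsMinimal) (hobj : Function.Bijective F.obj)
    (hmap : ∀ x y (p : ℤ), 0 < p → Function.Bijective (F.map₁ x y p))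
    (hone : ∀ x, D.one x ≠ 0) : (positiveLift hF hC).IsQuasiIso := by
  refine ⟨hobj, fun x y p => ?_⟩
  have hval (f : C.Hom x y p) : ((positiveLift hF hC).map₁ x y p f).1 = F.map₁ x y p f := rfl
  have hNm {x y : D.unitallyPositive.Obj} (p q : ℤ) (f) : D.unitallyPositive.m₁ x y p q f = 0 :=
    Subtype.ext (hDm f.1 q)
  suffices h : Function.Injective (F.map₁ x y p) ∧
      ∀ g ∈ D.positivePart (F.obj x) (F.obj y) p, ∃ f, F.map₁ x y p f = g by
    constructor
    · rw [cohomologyMap_injective_iff]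
      intro f _ g hg
      refine ⟨0, (_root_.map_zero _).trans (h.1 ?_).symm⟩
      rw [_root_.map_zero, ← hval, ← hg]
      exact congrArg Subtype.val (hNm _ _ g)
    · rw [cohomologyMap_surjective_iff]
      intro g _
      obtain ⟨f, hf⟩ := h.2 g.1 g.2
      refine ⟨f, hCm _ _, 0, (hNm _ _ 0).trans ?_⟩
      exact (sub_eq_zero.2 (Subtype.ext hf)).symm
  by_cases hp : 0 < p
  · exact ⟨(hmap x y p hp).1, fun g _ => (hmap x y p hp).2 g⟩
  · constructor
    · refine (injective_iff_map_eq_zero _).2 fun f hf => ?_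
      obtain h | ⟨g, hg, a, rfl⟩ := mem_span_isOne (hC f (not_lt.1 hp))
      · exact h
      · cases hg
        rw [_root_.map_smul] at hf
        rcases smul_eq_zero.1 hf with rfl | h
        · exact zero_smul _ _
        · exact absurd ((hF.map_one x).symm.trans h) (hone _)
    · intro g hg
      rw [positivePart, if_neg hp] at hg
      obtain ⟨f, -, hf⟩ := hF.exists_mem_span_isOne hobj.1 hg
      exact ⟨f, hf⟩

end AInfFunctor

/-! ### DG-functors -/

theorem Chain.cons_congr {O : Type u} {H : O → O → ℤ → Type v} {x y z : O} (f : ∀ q, H y z q)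
    {p p' : ℤ} (h : p = p') (c : Chain H x y) : Chain.cons (f p) c = Chain.cons (f p') c := by
  rw [h]

/-- A DG-functor. -/
structure DGFunctor {k : Type w₁} [Field k] (C : DGCat.{u, v} k) (D : DGCat.{u', v'} k) where
  obj : C.Obj → D.Obj
  map : ∀ (x y : C.Obj) (p : ℤ), C.Hom x y p →ₗ[k] D.Hom (obj x) (obj y) p
  map_d : ∀ {x y : C.Obj} {p : ℤ} (f : C.Hom x y p),
    map x y (p + 1) (C.d x y p (p + 1) f) = D.d _ _ p (p + 1) (map x y p f)
  map_comp : ∀ {x y z : C.Obj} {p q r : ℤ} (h : p + q = r) (g : C.Hom y z p) (f : C.Hom x y q),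
    map x z r (C.comp h g f) = D.comp h (map y z p g) (map x y q f)
  map_one : ∀ x, map x x 0 (C.one x) = D.one (obj x)

namespace DGFunctor

variable {k : Type w₁} [Field k] {C : DGCat.{u, v} k} {D : DGCat.{u', v'} k} (Φ : DGFunctor C D)

/-- The components of a DG-functor, regarded as an `A_∞`-functor. -/
def mapChain {x : C.Obj} : ∀ {y : C.Obj}, Chain C.Hom x y → ∀ q : ℤ, D.Hom (Φ.obj x) (Φ.obj y) q
  | _, .nil, _ => 0
  | _, .cons (p := p) f .nil, q => if h : p = q then h ▸ Φ.map _ _ p f else 0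
  | _, .cons _ (.cons _ _), _ => 0

theorem mapChain_letter {x y : C.Obj} {p : ℤ} (f : C.Hom x y p) :
    Φ.mapChain (.cons f .nil) p = Φ.map x y p f :=
  dif_pos rfl

theorem mapChain_letter_of_ne {x y : C.Obj} {p q : ℤ} (f : C.Hom x y p) (h : p ≠ q) :
    Φ.mapChain (.cons f .nil) q = 0 :=
  dif_neg h

theorem mapChain_of_two_le {x y : C.Obj} : ∀ (c : Chain C.Hom x y) (q : ℤ), 2 ≤ c.length →
    Φ.mapChain c q = 0
  | .nil, _, h => absurd h (by simp [Chain.length])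
  | .cons _ .nil, _, h => absurd h (by simp [Chain.length])
  | .cons _ (.cons _ _), _, _ => rfl

theorem mapChain_zero {x y : C.Obj} (p q : ℤ) :
    Φ.mapChain (.cons (0 : C.Hom x y p) .nil) q = 0 := by
  by_cases h : p = q
  · subst h
    rw [mapChain_letter, map_zero]
  · exact Φ.mapChain_letter_of_ne _ h

theorem mapChain_add {x y z w : C.Obj} {p : ℤ} (c : Chain C.Hom z w) (f g : C.Hom y z p)
    (d : Chain C.Hom x y) (q : ℤ) : Φ.mapChain (c.append (.cons (f + g) d)) q =
      Φ.mapChain (c.append (.cons f d)) q + Φ.mapChain (c.append (.cons g d)) q := by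
  by_cases h : c.length + d.length = 0
  · rcases c with _ | ⟨_, _⟩ <;> rcases d with _ | ⟨_, _⟩ <;> simp only [Chain.length] at h <;>
      try omega
    by_cases h : p = q
    · subst h
      simp only [Chain.append, mapChain_letter, map_add]
    · simp only [Chain.append, Φ.mapChain_letter_of_ne _ h, add_zero]
  · have h' (f : C.Hom y z p) : Φ.mapChain (c.append (.cons f d)) q = 0 :=
      Φ.mapChain_of_two_le _ q (by rw [Chain.length_append, Chain.length]; omega)
    rw [h', h', h', add_zero]

theorem mapChain_smul {x y z w : C.Obj} {p : ℤ} (c : Chain C.Hom z w) (a : k) (f : C.Hom y z p)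
    (d : Chain C.Hom x y) (q : ℤ) : Φ.mapChain (c.append (.cons (a • f) d)) q =
      a • Φ.mapChain (c.append (.cons f d)) q := by
  by_cases h : c.length + d.length = 0
  · rcases c with _ | ⟨_, _⟩ <;> rcases d with _ | ⟨_, _⟩ <;> simp only [Chain.length] at h <;>
      try omega
    by_cases h : p = q
    · subst h
      simp only [Chain.append, mapChain_letter, map_smul]
    · simp only [Chain.append, Φ.mapChain_letter_of_ne _ h, smul_zero]
  · have h' (f : C.Hom y z p) : Φ.mapChain (c.append (.cons f d)) q = 0 :=
      Φ.mapChain_of_two_le _ q (by rw [Chain.length_append, Chain.length]; omega)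
    rw [h', h', smul_zero]

/-- Only the linear component is nonzero, so on letters the relation is compatibility with
differentials, on words of length two it is compatibility with composition, and on longer words
every term vanishes. -/
theorem mapChain_rel {x y : C.Obj} (c : Chain C.Hom x y) (q : ℤ) :
    (c.splits.map fun s => s.sign • Φ.mapChain (s.contract C.m) q).sum =
      (c.blockings.map fun β => β.signExp.negOnePow • D.m (β.image Φ.obj Φ.mapChain) q).sum := by
  by_cases h : 3 ≤ c.length
  · rw [List.sum_eq_zero, List.sum_eq_zero]
    · intro t ht
      obtain ⟨β, hβ, rfl⟩ := List.mem_map.1 ht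
      have hc := congrArg Chain.length (Blocks.concat_of_mem _ _ hβ)
      rw [Blocks.length_concat] at hc
      have hz {x y : C.Obj} (b : Chain C.Hom x y) (n : ℤ) (hb : 2 ≤ b.length) :
        Φ.mapChain b n = 0 := Φ.mapChain_of_two_le b n hb
      rcases β with _ | ⟨b, _ | ⟨b', _ | ⟨b'', β⟩⟩⟩
      · simp only [Blocks.length] at hc
        omega
      · simp only [Blocks.length] at hc
        rw [Blocks.image, hz b _ (by omega)]
        exact (congrArg _ (D.m_zero .nil _ q)).trans (smul_zero _)
      · simp only [Blocks.length] at hc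
        rcases le_or_gt 2 b.length with hb | hb
        · rw [Blocks.image, hz b _ hb]
          exact (congrArg _ (D.m_zero .nil _ q)).trans (smul_zero _)
        · rw [Blocks.image, Blocks.image, hz b' _ (by omega)]
          have h0 {x y z : D.Obj} {p p' : ℤ} (f : D.Hom y z p) :
              D.m (.cons f (.cons (0 : D.Hom x y p') .nil)) q = 0 := D.m_zero (.cons f .nil) .nil q
          exact (congrArg _ (h0 _)).trans (smul_zero _)
      · rw [Blocks.image, Blocks.image, Blocks.image,
          D.m_eq_zero _ _ (by simp [Chain.length]), smul_zero]
    · intro t ht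
      obtain ⟨s, hs, rfl⟩ := List.mem_map.1 ht
      have hl := c.length_splits s hs
      by_cases h₁ : s.left.length + s.right.length = 0
      · obtain ⟨l, m, r⟩ := s
        simp only at hl h₁
        rcases l with _ | ⟨_, _⟩ <;> rcases r with _ | ⟨_, _⟩ <;> simp only [Chain.length] at hl h₁ <;>
          try omega
        rw [Split.contract, C.m_eq_zero m _ (by omega)]
        exact (congrArg _ (Φ.mapChain_zero _ q)).trans (smul_zero _)
      · rw [Φ.mapChain_of_two_le _ q, smul_zero]
        rw [Split.contract, Chain.length_append, Chain.length]
        omega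
  · match c with
    | .nil =>
      have e : (.nil : Chain C.Hom x x).splits = [⟨.nil, .nil, .nil⟩] := rfl
      have e' : (.nil : Chain C.Hom x x).blockings = [.nil] := rfl
      rw [e, e', List.map_singleton, List.map_singleton, List.sum_singleton, List.sum_singleton]
      exact ((congrArg _ (Φ.mapChain_zero _ q)).trans (smul_zero _)).trans (smul_zero _).symm
    | .cons (p := p) f .nil =>
      have e : (Chain.cons f .nil).splits =
        [⟨.nil, .nil, .cons f .nil⟩, ⟨.nil, .cons f .nil, .nil⟩, ⟨.cons f .nil, .nil, .nil⟩] := rfl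
      have e' : (Chain.cons f .nil).blockings = [.cons (.cons f .nil) .nil] := rfl
      have s₁ : (⟨.nil, .cons f .nil, .nil⟩ : Split C.Hom x y).sign = 1 := by
        simp [Split.sign, Chain.length, Chain.deg]
      have s₂ : (Blocks.cons (.cons f .nil) .nil : Blocks C.Hom x y).signExp = 0 := by
        simp [Blocks.signExp, Blocks.count, Blocks.length]
      have h₁ : (Chain.cons f .nil).deg + 2 - ((Chain.cons f .nil).length : ℤ) = p + 1 := by
        simp only [Chain.deg, Chain.length]
        push_cast
        omega
      have h₂ : (Chain.cons f .nil).deg + 1 - ((Chain.cons f .nil).length : ℤ) = p := by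
        simp only [Chain.deg, Chain.length]
        push_cast
        omega
      have k₁ := Chain.cons_congr (fun q => C.m (.cons f .nil) q) h₁ .nil
      have k₂ := Chain.cons_congr (fun q => Φ.mapChain (.cons f .nil) q) h₂ .nil
      rw [mapChain_letter] at k₂
      rw [e, e']
      simp only [List.map, List.sum_cons, List.sum_nil, s₁, s₂, Split.contract, Chain.append, k₁,
        Blocks.image, k₂, add_zero, Int.negOnePow_zero, one_smul,
        Φ.mapChain_of_two_le _ q (show 2 ≤ (Chain.cons _ (.cons _ _)).length by
          simp [Chain.length]), smul_zero, zero_add]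
      by_cases hq : p + 1 = q
      · subst hq
        exact (Φ.mapChain_letter _).trans (Φ.map_d f)
      · rw [Φ.mapChain_letter_of_ne _ hq]
        exact (LinearMap.congr_fun (D.d_shape _ _ p q hq) _).symm
    | .cons (p := p) g (.cons (p := p') f .nil) =>
      have e : (Chain.cons g (.cons f .nil)).splits =
        [⟨.nil, .nil, .cons g (.cons f .nil)⟩, ⟨.nil, .cons g .nil, .cons f .nil⟩,
          ⟨.nil, .cons g (.cons f .nil), .nil⟩, ⟨.cons g .nil, .nil, .cons f .nil⟩,
          ⟨.cons g .nil, .cons f .nil, .nil⟩, ⟨.cons g (.cons f .nil), .nil, .nil⟩] := rfl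
      have e' : (Chain.cons g (.cons f .nil)).blockings =
        [.cons (.cons g .nil) (.cons (.cons f .nil) .nil), .cons (.cons g (.cons f .nil)) .nil] :=
        rfl
      have s₁ : (⟨.nil, .cons g (.cons f .nil), .nil⟩ : Split C.Hom _ _).sign = 1 := by
        simp [Split.sign, Chain.length, Chain.deg]
      have s₂ : (Blocks.cons (.cons g .nil) (.cons (.cons f .nil) .nil) :
          Blocks C.Hom _ _).signExp = 0 := by
        simp [Blocks.signExp, Blocks.count, Blocks.length, Chain.length]
      have h₁ : (Chain.cons g (.cons f .nil)).deg + 2 - ((Chain.cons g (.cons f .nil)).length : ℤ) =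
          p + p' := by
        simp only [Chain.deg, Chain.length]
        push_cast
        omega
      have h₂ {x y : C.Obj} {p : ℤ} (f : C.Hom x y p) :
          (Chain.cons f .nil).deg + 1 - ((Chain.cons f .nil).length : ℤ) = p := by
        simp only [Chain.deg, Chain.length]
        push_cast
        omega
      have h₃ (n : ℤ) : D.m (.cons (0 : D.Hom (Φ.obj x) (Φ.obj y) n) .nil) q = 0 :=
        D.m_zero .nil .nil q
      have k₁ := Chain.cons_congr (fun q => C.m (.cons g (.cons f .nil)) q) h₁ .nil
      have k₂ {x y z : C.Obj} {p : ℤ} (f : C.Hom y z p) (c : Chain D.Hom (Φ.obj x) (Φ.obj y)) :=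
        Chain.cons_congr (fun q => Φ.mapChain (.cons f .nil) q) (h₂ f) c
      simp only [mapChain_letter] at k₂
      rw [e, e']
      simp only [List.map, List.sum_cons, List.sum_nil, s₁, s₂, Split.contract, Chain.append, k₁,
        Blocks.image, k₂, add_zero, Int.negOnePow_zero, one_smul,
        Φ.mapChain_of_two_le _ _ (show 2 ≤ (Chain.cons _ (.cons _ _)).length by
          simp [Chain.length]), smul_zero, zero_add, h₃]
      by_cases hq : p + p' = q
      · subst hq
        rw [C.m_comp g f _ rfl, D.m_comp _ _ _ rfl, mapChain_letter, Φ.map_comp]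
      · rw [Φ.mapChain_letter_of_ne _ hq, D.m_comp_of_ne _ _ _ hq]
    | .cons _ (.cons _ (.cons _ _)) =>
      exact absurd h (by simp only [Chain.length]; omega)

/-- A DG-functor, regarded as an `A_∞`-functor. -/
def toAInf : AInfFunctor C.toAInf.toAInfCat D.toAInf.toAInfCat where
  obj := Φ.obj
  map c q := Φ.mapChain c q
  map_nil _ _ := rfl
  map_deg c q h := by
    rcases c with _ | ⟨f, _ | _⟩
    · rfl
    · exact Φ.mapChain_letter_of_ne _ fun h' => h (by
        simp only [Chain.deg, Chain.length]
        push_cast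
        omega)
    · rfl
  map_add := Φ.mapChain_add
  map_smul := Φ.mapChain_smul
  rel := Φ.mapChain_rel

theorem toAInf_map₁ {x y : C.Obj} {p : ℤ} (f : C.Hom x y p) :
    Φ.toAInf.map₁ x y p f = Φ.map x y p f :=
  Φ.mapChain_letter f

theorem toAInf_isStrictlyUnital :
    AInfFunctor.IsStrictlyUnital (C := C.toAInf) (D := D.toAInf) Φ.toAInf where
  map_one x := (Φ.mapChain_letter _).trans (Φ.map_one x)
  map_one_eq_zero c d q h := by
    refine Φ.mapChain_of_two_le _ q ?_
    have e := Chain.length_append c (Chain.cons (C.one _) d)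
    simp only [Chain.length] at e
    have h' : (c.append (Chain.cons (C.one _) d)).length ≠ 1 := h
    refine le_trans ?_ (le_of_eq rfl : (c.append (Chain.cons (C.one _) d)).length ≤ _)
    omega

end DGFunctor

/-! ### The DG-functor induced by a linear functor -/

section

open CochainComplex.HomComplex

variable (k : Type w₁) [Field k] {𝒞 : Type u} [Category.{v} 𝒞] [Preadditive 𝒞]
  [Linear k 𝒞] {𝒟 : Type u'} [Category.{v'} 𝒟] [Preadditive 𝒟] [Linear k 𝒟] (Φ : 𝒞 ⥤ 𝒟)
  [Φ.Additive] [Φ.Linear k]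

/-- The map on cochains given by a linear functor. -/
def cochainMap (K L : CochainComplex 𝒞 ℤ) (p : ℤ) :
    Cochain K L p →ₗ[k] Cochain ((Φ.mapHomologicalComplex _).obj K)
      ((Φ.mapHomologicalComplex _).obj L) p where
  toFun f := f.map Φ
  map_add' f g := Cochain.map_add f g Φ
  map_smul' _ _ := Cochain.ext _ _ fun _ _ _ => Φ.map_smul _ _

/-- The DG-functor given by a linear functor. -/
noncomputable def homDGMap {ι : Type u''} (K : ι → CochainComplex 𝒞 ℤ) :
    DGFunctor (homDG k K) (homDG k fun i => (Φ.mapHomologicalComplex _).obj (K i)) where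
  obj i := i
  map i j p := cochainMap k Φ (K i) (K j) p
  map_d {i j p} f := (δ_map p (p + 1) f Φ).symm
  map_comp {i j l p q r} h g f := Cochain.map_comp (F := K i) (G := K j) (K := K l) f g (by omega) Φ
  map_one i := (Cochain.map_ofHom _ _ (𝟙 (K i)) Φ).trans
    (congrArg Cochain.ofHom ((Φ.mapHomologicalComplex _).map_id (K i)))

end

/-! ### Construction of cochains -/

section

open CochainComplex.HomComplex Limits

variable {𝒞 : Type u} [Category.{v} 𝒞] [Preadditive 𝒞] {X Y : CochainComplex 𝒞 ℤ}

/-- The equation δ g = w is solved one component at a time, by descending source degree. When the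
residual vanishes in source degrees above k, its cocycle equation says that the component at k is
annihilated by the differential of `Y`, so it lifts. The top degree `k₁` has its own hypothesis,
since in the applications the lift there comes from an augmentation. The last clause records that
`g` does not reach above `k₁`. -/
theorem exists_δ_eq {q m : ℤ} (hm : q + 1 = m) (w : Cochain X Y m) (hw : δ m (m + 1) w = 0)
    (b k₁ : ℤ) (hX : ∀ k ≤ b, IsZero (X.X k))
    (hw₁ : ∀ k k' (h : k + m = k'), k₁ < k → w.v k k' h = 0)
    (h₁ : ∀ k' k'' (h : k₁ + m = k'), k₁ + q = k'' →
      ∃ a : X.X k₁ ⟶ Y.X k'', a ≫ Y.d k'' k' = w.v k₁ k' h)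
    (hlift : ∀ k k' k'', k < k₁ → k + m = k' → k + q = k'' → ∀ φ : X.X k ⟶ Y.X k',
      φ ≫ Y.d k' (k' + 1) = 0 → ∃ a : X.X k ⟶ Y.X k'', a ≫ Y.d k'' k' = φ) :
    ∃ g : Cochain X Y q, δ q m g = w ∧ ∀ k k' (h : k + q = k'), k₁ < k → g.v k k' h = 0 := by
  have key (N : ℕ) : ∃ g : Cochain X Y q, (∀ k k' (h : k + q = k'), k₁ < k → g.v k k' h = 0) ∧
      ∀ k k' (h : k + m = k'), k₁ - N < k → (w - δ q m g).v k k' h = 0 := by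
    induction N with
    | zero => exact ⟨0, fun _ _ _ _ => rfl, fun k k' h hk => by
        rw [δ_zero, sub_zero]
        exact hw₁ k k' h (by simpa using hk)⟩
    | succ N ih =>
      obtain ⟨g, hg, hg'⟩ := ih
      set w' := w - δ q m g with hw'
      have hδ : δ m (m + 1) w' = 0 := by rw [hw', δ_sub, hw, δ_δ, sub_zero]
      obtain ⟨a, ha⟩ : ∃ a : X.X (k₁ - N) ⟶ Y.X (k₁ - N + q),
          a ≫ Y.d (k₁ - N + q) (k₁ - N + m) = w'.v (k₁ - N) (k₁ - N + m) rfl := by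
        -- At the start the residual is `w - δ g` and not `w`; the lift given for `w` is corrected
        -- by the component of `g`.
        rcases Nat.eq_zero_or_pos N with rfl | hN
        · obtain ⟨a, ha⟩ := h₁ (k₁ + m) (k₁ + q) rfl rfl
          have hz : (δ q m g).v k₁ (k₁ + m) rfl = g.v k₁ (k₁ + q) rfl ≫ Y.d _ _ := by
            rw [δ_v q m hm g k₁ (k₁ + m) rfl (k₁ + q) (k₁ + 1) (by omega) rfl,
              hg _ _ _ (lt_add_one k₁), comp_zero, smul_zero, add_zero]
          have : ∃ a : X.X k₁ ⟶ Y.X (k₁ + q), a ≫ Y.d (k₁ + q) (k₁ + m) =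
              w'.v k₁ (k₁ + m) rfl := ⟨a - g.v k₁ (k₁ + q) rfl, by
            rw [Preadditive.sub_comp, ha, hw', Cochain.sub_v, hz]⟩
          have e : k₁ - ((0 : ℕ) : ℤ) = k₁ := by simp
          rwa [e]
        · refine hlift (k₁ - N) _ _ (by omega) rfl rfl _ ?_
          have := Cochain.congr_v hδ (k₁ - N) (k₁ - N + m + 1) (by ring)
          rwa [δ_v m (m + 1) rfl w' _ _ _ (k₁ - N + m) (k₁ - N + 1) (by ring) rfl,
            hg' _ _ _ (lt_add_one _), comp_zero, smul_zero, add_zero] at this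
      have hs (k k' : ℤ) (h : k + q = k') (hk : k₁ - N < k) : (Cochain.single a q).v k k' h = 0 :=
        Cochain.single_v_eq_zero a q k k' h hk.ne'
      refine ⟨g + Cochain.single a q, fun k k' h hk => ?_, fun k k' h hk => ?_⟩
      · rw [Cochain.add_v, hg k k' h hk, hs k k' h (by omega), add_zero]
      · rw [δ_add, ← sub_sub, Cochain.sub_v, ← hw',
          δ_v q m hm _ k k' h (k + q) (k + 1) (by omega) rfl,
          hs (k + 1) k' (by omega) (by push_cast at hk; omega),
          comp_zero, smul_zero, add_zero]
        rcases eq_or_ne k (k₁ - N) with rfl | hk'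
        · obtain rfl := h
          rw [Cochain.single_v, ha, sub_self]
        · rw [hs k _ rfl (by push_cast at hk; omega), zero_comp, sub_zero]
          exact hg' _ _ _ (by push_cast at hk; omega)
  -- After this many steps all source degrees above `b` are settled, and in the remaining ones `X`
  -- is zero.
  obtain ⟨g, hg, hg'⟩ := key (k₁ - b).toNat
  refine ⟨g, (sub_eq_zero.1 (Cochain.ext _ _ fun k k' h => ?_)).symm, hg⟩
  by_cases hk : k ≤ b
  · exact (hX k hk).eq_of_src _ _
  · exact hg' k k' h (by omega)

end

/-! ### Augmented complexes of modules -/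

theorem Module.Projective.exists_lift {R : Type u} [Ring R] {P M N : ModuleCat.{v} R}
    (hP : Module.Projective R P) (f : P ⟶ N) (g : M ⟶ N) (h : ∀ x, ∃ y, g y = f x) :
    ∃ a : P ⟶ M, a ≫ g = f := by
  obtain ⟨a, ha⟩ := Module.projective_lifting_property g.hom.rangeRestrict
    (f.hom.codRestrict (LinearMap.range g.hom) h) g.hom.surjective_rangeRestrict
  exact ⟨ModuleCat.ofHom a, ModuleCat.hom_ext (LinearMap.ext fun x =>
    congrArg Subtype.val (LinearMap.congr_fun ha x))⟩

/-- `ε` is an augmentation of a complex concentrated in nonpositive degrees which identifies the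
cohomology in degree `0`. -/
structure IsAugmentation {R : Type u} [Ring R] (Y : CochainComplex (ModuleCat.{v} R) ℤ)
    {S : ModuleCat.{v} R} (ε : Y.X 0 ⟶ S) : Prop where
  isZero : ∀ k, 0 < k → Limits.IsZero (Y.X k)
  surjective : Function.Surjective ε
  comp : ∀ k, Y.d k 0 ≫ ε = 0
  exists_of_eq_zero : ∀ y, ε y = 0 → ∃ z, Y.d (-1) 0 z = y

namespace IsAugmentation

open CochainComplex.HomComplex Limits

variable {R : Type u} [Ring R] {X Y : CochainComplex (ModuleCat.{v} R) ℤ} {S : ModuleCat.{v} R}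
  {ε : Y.X 0 ⟶ S}

/-- A morphism from a projective module to a module of cocycles lifts if the complex is exact. -/
theorem _root_.HomologicalComplex.ExactAt.exists_lift {k : ℤ} (hY : Y.ExactAt k)
    {P : ModuleCat.{v} R} (hP : Module.Projective R P) {l : ℤ} (hl : l + 1 = k) (φ : P ⟶ Y.X k)
    (hφ : φ ≫ Y.d k (k + 1) = 0) : ∃ a : P ⟶ Y.X l, a ≫ Y.d l k = φ := by
  rw [Y.exactAt_iff' l k (k + 1) (by simp; omega) (by simp),
    ShortComplex.moduleCat_exact_iff] at hY
  exact hP.exists_lift φ _ fun x => hY _ (by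
    exact congrArg (fun ψ : P ⟶ _ => ψ x) hφ)

/-- The top component of `w`, with target in degree 0, lifts by the augmentation, and the lower ones
lift by exactness. Exactness at k is needed only for b < k - m: a component of degree m ending at k
starts at k - m, where `X` is zero otherwise. This restriction allows a complex with further
cohomology at its lower end. -/
theorem exists_δ_eq_of_comp_eq_zero (hε : IsAugmentation Y ε) (hP : ∀ k, Module.Projective R (X.X k))
    {b : ℤ} (hX : ∀ k ≤ b, IsZero (X.X k)) {q m : ℤ} (hm : q + 1 = m)
    (hY : ∀ k < 0, b < k - m → Y.ExactAt k) (w : Cochain X Y m) (hw : δ m (m + 1) w = 0)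
    (hw₀ : w.v (-m) 0 (by omega) ≫ ε = 0) : ∃ g : Cochain X Y q, δ q m g = w := by
  obtain ⟨g, hg, -⟩ := exists_δ_eq hm w hw b (-m) hX
    (fun k k' h hk => (hε.isZero k' (by omega)).eq_of_tgt _ _)
    (fun k' k'' h h' => by
      obtain rfl : k' = 0 := by omega
      obtain rfl : k'' = -1 := by omega
      exact (hP _).exists_lift _ _ fun x => hε.exists_of_eq_zero _
        (congrArg (fun ψ : X.X (-m) ⟶ S => ψ x) hw₀))
    (fun k k' k'' hk h h' φ hφ => by
      by_cases hkb : k ≤ b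
      · exact ⟨0, (hX k hkb).eq_of_src _ _⟩
      · exact (hY k' (by omega) (by omega)).exists_lift (hP k) (by omega) φ hφ)
  exact ⟨g, hg⟩

/-- The prescribed map `ζ` is lifted to a cochain concentrated in source degree -q. By `hζ` the
remaining error has zero augmentation, and it is corrected by a cochain in source degrees at most -m
= -q - 1, which leaves the prescribed component unchanged. -/
theorem exists_δ_eq_and_comp_eq (hε : IsAugmentation Y ε) (hP : ∀ k, Module.Projective R (X.X k))
    {b : ℤ} (hX : ∀ k ≤ b, IsZero (X.X k)) (hY : ∀ k < 0, Y.ExactAt k) {q m : ℤ} (hm : q + 1 = m)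
    (w : Cochain X Y m) (hw : δ m (m + 1) w = 0) (ζ : X.X (-q) ⟶ S)
    (hζ : w.v (-m) 0 (by omega) ≫ ε = m.negOnePow • X.d (-m) (-q) ≫ ζ) :
    ∃ g : Cochain X Y q, δ q m g = w ∧ g.v (-q) 0 (by omega) ≫ ε = ζ := by
  obtain ⟨a, ha⟩ := (hP (-q)).exists_lift ζ ε fun x => hε.surjective _
  have hv : (δ q m (Cochain.single a q)).v (-m) 0 (by omega) =
      m.negOnePow • X.d (-m) (-q) ≫ a := by
    rw [δ_v q m hm _ (-m) 0 (by omega) (-1) (-q) (by omega) (by omega), Cochain.single_v,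
      Cochain.single_v_eq_zero _ _ _ _ _ (by omega), zero_comp, zero_add]
  obtain ⟨g, hg, hg'⟩ := exists_δ_eq hm (w - δ q m (Cochain.single a q))
    (by rw [δ_sub, hw, δ_δ, sub_zero]) b (-m) hX
    (fun k k' h hk => (hε.isZero k' (by omega)).eq_of_tgt _ _)
    (fun k' k'' h h' => by
      obtain rfl : k' = 0 := by omega
      obtain rfl : k'' = -1 := by omega
      have hz : (w - δ q m (Cochain.single a q)).v (-m) 0 h ≫ ε = 0 := by
        rw [Cochain.sub_v, Preadditive.sub_comp, hv, hζ, Linear.units_smul_comp, Category.assoc, ha,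
          sub_self]
      exact (hP _).exists_lift _ _ fun x => hε.exists_of_eq_zero _
        (congrArg (fun ψ : X.X (-m) ⟶ S => ψ x) hz))
    (fun k k' k'' hk h h' φ hφ => (hY k' (by omega)).exists_lift (hP k) (by omega) φ hφ)
  refine ⟨Cochain.single a q + g, by rw [δ_add, hg]; abel, ?_⟩
  rw [Cochain.add_v, hg' _ _ _ (by omega), Cochain.single_v, add_zero, ha]

/-- The identity of a complex with nonzero cohomology in degree `0` is not a coboundary. -/
theorem δ_ne_ofHom_id (hε : IsAugmentation Y ε) [Nontrivial S] (g : Cochain Y Y (-1)) :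
    δ (-1) 0 g ≠ Cochain.ofHom (𝟙 Y) := by
  intro h
  -- In degree 0 the identity would factor through the differential from degree -1, since the
  -- complex vanishes in degree 1; the augmentation, which kills boundaries, would then be zero.
  have h₀ := Cochain.congr_v h 0 0 (add_zero 0)
  rw [δ_v (-1) 0 (by norm_num) g 0 0 (add_zero 0) (-1) 1 (by norm_num) (by norm_num),
    (hε.isZero 1 one_pos).eq_of_tgt (Y.d 0 1) 0, zero_comp, smul_zero, add_zero,
    Cochain.ofHom_v, HomologicalComplex.id_f] at h₀
  have h₁ : ε = 0 := by
    rw [← Category.id_comp ε, ← h₀, Category.assoc, hε.comp, comp_zero]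
  obtain ⟨s, hs⟩ := exists_ne (0 : S)
  obtain ⟨y, rfl⟩ := hε.surjective s
  exact hs (by rw [h₁]; rfl)

end IsAugmentation

/-! ### Transport along functors to the unitally positive category of a minimal model -/

namespace AInfFunctor

variable {k : Type w₁} [Field k]

theorem map₁_bijective_of_isMinimal {C : AInfCat.{u, v} k} {D : AInfCat.{u', v'} k}
    (hC : C.IsMinimal) (hD : D.IsMinimal) (F : AInfFunctor C D) {x y : C.Obj} {p : ℤ}
    (h : Function.Bijective (F.cohomologyMap x y p)) : Function.Bijective (F.map₁ x y p) := by
  constructor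
  · refine (injective_iff_map_eq_zero _).2 fun f hf => ?_
    obtain ⟨f', hf'⟩ := (F.cohomologyMap_injective_iff x y p).1 h.1 f (hC _ _) 0
      ((_root_.map_zero _).trans hf.symm)
    rw [← hf']
    exact hC _ _
  · intro g
    obtain ⟨f, -, g', hg'⟩ := (F.cohomologyMap_surjective_iff x y p).1 h.2 g (hD _ _)
    exact ⟨f, sub_eq_zero.1 (hg'.symm.trans (hD _ _))⟩

end AInfFunctor

namespace MinimalModel

variable {k : Type w₁} [Field k] {C : UnitalAInfCat.{u, v} k}

/-- A morphism of nonpositive degree in the model is a cycle, and its image is cohomologous to a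
combination of units. As the inclusion is injective on cohomology and there are no nonzero
coboundaries in the model, the morphism equals the corresponding combination of units. -/
theorem isPositive (M : MinimalModel.{u, v, u', v', w₁} C)
    (hC : ∀ (x y : C.Obj) (p : ℤ), p ≤ 0 → ∀ f : C.Hom x y p, C.m₁ x y p (p + 1) f = 0 →
      ∃ e ∈ Submodule.span k {f : C.Hom x y p | C.IsOne f}, ∃ g, C.m₁ x y (p - 1) p g = f - e) :
    M.cat.IsPositive := by
  intro x y p f hp
  have hf : C.m₁ _ _ p (p + 1) (M.incl.map₁ x y p f) = 0 := by
    rw [M.incl.map₁_m₁ x y p (p + 1) rfl, show M.cat.m₁ x y p (p + 1) f = 0 from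
      M.isMinimal f _, map_zero]
  obtain ⟨e, he, g, hg⟩ := hC _ _ p hp _ hf
  obtain ⟨e, he', rfl⟩ := M.incl_unital.exists_mem_span_isOne M.incl_quasiIso.1.1 he
  obtain ⟨f', hf'⟩ := (M.incl.cohomologyMap_injective_iff x y p).1 (M.incl_quasiIso.2 x y p).1
    (f - e) (M.isMinimal _ _) g (by rw [hg, map_sub])
  rwa [sub_eq_zero.1 (hf'.symm.trans (M.isMinimal f' p))]

theorem one_ne_zero (M : MinimalModel.{u, v, u', v', w₁} C) (hC : C.UnitsNonexact) (x : M.cat.Obj) :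
    M.cat.one x ≠ 0 := fun h => hC (M.incl.obj x) 0 <| by
  rw [map_zero, ← M.incl_unital.map_one, h]
  exact (map_zero (M.incl.map₁ x x 0)).symm

/-- A functor inducing isomorphisms on cohomology in positive degrees yields a quasi-isomorphism
to the unitally positive category of a minimal model of its target, if the cohomology of its source
in nonpositive degrees is spanned by the units. -/
theorem exists_isQuasiIso_unitallyPositive {D : UnitalAInfCat.{u', v'} k}
    {Φ : AInfFunctor C.toAInfCat D.toAInfCat} (hΦ : Φ.IsStrictlyUnital)
    (hobj : Function.Bijective Φ.obj)
    (hmap : ∀ x y (p : ℤ), 0 < p → Function.Bijective (Φ.cohomologyMap x y p))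
    (hC : C.UnitsNonexact) (hD : D.UnitsNonexact)
    (hneg : ∀ (x y : C.Obj) (p : ℤ), p ≤ 0 → ∀ f : C.Hom x y p, C.m₁ x y p (p + 1) f = 0 →
      ∃ e ∈ Submodule.span k {f : C.Hom x y p | C.IsOne f}, ∃ g, C.m₁ x y (p - 1) p g = f - e)
    (M : MinimalModel.{u', v', u'', v'', w₁} D) :
    ∃ F : AInfFunctor C.toAInfCat M.cat.unitallyPositive, F.IsQuasiIso := by
  -- The detour through a minimal model of the source is needed because `C` itself may have many
  -- morphisms of nonpositive degree. Only `N → C → D → M` takes values in the positive part;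
  -- composing with `C → N` returns to `C`.
  obtain ⟨N⟩ := hC.nonempty_minimalModel
  have hG : (M.proj.comp (Φ.comp N.incl)).IsStrictlyUnital :=
    M.proj_unital.comp (hΦ.comp N.incl_unital)
  refine ⟨(AInfFunctor.positiveLift hG (N.isPositive hneg)).comp N.proj,
    (AInfFunctor.positiveLift_isQuasiIso hG (N.isPositive hneg) N.isMinimal M.isMinimal
      (M.proj_quasiIso.1.comp (hobj.comp N.incl_quasiIso.1)) (fun x y p hp => ?_)
      (M.one_ne_zero hD)).comp N.proj_quasiIso⟩
  refine AInfFunctor.map₁_bijective_of_isMinimal N.isMinimal M.isMinimal _ ?_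
  have e : ⇑((M.proj.comp (Φ.comp N.incl)).cohomologyMap x y p) =
      M.proj.cohomologyMap _ _ p ∘ Φ.cohomologyMap _ _ p ∘ N.incl.cohomologyMap x y p :=
    funext fun c => by
      rw [AInfFunctor.cohomologyMap_comp, AInfFunctor.cohomologyMap_comp]
      rfl
  rw [e]
  exact (M.proj_quasiIso.2 _ _ p).comp ((hmap _ _ p hp).comp (N.incl_quasiIso.2 x y p))

end MinimalModel

/-! ### Comparison of complexes of morphisms under an additive functor -/

namespace IsAugmentation

open CochainComplex.HomComplex Limits

variable {R : Type u} [Ring R] {X Y : CochainComplex (ModuleCat.{v} R) ℤ} {S T : ModuleCat.{v} R}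
  {ε : Y.X 0 ⟶ S}

theorem exists_desc (hε : IsAugmentation Y ε) (ψ : Y.X 0 ⟶ T) (hψ : Y.d (-1) 0 ≫ ψ = 0) :
    ∃ φ : S ⟶ T, ε ≫ φ = ψ := by
  have h : LinearMap.ker ε.hom ≤ LinearMap.ker ψ.hom := fun y hy => by
    obtain ⟨z, rfl⟩ := hε.exists_of_eq_zero y hy
    exact congrArg (fun f : Y.X (-1) ⟶ T => f z) hψ
  refine ⟨ModuleCat.ofHom (((LinearMap.ker ε.hom).liftQ ψ.hom h).comp
    (ε.hom.quotKerEquivOfSurjective hε.surjective).symm.toLinearMap), ModuleCat.hom_ext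
      (LinearMap.ext fun y => ?_)⟩
  refine (congrArg ((LinearMap.ker ε.hom).liftQ ψ.hom h)
    ((LinearEquiv.symm_apply_eq _).2 ?_)).trans ((LinearMap.ker ε.hom).liftQ_apply ψ.hom y)
  rfl

theorem δ_v_comp (hε : IsAugmentation Y ε) {p q : ℤ} (hq : q + 1 = p) (h : Cochain X Y q) :
    (δ q p h).v (-p) 0 (by omega) ≫ ε =
      p.negOnePow • X.d (-p) (-q) ≫ h.v (-q) 0 (by omega) ≫ ε := by
  rw [δ_v q p hq h (-p) 0 (by omega) (-1) (-q) (by omega) (by omega), Preadditive.add_comp,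
    Category.assoc, hε.comp, comp_zero, zero_add, Linear.units_smul_comp, Category.assoc]

/-- Cocycles of degree `0` are, up to coboundaries, determined by the induced morphisms of the
augmentations. -/
theorem exists_comp_eq {ε' : X.X 0 ⟶ T} (hε' : IsAugmentation X ε') (hε : IsAugmentation Y ε)
    (f : Cochain X Y 0) (hf : δ 0 1 f = 0) :
    ∃ φ : T ⟶ S, ε' ≫ φ = f.v 0 0 (add_zero 0) ≫ ε := by
  refine hε'.exists_desc _ ?_
  have h := Cochain.congr_v hf (-1) 0 (by norm_num)
  rw [δ_v 0 1 (by norm_num) f (-1) 0 (by norm_num) (-1) 0 (by norm_num) (by norm_num),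
    Cochain.zero_v, Int.negOnePow_one, Units.neg_smul, one_smul, ← sub_eq_add_neg, sub_eq_zero] at h
  rw [← Category.assoc, ← h, Category.assoc, hε.comp, comp_zero]

section Functor

variable {R' : Type u'} [Ring R'] (Φ : ModuleCat.{v} R ⥤ ModuleCat.{v'} R') [Φ.Additive]
  (hS : ∀ M : ModuleCat.{v} R, Function.Bijective (Φ.map : (M ⟶ S) → (Φ.obj M ⟶ Φ.obj S)))
  (hε : IsAugmentation Y ε)
  (hε' : IsAugmentation ((Φ.mapHomologicalComplex _).obj Y) (Φ.map ε))
  (hP : ∀ k, Module.Projective R (X.X k)) {b : ℤ} (hX : ∀ k ≤ b, IsZero (X.X k))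
  (hY : ∀ k < 0, Y.ExactAt k) {p q : ℤ} (hq : q + 1 = p)

include hS hε hε' hP hX hY hq

/-- Injectivity on cohomology. The augmented component of the bounding cochain `h` is a map into `Φ
S`, hence comes from a map `ζ` into `S`. Faithfulness on such maps turns δ h = Φ f into the
compatibility required to solve δ g = f with augmentation `ζ`. -/
theorem exists_δ_eq_of_map_eq (f : Cochain X Y p) (hf : δ p (p + 1) f = 0)
    (h : Cochain ((Φ.mapHomologicalComplex _).obj X) ((Φ.mapHomologicalComplex _).obj Y) q)
    (hh : δ q p h = f.map Φ) : ∃ g : Cochain X Y q, δ q p g = f := by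
  obtain ⟨ζ, hζ⟩ := (hS _).2 (h.v (-q) 0 (by omega) ≫ Φ.map ε)
  have e := hε'.δ_v_comp hq h
  rw [hh] at e
  obtain ⟨g, hg, -⟩ := hε.exists_δ_eq_and_comp_eq hP hX hY hq f hf ζ ((hS _).1 (by
    rw [Φ.map_comp, Φ.map_units_smul, Φ.map_comp, hζ]
    exact e))
  exact ⟨g, hg⟩

/-- Surjectivity on cohomology. The augmented component of `h` descends to a map `ζ`, and a cocycle
`f` with this augmentation is constructed over `R`. The difference Φ f - h has zero augmentation,
hence is a coboundary; only here is exactness of the image of `Y` used, and only in the restricted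
range. -/
theorem exists_map_sub_eq_δ (hP' : ∀ k, Module.Projective R' (Φ.obj (X.X k)))
    (hY' : ∀ k < 0, b < k - p → ((Φ.mapHomologicalComplex (ComplexShape.up ℤ)).obj Y).ExactAt k)
    (h : Cochain ((Φ.mapHomologicalComplex _).obj X) ((Φ.mapHomologicalComplex _).obj Y) p)
    (hh : δ p (p + 1) h = 0) : ∃ f : Cochain X Y p, δ p (p + 1) f = 0 ∧
      ∃ g : Cochain ((Φ.mapHomologicalComplex _).obj X) ((Φ.mapHomologicalComplex _).obj Y) q,
        δ q p g = f.map Φ - h := by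
  obtain ⟨ζ, hζ⟩ := (hS _).2 (h.v (-p) 0 (by omega) ≫ Φ.map ε)
  have e := hε'.δ_v_comp rfl h
  rw [hh, Cochain.zero_v] at e
  replace e := zero_comp.symm.trans e
  obtain ⟨f, hf, hfζ⟩ := hε.exists_δ_eq_and_comp_eq hP hX hY rfl (0 : Cochain X Y (p + 1))
    (δ_zero _ _) ζ ((hS _).1 (by
      rw [Cochain.zero_v, zero_comp, Φ.map_zero, Φ.map_units_smul, Φ.map_comp, hζ]
      exact e))
  have key {T : ModuleCat.{v'} R'}
      (ε' : ((Φ.mapHomologicalComplex (ComplexShape.up ℤ)).obj Y).X 0 ⟶ T) :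
      (f.map Φ - h).v (-p) 0 (by omega) ≫ ε' =
        (f.map Φ).v (-p) 0 (by omega) ≫ ε' - h.v (-p) 0 (by omega) ≫ ε' := by
    rw [Cochain.sub_v, Preadditive.sub_comp]
  refine ⟨f, hf, hε'.exists_δ_eq_of_comp_eq_zero hP' (b := b)
    (fun k hk => Φ.map_isZero (hX k hk)) hq hY' _ ?_ ?_⟩
  · rw [δ_sub, hh, δ_map, hf, Cochain.map_zero, sub_zero]
  · refine (key _).trans (sub_eq_zero.2 ?_)
    exact ((Φ.map_comp _ _).symm.trans (congrArg Φ.map hfζ)).trans hζ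

end Functor

/-- The augmentation of a resolution. -/
theorem of_quasiIso (hY : ∀ k, 0 < k → IsZero (Y.X k))
    (f : Y ⟶ (HomologicalComplex.single (ModuleCat.{v} R) (ComplexShape.up ℤ) 0).obj S) (hf : QuasiIso f) :
    IsAugmentation Y (f.f 0 ≫ (HomologicalComplex.singleObjXSelf (ComplexShape.up ℤ) 0 S).hom) := by
  have h := (quasiIsoAt_iff' f (-1) 0 1 (by simp) (by simp)).1 inferInstance
  rw [ShortComplex.quasiIso_iff_of_zeros' _ ((hY 1 one_pos).eq_of_tgt _ _)
    ((HomologicalComplex.isZero_single_obj_X (ComplexShape.up ℤ) 0 S (-1)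
      (by norm_num)).eq_of_src _ _)
    ((HomologicalComplex.isZero_single_obj_X (ComplexShape.up ℤ) 0 S 1
      (by norm_num)).eq_of_tgt _ _)] at h
  obtain ⟨h₁, h₂⟩ := h
  rw [ShortComplex.moduleCat_exact_iff] at h₁
  have h₂' : Epi (f.f 0) := h₂
  refine ⟨hY, ?_, fun k => ?_, fun y hy => ?_⟩
  · rw [← ModuleCat.epi_iff_surjective]
    infer_instance
  · rw [← Category.assoc, ← f.comm]
    simp
  · refine h₁ y ?_
    have := congrArg (HomologicalComplex.singleObjXSelf (ComplexShape.up ℤ) 0 S).inv hy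
    rw [map_zero] at this
    refine Eq.trans ?_ this
    simp
    rfl

theorem _root_.HomologicalComplex.exactAt_of_quasiIso_single {k : ℤ} (hk : k ≠ 0)
    (f : Y ⟶ (HomologicalComplex.single (ModuleCat.{v} R) (ComplexShape.up ℤ) 0).obj S) (hf : QuasiIso f) :
    Y.ExactAt k :=
  (quasiIsoAt_iff_exactAt' f k (HomologicalComplex.exactAt_single_obj _ _ _ _ hk)).1 inferInstance

end IsAugmentation

/-! ### Extension of scalars to `A / A e A` -/

section

open MulOpposite Limits

variable {A : Type u} [Ring A] (e : A)

theorem exists_mem_smulAeA {M N : Type v} [AddCommGroup M] [Module Aᵐᵒᵖ M] [AddCommGroup N]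
    [Module Aᵐᵒᵖ N] {f : M →ₗ[Aᵐᵒᵖ] N} (hf : Function.Surjective f) {n : N}
    (hn : n ∈ smulAeA e N) : ∃ m ∈ smulAeA e M, f m = n := by
  change n ∈ Submodule.map f (smulAeA e M)
  refine Submodule.span_le.2 ?_ hn
  rintro _ ⟨a, ha, n, rfl⟩
  obtain ⟨m, rfl⟩ := hf n
  exact ⟨op a • m, Submodule.subset_span ⟨a, ha, m, rfl⟩, f.map_smul _ _⟩

/-- Right exactness of the extension of scalars: an element of `Y_0` whose augmentation lies in S ·
AeA differs from a boundary by an element of Y_0 · AeA. -/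
theorem IsAugmentation.map_extScalars {Y : CochainComplex (ModuleCat.{v} Aᵐᵒᵖ) ℤ}
    {S : ModuleCat.{v} Aᵐᵒᵖ} {ε : Y.X 0 ⟶ S} (hε : IsAugmentation Y ε) :
    IsAugmentation (((extScalars e).mapHomologicalComplex (ComplexShape.up ℤ)).obj Y)
      ((extScalars e).map ε) where
  isZero k hk := (extScalars e).map_isZero (hε.isZero k hk)
  surjective s := by
    obtain ⟨s, rfl⟩ := Submodule.Quotient.mk_surjective _ s
    obtain ⟨y, rfl⟩ := hε.surjective s
    exact ⟨Submodule.Quotient.mk y, rfl⟩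
  comp k := ((extScalars e).map_comp _ _).symm.trans
    ((congrArg (extScalars e).map (hε.comp k)).trans ((extScalars e).map_zero _ _))
  exists_of_eq_zero y hy := by
    obtain ⟨y, rfl⟩ := Submodule.Quotient.mk_surjective _ y
    have h : ε y ∈ smulAeA e S := (Submodule.Quotient.mk_eq_zero _).1 hy
    obtain ⟨y', hy', h'⟩ := exists_mem_smulAeA e hε.surjective h
    obtain ⟨z, hz⟩ := hε.exists_of_eq_zero (y - y') (by
      rw [map_sub, sub_eq_zero]
      exact h'.symm)
    refine ⟨Submodule.Quotient.mk z, ?_⟩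
    refine Eq.trans (b := Submodule.Quotient.mk (Y.d (-1) 0 z)) rfl ?_
    rw [hz]
    refine (Submodule.Quotient.eq _).2 ?_
    simpa using hy'

/-- Linear maps to an `A_con`-module extend to the extension of scalars. -/
theorem exists_extScalars_desc {M : Type v} [AddCommGroup M] [Module Aᵐᵒᵖ M] {N : Type w₁}
    [AddCommGroup N] [Module (Acon e)ᵐᵒᵖ N] (f : M →+ N)
    (hf : ∀ (a : A) m, f (op a • m) = op (Ideal.Quotient.mk (idealAeA e) a) • f m) :
    ∃ g : ExtScalars e M →ₗ[(Acon e)ᵐᵒᵖ] N, ∀ m, g (Submodule.Quotient.mk m) = f m := by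
  have hz (m : M) (hm : m ∈ smulAeA e M) : f m = 0 := by
    induction hm using Submodule.span_induction with
    | zero => exact map_zero f
    | add x y _ _ hx hy => rw [map_add, hx, hy, add_zero]
    | smul a x _ hx => rw [← op_unop a, hf, hx, smul_zero]
    | mem x hx =>
      obtain ⟨a, ha, m, rfl⟩ := hx
      rw [hf, Ideal.Quotient.eq_zero_iff_mem.2 ha, MulOpposite.op_zero, zero_smul]
  let g : ExtScalars e M →+ N := QuotientAddGroup.lift (smulAeA e M).toAddSubgroup f hz
  refine ⟨{ g with map_smul' := fun r x => ?_ }, fun m => rfl⟩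
  obtain ⟨a, rfl⟩ := op_surjective r
  obtain ⟨a, rfl⟩ := Ideal.Quotient.mk_surjective a
  obtain ⟨m, rfl⟩ := Submodule.Quotient.mk_surjective _ x
  exact hf a m

/-- Extension of scalars is left adjoint to restriction. A surjection onto M / M · AeA is restricted
to `A`, the projection from `M` lifts through it, and the lift factors through the quotient because
its target is an `A_con`-module. -/
theorem projective_extScalars {M : Type v} [AddCommGroup M] [Module Aᵐᵒᵖ M]
    (hM : Module.Projective Aᵐᵒᵖ M) : Module.Projective (Acon e)ᵐᵒᵖ (ExtScalars e M) := by
  have key {N : Type (max u v)} [AddCommGroup N] [Module (Acon e)ᵐᵒᵖ N]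
      (f : N →ₗ[(Acon e)ᵐᵒᵖ] ExtScalars e M) (hf : Function.Surjective f) :
      ∃ h : ExtScalars e M →ₗ[(Acon e)ᵐᵒᵖ] N, f.comp h = .id := by
    let _ : Module Aᵐᵒᵖ N := Module.compHom N (RingHom.op (Ideal.Quotient.mk (idealAeA e)))
    let f' : N →ₗ[Aᵐᵒᵖ] ExtScalars e M :=
      { f with
        map_smul' := fun r x => by
          refine (f.map_smul (op (Ideal.Quotient.mk (idealAeA e) r.unop)) x).trans ?_
          obtain ⟨m, hm⟩ := Submodule.Quotient.mk_surjective _ (f x)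
          change _ = r • f x
          rw [← hm]
          rfl }
    obtain ⟨g, hg⟩ := Module.projective_lifting_property f' (Submodule.mkQ (smulAeA e M)) hf
    obtain ⟨h, hh⟩ := exists_extScalars_desc e g.toAddMonoidHom fun a m => g.map_smul (op a) m
    refine ⟨h, LinearMap.ext fun x => ?_⟩
    obtain ⟨m, rfl⟩ := Submodule.Quotient.mk_surjective _ x
    exact (congrArg f (hh m)).trans (LinearMap.congr_fun hg m)
  exact Module.Projective.of_lifting_property'' key

theorem mk_smulAeA_bijective {S : Type v} [AddCommGroup S] [Module Aᵐᵒᵖ S]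
    (hS : ∀ s : S, op e • s = 0) :
    Function.Bijective (Submodule.Quotient.mk : S → ExtScalars e S) := by
  have h : smulAeA e S = ⊥ := by
    refine Submodule.span_eq_bot.2 ?_
    rintro _ ⟨a, ha, s, rfl⟩
    induction ha using Submodule.span_induction generalizing s with
    | zero => rw [MulOpposite.op_zero, zero_smul]
    | add x y _ _ hx hy => rw [MulOpposite.op_add, add_smul, hx, hy, add_zero]
    | smul a x _ hx => rw [smul_eq_mul, op_mul, mul_smul, hx]
    | mem x hx =>
      obtain ⟨a, b, rfl⟩ := hx
      rw [op_mul, op_mul, mul_smul, mul_smul, hS, smul_zero]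
  refine ⟨fun s s' hs => ?_, Submodule.Quotient.mk_surjective _⟩
  have := (Submodule.Quotient.eq _).1 hs
  rwa [h, Submodule.mem_bot, sub_eq_zero] at this

/-- Modules annihilated by `e` are modules over `A_con`. -/
theorem extScalars_map_bijective {S : ModuleCat.{v} Aᵐᵒᵖ} (hS : ∀ s : S, op e • s = 0)
    (M : ModuleCat.{v} Aᵐᵒᵖ) :
    Function.Bijective ((extScalars e).map : (M ⟶ S) → ((extScalars e).obj M ⟶ _)) := by
  have hb := mk_smulAeA_bijective e hS
  constructor
  · intro f g h
    exact ModuleCat.hom_ext (LinearMap.ext fun m => hb.1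
      (congrArg (fun φ : (extScalars e).obj M ⟶ (extScalars e).obj S =>
        φ (Submodule.Quotient.mk m)) h))
  · intro φ
    let j := LinearEquiv.ofBijective (Submodule.mkQ (smulAeA e S)) hb
    let ψ : ExtScalars e M →ₗ[(Acon e)ᵐᵒᵖ] ExtScalars e S := φ.hom
    let φ' : M →ₗ[Aᵐᵒᵖ] ExtScalars e S :=
      { toFun := fun m => ψ (Submodule.Quotient.mk m)
        map_add' := fun m m' => ψ.map_add (Submodule.Quotient.mk m) (Submodule.Quotient.mk m')
        map_smul' := fun r m => by
          refine (ψ.map_smul (op (Ideal.Quotient.mk (idealAeA e) r.unop))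
            (Submodule.Quotient.mk m)).trans ?_
          obtain ⟨s, hs⟩ := hb.2 (ψ (Submodule.Quotient.mk m))
          change _ = r • ψ (Submodule.Quotient.mk m)
          rw [← hs]
          rfl }
    refine ⟨ModuleCat.ofHom (j.symm.toLinearMap.comp φ'), ModuleCat.hom_ext
      (LinearMap.ext fun x => ?_)⟩
    obtain ⟨m, rfl⟩ := Submodule.Quotient.mk_surjective _ x
    exact j.apply_symm_apply _

instance {k : Type w₁} [Field k] [Algebra k A] : (extScalars.{u, v} e).Linear k where
  map_smul {M N} f r := by
    refine ModuleCat.hom_ext (LinearMap.ext fun x => ?_)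
    obtain ⟨m, rfl⟩ := Submodule.Quotient.mk_surjective _ x
    rfl

end

/-! ### Schur's lemma -/

/-- If `a` is an eigenvalue of `f`, then `f - a` has a kernel and so vanishes on a simple module.
The eigenvalue exists by finite dimension and algebraic closedness. -/
theorem exists_eq_smul_id {k : Type w₁} [Field k] [IsAlgClosed k] {R : Type u} [Ring R]
    [Algebra k R] (S : ModuleCat.{v} R) [IsSimpleModule R S]
    (hS : letI := ModuleCat.moduleOfAlgebraModule (k := k) S; Module.Finite k S) (f : S ⟶ S) :
    ∃ a : k, f = a • 𝟙 S := by
  let _ := ModuleCat.moduleOfAlgebraModule (k := k) S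
  have := ModuleCat.isScalarTower_of_algebra_moduleCat (k := k) S
  have := hS
  have := IsSimpleModule.nontrivial R S
  obtain ⟨a, ha⟩ := Module.End.exists_eigenvalue (f.hom.restrictScalars k)
  obtain ⟨s, hs⟩ := ha.exists_hasEigenvector
  refine ⟨a, ?_⟩
  rcases (f - a • 𝟙 S).hom.bijective_or_eq_zero with h | h
  · refine absurd (h.1 (a₁ := s) (a₂ := 0) ?_) hs.2
    rw [map_zero]
    exact sub_eq_zero.2 hs.apply_eq_smul
  · exact sub_eq_zero.1 (ModuleCat.hom_ext h)

theorem eq_zero_of_isEmpty_iso {R : Type u} [Ring R] {S T : ModuleCat.{v} R} [IsSimpleModule R S]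
    [IsSimpleModule R T] (h : IsEmpty (S ≅ T)) (f : S ⟶ T) : f = 0 := by
  rcases f.hom.bijective_or_eq_zero with hf | hf
  · exact (h.false (LinearEquiv.ofBijective f.hom hf).toModuleIso).elim
  · exact ModuleCat.hom_ext hf

/-! ### Complexes of morphisms between projective resolutions -/

section

open CochainComplex.HomComplex

variable {k : Type w₁} [Field k] {R : Type u} [Ring R] [Algebra k R] {ι : Type u'}
  {K : ι → CochainComplex (ModuleCat.{v} R) ℤ} {S : ι → ModuleCat.{v} R}
  {ε : ∀ i, (K i).X 0 ⟶ S i}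

theorem homDG_unitsNonexact (hε : ∀ i, IsAugmentation (K i) (ε i)) (hS : ∀ i, Nontrivial (S i)) :
    (homDG k K).toAInf.UnitsNonexact := fun i f =>
  have := hS i
  (hε i).δ_ne_ofHom_id f

/-- The cohomology in nonpositive degrees of the complexes of morphisms between projective
resolutions is spanned by the units, if this holds for the morphisms between the modules. -/
theorem homDG_exists_mem_span_isOne (hε : ∀ i, IsAugmentation (K i) (ε i))
    (hP : ∀ i n, Module.Projective R ((K i).X n)) {b : ℤ}
    (hb : ∀ i, ∀ n ≤ b, Limits.IsZero ((K i).X n)) (hK : ∀ i, ∀ n < 0, (K i).ExactAt n)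
    (hend : ∀ i (f : S i ⟶ S i), ∃ a : k, f = a • 𝟙 (S i))
    (hhom : ∀ i j, i ≠ j → ∀ f : S i ⟶ S j, f = 0) (i j : (homDG k K).toAInf.Obj)
    (p : ℤ) (hp : p ≤ 0) (f : (homDG k K).toAInf.Hom i j p)
    (hf : (homDG k K).toAInf.m₁ i j p (p + 1) f = 0) :
    ∃ e ∈ Submodule.span k {f : (homDG k K).toAInf.Hom i j p | (homDG k K).toAInf.IsOne f},
      ∃ g, (homDG k K).toAInf.m₁ i j (p - 1) p g = f - e := by
  let f' : Cochain (K i) (K j) p := f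
  have hf' : δ p (p + 1) f' = 0 := hf
  have key (f : Cochain (K i) (K j) p) (hf : δ p (p + 1) f = 0)
      (hf₀ : f.v (-p) 0 (by omega) ≫ ε j = 0) :
      ∃ g : Cochain (K i) (K j) (p - 1), δ (p - 1) p g = f :=
    (hε j).exists_δ_eq_of_comp_eq_zero (hP i) (hb i) (by omega) (fun n hn _ => hK j n hn) f hf hf₀
  -- In negative degree p the component that meets the augmentation starts in degree -p > 0, where
  -- the resolution is zero.
  rcases hp.lt_or_eq with hp | rfl
  · refine ⟨0, Submodule.zero_mem _, ?_⟩
    obtain ⟨g, hg⟩ := key f' hf' (((hε i).isZero _ (by omega)).eq_of_src _ _)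
    exact ⟨g, hg.trans (sub_zero f').symm⟩
  -- A cocycle of degree 0 induces a map of the resolved modules. This map is a scalar or zero, and
  -- after subtracting that multiple of the unit the augmented component vanishes.
  obtain ⟨φ, hφ⟩ := (hε i).exists_comp_eq (hε j) f' hf'
  by_cases hij : i = j
  · subst hij
    obtain ⟨a, rfl⟩ := hend i φ
    refine ⟨a • Cochain.ofHom (𝟙 (K i)), Submodule.smul_mem _ a (Submodule.subset_span
      (UnitalAInfCat.IsOne.one (C := (homDG k K).toAInf) i)), key (f' - a • Cochain.ofHom (𝟙 (K i))) ?_ ?_⟩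
    · rw [δ_sub, δ_smul, hf', δ_ofHom, smul_zero, sub_zero]
    · refine Eq.trans (b := f'.v 0 0 (add_zero 0) ≫ ε i - (a • 𝟙 _) ≫ ε i)
        (Preadditive.sub_comp _ _ _) ?_
      rw [← hφ, Linear.comp_smul, Linear.smul_comp, Category.comp_id, Category.id_comp, sub_self]
  · obtain rfl := hhom i j hij φ
    refine ⟨0, Submodule.zero_mem _, ?_⟩
    obtain ⟨g, hg⟩ := key f' hf' (hφ.symm.trans Limits.comp_zero)
    exact ⟨g, hg.trans (sub_zero f').symm⟩

variable {R' : Type u} [Ring R'] [Algebra k R'] (Φ : ModuleCat.{v} R ⥤ ModuleCat.{v} R')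
  [Φ.Additive] [Φ.Linear k]

/-- Positivity of p enters only in surjectivity: b < n - p with p ≥ 1 implies b + 1 < n, so
cohomology of the image complexes in the lowest possible degree b + 1 is harmless. -/
theorem homDGMap_cohomologyMap_bijective (hε : ∀ i, IsAugmentation (K i) (ε i))
    (hε' : ∀ i, IsAugmentation ((Φ.mapHomologicalComplex (ComplexShape.up ℤ)).obj (K i))
      (Φ.map (ε i)))
    (hP : ∀ i n, Module.Projective R ((K i).X n))
    (hP' : ∀ i n, Module.Projective R' (Φ.obj ((K i).X n))) {b : ℤ}
    (hb : ∀ i, ∀ n ≤ b, Limits.IsZero ((K i).X n)) (hK : ∀ i, ∀ n < 0, (K i).ExactAt n)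
    (hK' : ∀ i, ∀ n < 0, b + 1 < n →
      ((Φ.mapHomologicalComplex (ComplexShape.up ℤ)).obj (K i)).ExactAt n)
    (hS : ∀ i (M : ModuleCat.{v} R), Function.Bijective
      (Φ.map : (M ⟶ S i) → (Φ.obj M ⟶ Φ.obj (S i)))) (i j : ι) (p : ℤ) (hp : 0 < p) :
    Function.Bijective ((homDGMap k Φ K).toAInf.cohomologyMap i j p) := by
  constructor
  · refine ((homDGMap k Φ K).toAInf.cohomologyMap_injective_iff i j p).2 fun f hf g hg => ?_
    exact IsAugmentation.exists_δ_eq_of_map_eq Φ (hS j) (hε j) (hε' j) (hP i) (hb i) (hK j)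
      (sub_add_cancel p 1) f hf g (hg.trans ((homDGMap k Φ K).toAInf_map₁ f))
  · refine ((homDGMap k Φ K).toAInf.cohomologyMap_surjective_iff i j p).2 fun g hg => ?_
    obtain ⟨f, hf, h, hh⟩ := IsAugmentation.exists_map_sub_eq_δ Φ (hS j) (hε j) (hε' j) (hP i) (hb i) (hK j)
      (sub_add_cancel p 1) (hP' i) (fun n hn hbn => hK' j n hn (by omega)) g hg
    exact ⟨f, hf, h, hh.trans (congrArg (· - g) ((homDGMap k Φ K).toAInf_map₁ f).symm)⟩

end

/-! ### The main theorem -/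

theorem theorem7 {A : Type u} [Ring A] [Algebra ℂ A] (e : A) (he : IsIdempotentElem e) (n t : ℕ)
    -- pairwise non-isomorphic finite-dimensional simple right `A`-modules, annihilated by `e`
    (S : Fin t → ModuleCat.{v} Aᵐᵒᵖ)
    (hS : ∀ j, IsSimpleModule Aᵐᵒᵖ (S j))
    (hSfin : ∀ j, letI := ModuleCat.moduleOfAlgebraModule (k := ℂ) (S j); Module.Finite ℂ (S j))
    (hSe : ∀ j, ∀ s : S j, MulOpposite.op e • s = 0)
    (hSiso : ∀ i j, i ≠ j → IsEmpty (S i ≅ S j))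
    -- complexes of finitely generated projective modules, in cohomological degrees `1 - n, …, 0`
    (Q : Fin t → CochainComplex (ModuleCat.{v} Aᵐᵒᵖ) ℤ)
    (hQproj : ∀ j k, Module.Projective Aᵐᵒᵖ ((Q j).X k))
    (hQfin : ∀ j k, Module.Finite Aᵐᵒᵖ ((Q j).X k))
    (hQzero : ∀ j (k : ℤ), k ≤ -n ∨ 0 < k → Limits.IsZero ((Q j).X k))
    -- `Q j` is a resolution of `S j`
    (hQres : ∀ j, ∃ ε : Q j ⟶ (CochainComplex.singleFunctor (ModuleCat.{v} Aᵐᵒᵖ) 0).obj (S j),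
      QuasiIso ε)
    -- the cohomology of `P j = i^* (Q j)` is `i^* (S j)` in degrees `0` and `1 - n`, zero elsewhere
    (hPtop : ∀ j, Nonempty ((extScalarsComplex e (Q j)).homology 0 ≅ (extScalars e).obj (S j)))
    (hPbot : ∀ j,
      Nonempty ((extScalarsComplex e (Q j)).homology (1 - n) ≅ (extScalars e).obj (S j)))
    (hPzero : ∀ j (k : ℤ), k ≠ 0 → k ≠ 1 - n →
      Limits.IsZero ((extScalarsComplex e (Q j)).homology k)) :
    -- the DG-category `(i, j) ↦ Hom(P i, P j)` has a strictly unital minimal model, and for each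
    -- of them there is an `A_∞`-quasi-isomorphism from `(i, j) ↦ Hom(Q i, Q j)` to the associated
    -- unitally positive `A_∞`-category
    Nonempty (MinimalModel.{0, v, 0, v, 0} (homDG ℂ fun j => extScalarsComplex e (Q j)).toAInf) ∧
      ∀ M : MinimalModel.{0, v, w₁, w₂, 0} (homDG ℂ fun j => extScalarsComplex e (Q j)).toAInf,
        ∃ F : AInfFunctor (homDG ℂ Q).toAInf.toAInfCat M.cat.unitallyPositive, F.IsQuasiIso := by
  have hQaug (j : Fin t) : ∃ ε : (Q j).X 0 ⟶ S j, IsAugmentation (Q j) ε := by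
    obtain ⟨ε, hε⟩ := hQres j
    exact ⟨_, IsAugmentation.of_quasiIso (S := S j) (fun k hk => hQzero j k (Or.inr hk)) ε (hf := hε)⟩
  choose ε hε using hQaug
  have hQexact (j : Fin t) (k : ℤ) (hk : k < 0) : (Q j).ExactAt k := by
    obtain ⟨ε, hε⟩ := hQres j
    exact HomologicalComplex.exactAt_of_quasiIso_single (S := S j) hk.ne ε (hf := hε)
  have hε' (j : Fin t) := (hε j).map_extScalars e
  have hSnt (j : Fin t) : Nontrivial (S j) := IsSimpleModule.nontrivial Aᵐᵒᵖ (S j)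
  have hSnt' (j : Fin t) : Nontrivial ((extScalars e).obj (S j)) :=
    (mk_smulAeA_bijective e (hSe j)).1.nontrivial
  have hunits : (homDG ℂ fun j => extScalarsComplex e (Q j)).toAInf.UnitsNonexact :=
    homDG_unitsNonexact hε' hSnt'
  refine ⟨hunits.nonempty_minimalModel, fun M => ?_⟩
  exact M.exists_isQuasiIso_unitallyPositive
    (homDGMap ℂ (extScalars e) Q).toAInf_isStrictlyUnital Function.bijective_id
    (homDGMap_cohomologyMap_bijective (extScalars e) hε hε' hQproj
      (fun j k => projective_extScalars e (hQproj j k)) (b := -n)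
      (fun j k hk => hQzero j k (Or.inl hk)) hQexact
      -- With b = -n, the second cohomology module of `P j` sits in degree b + 1 = 1 - n, which the
      -- condition b + 1 < k just excludes.
      (fun j k hk hk' => (HomologicalComplex.exactAt_iff_isZero_homology _ _).2
        (hPzero j k hk.ne (by omega)))
      fun j => extScalars_map_bijective e (hSe j))
    (homDG_unitsNonexact hε hSnt) hunits
    (homDG_exists_mem_span_isOne hε hQproj (b := -n) (fun j k hk => hQzero j k (Or.inl hk)) hQexact
      (fun j => exists_eq_smul_id (S j) (hSfin j))
      fun i j hij => eq_zero_of_isEmpty_iso (hSiso i j hij))
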